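/- **Setting.** Let $n\ge 1$, let $p_0,\dots,p_{2n}\in C^\infty(\mathbb R)$ be 1-periodic, let $0\le t_1<\dots<t_k<1$, and let $I_j,J_j:\mathbb R^2\to\mathbb R$ ($1\le j\le k$). Consider the impulsive Duffing equation $$\dot x=y,\quad \dot y=-x^{2n+1}-\sum_{i=0}^{2n}p_i(t)x^i\ \ (t\ne t_j),\qquad \Delta x(t_j)=I_j(x(t_j^-),y(t_j^-)),\quad \Delta y(t_j)=J_j(x(t_j^-),y(t_j^-)),$$ continued 1-periodically in time, with plane jump maps $\Phi_j(x,y)=(x+I_j(x,y),\,y+J_j(x,y))$ and Hamiltonian $h(x,y,t)=\frac12y^2+\frac1{2n+2}x^{2n+2}+\sum_{i=0}^{2n}\frac{p_i(t)}{i+1}x^{i+1}$. Let $(x_0,y_0)$ solve $\dot x=y$, $\dot y=-x^{2n+1}$ with $(x_0,y_0)(0)=(1,0)$, let $T_0$ be its minimal period, and put $\alpha=\frac1{n+2}$, $\beta=1-\alpha$, $c=\frac1{\alpha T_0}$. Let $\varphi_0(\lambda,\theta)=\big(c^\alpha\lambda^\alpha x_0(\theta T_0),\,c^\beta\lambda^\beta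 y_0(\theta T_0)\big)$ for $\lambda>0$, $\theta\in S^1=\mathbb R/\mathbb Z$, and $H(\lambda,\theta,t)=h(\varphi_0(\lambda,\theta),t)$. Put $a=\frac{2n+2}{n+2}$, $b=\frac{2n+1}{n+2}$, $\kappa=\frac{c^{2\beta}}{2n+2}$. Let $F(r)$ be the class of smooth functions $f(\lambda,\theta,t)$, 1-periodic in $\theta$ and $t$, such that $\lambda^{i-r}|\partial_\lambda^i\partial_\theta^m\partial_t^qf|$ is bounded for large $\lambda$, for all $i,m,q\ge 0$. Let $\psi_t(\mu,\phi)=(\mu+u(\mu,\phi,t),\ \phi+v(\mu,\phi,t))$, with $u\in F(1-(a-b))$ and $v\in F(-(a-b))$ defined for $\mu>\mu_*\ge 0$, be a symplectic diffeomorphism of $\{\mu>\mu_*\}\times S^1$ onto its image in $\{\lambda>0\}\times S^1$, with $\{\lambda\ge\mu_+\}\subset\psi_t(\{\mu\ge\mu_1\})\subset\{\lambda\ge\mu_-\}$ for all $t$ and some $0<\mu_-<\mu_1<\mu_+$, $\mu_1>\mu_*$, that transforms the Hamiltonian system of $H$ ($\dot\theta=\partial_\lambda H$, $\dot\lambda=-\partial_\theta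 H$) into that of $\hat H=\kappa\mu^a+\hat h_1(\mu,t)+\hat h_2(\mu,\phi,t)$, where $\hat h_1\in F(b)$ and $\hat h_2\in F(-\varepsilon_1)$ are defined for $\mu>\mu_*$ and $\varepsilon_1>2-a$. The transformed impulsive system on $\{\mu>\mu_*\}\times S^1$ is $\dot\phi=\partial_\mu\hat H$, $\dot\mu=-\partial_\phi\hat H$ for $t\ne t_j$, with jump maps $\Phi_j^*=(\varphi_0\circ\psi_{t_j})^{-1}\circ\Phi_j\circ(\varphi_0\circ\psi_{t_j})$. Its time-1 map is $$\Phi^1=P_k\circ\Phi_k^*\circ P_{k-1}\circ\dots\circ P_1\circ\Phi_1^*\circ P_0,$$ where $P_j$ is the flow map of $\hat H$ from $t_j$ to $t_{j+1}$ (with $t_0:=0$, $t_{k+1}:=1$). Each of these maps is taken on its natural domain: the points for which the orbit exists and stays in $\{\mu>\mu_*\}$. A map is called area-preserving if it is injective and preserves the area $d\mu\,d\phi$ of every measurable subset of its domain, and locally area-preserving if each point of its domain has a neighbourhood on which it is so. Let $A_{\mu_0}=\{\mu\ge\mu_0\}\times S^1$. **Lemma 5.2.** Assume that $I_j,J_j$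 ($1\le j\le k$) are of class $C^1$ and satisfy on $\mathbb R^2$ $$\frac{\partial I_j}{\partial x}+\frac{\partial J_j}{\partial y}+\frac{\partial I_j}{\partial x}\frac{\partial J_j}{\partial y}-\frac{\partial I_j}{\partial y}\frac{\partial J_j}{\partial x}=0 .$$ Then the flow maps $P_0,\dots,P_k$ are area-preserving, and the jump maps $\Phi_j^*$ and the time-1 map $\Phi^1$ are locally area-preserving. If moreover $|\Phi_j(x,y)|\to\infty$ as $|(x,y)|\to\infty$ for $1\le j\le k$ (which holds in particular if all $I_j$ and $J_j$ tend to $0$ at infinity), then: 1. the jump maps $\Phi_j^*$ and the time-1 map $\Phi^1$ are area-preserving; 2. $\Phi^1$ is defined on $A_{\mu_0}$ for all sufficiently large $\mu_0$; 3. for every $\mu_0$ such that $\Phi^1$ is defined on $A_{\mu_0}$, $\Phi^1$ has the intersection property on $A_{\mu_0}$: if $C$ is an embedded circle in $A_{\mu_0}$ that is homotopic in $A_{\mu_0}$ to a circle $\mu=\mathrm{const}$, then $\Phi^1(C)\cap C\ne\emptyset$. -/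

import Mathlib

open Set Filter Topology MeasureTheory
open scoped ContDiff

noncomputable section

namespace Duffing

/-- The data of the impulsive Duffing equation
`x'' + x^(2n+1) + ∑_{i ≤ 2n} p_i(t) x^i = 0` for `t ≠ t_j`,
`Δx(t_j) = I_j(x(t_j⁻), x'(t_j⁻))`, `Δx'(t_j) = J_j(x(t_j⁻), x'(t_j⁻))`.
Only the indices `i ≤ 2n` of `p` and `1 ≤ j ≤ k` of `t`, `I`, `J` are used: these are the impulses
of one period `[0, 1)`, and the others are their 1-periodic continuation. -/
structure ImpulsiveDuffing where
  n : ℕ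
  one_le_n : 1 ≤ n
  p : ℕ → ℝ → ℝ
  p_smooth : ∀ i ≤ 2 * n, ContDiff ℝ ∞ (p i)
  p_periodic : ∀ i ≤ 2 * n, Function.Periodic (p i) 1
  k : ℕ
  t : ℕ → ℝ
  t_mem : ∀ j, 1 ≤ j → j ≤ k → t j ∈ Ico (0 : ℝ) 1
  t_lt : ∀ i j, 1 ≤ i → i < j → j ≤ k → t i < t j
  I : ℕ → ℝ × ℝ → ℝ
  J : ℕ → ℝ × ℝ → ℝ

/-- The jump map `Φ_j : (x, y) ↦ (x + I_j(x, y), y + J_j(x, y))` of the plane. -/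
def ImpulsiveDuffing.jump (D : ImpulsiveDuffing) (j : ℕ) (w : ℝ × ℝ) : ℝ × ℝ :=
  (w.1 + D.I j w, w.2 + D.J j w)

/-- The differential condition on the jumps (with `I_j`, `J_j` of class `C¹`):
`∂I/∂x + ∂J/∂y + ∂I/∂x ∂J/∂y - ∂I/∂y ∂J/∂x = 0`. -/
def ImpulsiveDuffing.JumpCondition (D : ImpulsiveDuffing) : Prop :=
  ∀ j, 1 ≤ j → j ≤ D.k →
    ContDiff ℝ 1 (D.I j) ∧ ContDiff ℝ 1 (D.J j) ∧
    ∀ x y : ℝ,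
      deriv (fun s => D.I j (s, y)) x + deriv (fun s => D.J j (x, s)) y
        + deriv (fun s => D.I j (s, y)) x * deriv (fun s => D.J j (x, s)) y
        - deriv (fun s => D.I j (x, s)) y * deriv (fun s => D.J j (s, y)) x = 0

/-- The Hamiltonian of the equation without impulses, in the `(x, y)`-plane, `y = x'`. -/
def ImpulsiveDuffing.planeHam (D : ImpulsiveDuffing) (w : ℝ × ℝ) (t : ℝ) : ℝ :=
  w.2 ^ 2 / 2 + w.1 ^ (2 * D.n + 2) / (2 * D.n + 2)
    + ∑ i ∈ Finset.range (2 * D.n + 1), D.p i t * w.1 ^ (i + 1) / (i + 1)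

/-- `(x₀, y₀)` is the solution of `x' = y`, `y' = -x^(2n+1)` starting at `(1, 0)`, and `T₀` is its
minimal positive period. -/
structure IsReferenceSolution (n : ℕ) (x₀ y₀ : ℝ → ℝ) (T₀ : ℝ) : Prop where
  deriv_x : ∀ t, HasDerivAt x₀ (y₀ t) t
  deriv_y : ∀ t, HasDerivAt y₀ (-(x₀ t) ^ (2 * n + 1)) t
  x_zero : x₀ 0 = 1
  y_zero : y₀ 0 = 0
  period : IsLeast {T | 0 < T ∧ Function.Periodic x₀ T ∧ Function.Periodic y₀ T} T₀

/-- The exponent `α = 1 / (n + 2)`. -/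
def expα (n : ℕ) : ℝ := 1 / (n + 2)

/-- The exponent `β = 1 - α`. -/
def expβ (n : ℕ) : ℝ := 1 - expα n

/-- The constant `c = 1 / (α T₀)`. -/
def actionConst (n : ℕ) (T₀ : ℝ) : ℝ := 1 / (expα n * T₀)

/-- The action-angle map `φ₀ : (λ, θ) ↦ (c^α λ^α x₀(θ T₀), c^β λ^β y₀(θ T₀))`. -/
def actionAngle (n : ℕ) (x₀ y₀ : ℝ → ℝ) (T₀ : ℝ) (z : ℝ × ℝ) : ℝ × ℝ :=
  (actionConst n T₀ ^ expα n * z.1 ^ expα n * x₀ (z.2 * T₀),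
   actionConst n T₀ ^ expβ n * z.1 ^ expβ n * y₀ (z.2 * T₀))

/-- The Hamiltonian `H(λ, θ, t)` in action-angle variables. -/
def ImpulsiveDuffing.actionHam (D : ImpulsiveDuffing) (x₀ y₀ : ℝ → ℝ) (T₀ : ℝ) (l θ t : ℝ) : ℝ :=
  D.planeHam (actionAngle D.n x₀ y₀ T₀ (l, θ)) t

/-- The Hamiltonian vector field `(l', θ') = (-∂K/∂θ, ∂K/∂l)` of `K(l, θ, t)` at time `t`. -/
def hamField (K : ℝ → ℝ → ℝ → ℝ) (t : ℝ) (z : ℝ × ℝ) : ℝ × ℝ :=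
  (-deriv (fun θ => K z.1 θ t) z.2, deriv (fun l => K l z.2 t) z.1)

/-- The class `F(r)`: functions `f(l, θ, t)`, smooth for `l > l₀`, 1-periodic in `θ` and `t`, with
`l^(i-r) |∂_l^i ∂_θ^m ∂_t^q f|` bounded for large `l`, for all `i`, `m`, `q`. -/
def SymbolClass (r l₀ : ℝ) (f : ℝ → ℝ → ℝ → ℝ) : Prop :=
  ContDiffOn ℝ ∞ (fun q : ℝ × ℝ × ℝ => f q.1 q.2.1 q.2.2) {q | l₀ < q.1} ∧
  (∀ l θ t, l₀ < l → f l (θ + 1) t = f l θ t ∧ f l θ (t + 1) = f l θ t) ∧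
  ∀ i m q : ℕ, ∃ L C : ℝ, 0 < L ∧ l₀ ≤ L ∧ ∀ l θ t, L < l →
    l ^ ((i : ℝ) - r) *
      |iteratedDeriv i (fun l' => iteratedDeriv m (fun θ' => iteratedDeriv q
        (fun t' => f l' θ' t') t) θ) l| ≤ C

/-- The phase cylinder `ℝ × S¹` with coordinates (action, angle mod 1); its `volume` is the area
`dμ dφ`. -/
abbrev Cyl : Type := ℝ × UnitAddCircle

/-- Reduction of the angle mod 1. -/
def proj (z : ℝ × ℝ) : Cyl := (z.1, (z.2 : UnitAddCircle))

/-- The annulus `A_m = {μ ≥ m}` of the cylinder. -/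
def annulus (m : ℝ) : Set Cyl := {z | m ≤ z.1}

/-- The map `ψ_t(μ, φ) = (μ + u(μ, φ, t), φ + v(μ, φ, t))`, lifted to the universal covers. -/
def nearId (u v : ℝ → ℝ → ℝ → ℝ) (t : ℝ) (z : ℝ × ℝ) : ℝ × ℝ :=
  (z.1 + u z.1 z.2 t, z.2 + v z.1 z.2 t)

/-- The Hamiltonian `Ĥ = κ μ^a + h₁(μ, t) + h₂(μ, φ, t)`, with `a = 2β = (2n+2)/(n+2)` and
`κ = c^(2β) / (2n + 2)`. -/
def normalHam (n : ℕ) (T₀ : ℝ) (h₁ : ℝ → ℝ → ℝ) (h₂ : ℝ → ℝ → ℝ → ℝ) (m φ t : ℝ) : ℝ :=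
  actionConst n T₀ ^ (2 * expβ n) / (2 * n + 2) * m ^ (2 * expβ n) + h₁ m t + h₂ m φ t

/-- The map `ψ = nearId u v`, defined for `μ > μs`, is a symplectic diffeomorphism onto its image,
1-periodic in time, that transforms the Hamiltonian system of `H` (the Duffing equation without
impulses, in action-angle variables) into that of `Ĥ = κ μ^a + h₁ + h₂`,
with `u ∈ F(1-(a-b))`, `v ∈ F(-(a-b))`, `h₁ ∈ F(b)`, `h₂ ∈ F(-ε₁)` and `ε₁ > 2 - a`,
where `a = (2n+2)/(n+2)`, `b = (2n+1)/(n+2)`, so that `a - b = α`. -/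
structure IsNormalForm (D : ImpulsiveDuffing) (x₀ y₀ : ℝ → ℝ) (T₀ : ℝ)
    (u v : ℝ → ℝ → ℝ → ℝ) (h₁ : ℝ → ℝ → ℝ) (h₂ : ℝ → ℝ → ℝ → ℝ) (μs ε₁ : ℝ) : Prop where
  nonneg : 0 ≤ μs
  u_mem : SymbolClass (1 - expα D.n) μs u
  v_mem : SymbolClass (-expα D.n) μs v
  h₁_mem : SymbolClass ((2 * D.n + 1) / (D.n + 2)) μs (fun m _ t => h₁ m t)
  h₂_mem : SymbolClass (-ε₁) μs h₂
  lt_ε₁ : 2 - 2 * expβ D.n < ε₁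
  action_pos : ∀ t z, μs < z.1 → 0 < (nearId u v t z).1
  injective : ∀ t z z', μs < z.1 → μs < z'.1 →
    proj (nearId u v t z) = proj (nearId u v t z') → proj z = proj z'
  symplectic : ∀ t z, μs < z.1 → (fderiv ℝ (nearId u v t) z).det = 1
  annuli : ∃ μm μ₁ μp : ℝ, 0 < μm ∧ μm < μ₁ ∧ μ₁ < μp ∧ μs < μ₁ ∧ ∀ t,
    {z : ℝ × ℝ | μp ≤ z.1} ⊆ nearId u v t '' {z | μ₁ ≤ z.1} ∧
    nearId u v t '' {z | μ₁ ≤ z.1} ⊆ {z | μm ≤ z.1}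
  conj : ∀ t z, μs < z.1 →
    fderiv ℝ (fun q : ℝ × ℝ × ℝ => nearId u v q.2.2 (q.1, q.2.1)) (z.1, z.2, t)
      ((hamField (normalHam D.n T₀ h₁ h₂) t z).1, (hamField (normalHam D.n T₀ h₁ h₂) t z).2, 1)
      = hamField (D.actionHam x₀ y₀ T₀) t (nearId u v t z)

/-- `w` is reached at time `t` by the solution, with values in `{μ > μs}`, of the Hamiltonian system
of `K` that starts in `z` at time `s`. (This is the graph of the flow map from `s` to `t`.) -/
def flowRel (K : ℝ → ℝ → ℝ → ℝ) (μs s t : ℝ) (z w : Cyl) : Prop :=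
  ∃ γ : ℝ → ℝ × ℝ,
    (∀ τ ∈ Icc s t, μs < (γ τ).1 ∧ HasDerivWithinAt γ (hamField K τ (γ τ)) (Icc s t) τ) ∧
    proj (γ s) = z ∧ proj (γ t) = w

/-- The graph of the `j`-th jump map in the coordinates `(μ, φ)`: the jump map `Φ_j` of the plane
conjugated by `φ₀ ∘ ψ_{t_j}`, `ψ = nearId u v`. -/
def jumpRel (D : ImpulsiveDuffing) (x₀ y₀ : ℝ → ℝ) (T₀ : ℝ) (u v : ℝ → ℝ → ℝ → ℝ) (μs : ℝ)
    (j : ℕ) (z w : Cyl) : Prop :=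
  ∃ ζ η : ℝ × ℝ, μs < ζ.1 ∧ μs < η.1 ∧ proj ζ = z ∧ proj η = w ∧
    actionAngle D.n x₀ y₀ T₀ (nearId u v (D.t j) η)
      = D.jump j (actionAngle D.n x₀ y₀ T₀ (nearId u v (D.t j) ζ))

/-- The initial time of the `j`-th impulse-free interval, `0 ≤ j ≤ k`: `0, t_1, …, t_k`. -/
def ImpulsiveDuffing.tStart (D : ImpulsiveDuffing) (j : ℕ) : ℝ := if j = 0 then 0 else D.t j

/-- The final time of the `j`-th impulse-free interval, `0 ≤ j ≤ k`: `t_1, …, t_k, 1`. -/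
def ImpulsiveDuffing.tEnd (D : ImpulsiveDuffing) (j : ℕ) : ℝ := if j = D.k then 1 else D.t (j + 1)

/-- The graph of the time 1 map `Φ¹ = P_k ∘ Φ*_k ∘ ⋯ ∘ P_1 ∘ Φ*_1 ∘ P_0` of the impulsive Hamiltonian
system in the coordinates `(μ, φ)`, where `P_j` is the flow map over the `j`-th impulse-free interval
and `Φ*_j` is the `j`-th jump map. -/
def timeOneRel (D : ImpulsiveDuffing) (x₀ y₀ : ℝ → ℝ) (T₀ : ℝ) (u v : ℝ → ℝ → ℝ → ℝ)
    (h₁ : ℝ → ℝ → ℝ) (h₂ : ℝ → ℝ → ℝ → ℝ) (μs : ℝ) (z w : Cyl) : Prop :=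
  ∃ a b : ℕ → Cyl, a 0 = z ∧ b D.k = w ∧
    (∀ j ≤ D.k, flowRel (normalHam D.n T₀ h₁ h₂) μs (D.tStart j) (D.tEnd j) (a j) (b j)) ∧
    ∀ j < D.k, jumpRel D x₀ y₀ T₀ u v μs (j + 1) (b j) (a (j + 1))

/-- The domain of the partial map with graph `R`. -/
def dom (R : Cyl → Cyl → Prop) : Set Cyl := {z | ∃ w, R z w}

/-- The image of `S` under the partial map with graph `R`. -/
def image (R : Cyl → Cyl → Prop) (S : Set Cyl) : Set Cyl := {w | ∃ z ∈ S, R z w}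

/-- `R` is on `A` the graph of an injective map that preserves the area of all measurable sets. -/
def IsAreaPreservingOn (R : Cyl → Cyl → Prop) (A : Set Cyl) : Prop :=
  (∀ z ∈ A, ∃! w, R z w) ∧
  (∀ z ∈ A, ∀ z' ∈ A, ∀ w, R z w → R z' w → z = z') ∧
  ∀ S ⊆ A, MeasurableSet S → MeasurableSet (image R S) ∧ volume (image R S) = volume S

/-- The map with graph `R` is area-preserving near every point of its domain. -/
def IsLocallyAreaPreserving (R : Cyl → Cyl → Prop) : Prop :=
  ∀ z ∈ dom R, ∃ U ∈ 𝓝 z, IsAreaPreservingOn R (dom R ∩ U)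

/-- The circle `μ = m` in the annulus `A_{μ₀}`, `m ≥ μ₀`. -/
def coreCircle {μ₀ m : ℝ} (hm : μ₀ ≤ m) : C(UnitAddCircle, annulus μ₀) where
  toFun s := ⟨(m, s), hm⟩
  continuous_toFun := by fun_prop

/-- The intersection property on `A_{μ₀}`: every embedded circle `C` in `A_{μ₀}` that is homotopic in
`A_{μ₀}` to a circle `μ = const` meets its image. -/
def IntersectionProperty (R : Cyl → Cyl → Prop) (μ₀ : ℝ) : Prop :=
  ∀ c : C(UnitAddCircle, annulus μ₀), IsEmbedding c →
    (∃ (m : ℝ) (hm : μ₀ ≤ m), c.Homotopic (coreCircle hm)) →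
    (image R (range fun s => (c s : Cyl)) ∩ range fun s => (c s : Cyl)).Nonempty

end Duffing

end

/-! The idea is to transport everything to the `(x, y)`-plane by the charts `φ₀ ∘ ψ_t` (`chart`), which
are injective, continuous and area-preserving on `{μ > μ_*}`. The chart at time `t` maps solutions of
the normal form to solutions of the Duffing equation, and it conjugates the `j`-th jump map to the
plane jump map; by periodicity the charts at the times `0` and `1` agree. So each relation of the
theorem is a restriction of a map of the whole plane (`IsChartOf`), and the statements about area
follow from properties of the plane maps (`isAreaPreservingOn_of_isChartOf`):

* The Duffing equation has a trace-free right-hand side, and its Hamiltonian plus a constant is a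
  coercive function that grows at most exponentially along solutions. Its flow maps are therefore
  homeomorphisms of the plane that are differentiable with determinant `1` (`IsTame.exists_flow`).
* The condition on the jumps says that the plane jump maps have determinant `1`, so they are local
  homeomorphisms that locally preserve area. If they tend to infinity at infinity, they are coverings
  of the plane, hence homeomorphisms (`bijective_of_tendsto_cocompact`).

The time 1 map is defined for large actions because the action changes by a bounded amount along the
normal form, `∂h₂/∂φ` being bounded (`exists_flowRel`), and because the jumps map a neighbourhood of
infinity into any given one, while the chart covers a neighbourhood of infinity (`exists_jumpRel`).

For the intersection property, let `f` be the plane curve of an embedded circle and `G` the plane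
homeomorphism of the time 1 map. A homotopy in the annulus shows that `f` winds around the origin.
So does `G ∘ f`, since `G` maps no point of the annulus to the origin and since a circle of large
action encloses the point that `G` maps to the origin. So the origin is enclosed by both curves, while
the regions enclosed by `f` and by `G ∘ f` have the same area: if the curves were disjoint, one region
would be contained in the interior of the other (`range_inter_range_nonempty`). Winding around a point
is expressed by the absence of a continuous logarithm (`HasLog`), and the enclosed region is the curve
together with the points that it winds around (`filled`); this needs no Jordan curve theorem, and
applies to every closed curve. -/

noncomputable section

namespace Duffing

/-! ### Logarithms of plane loops and filled curves -/

/-- The map `f` into `ℂ` is the exponential of a continuous map. For a loop `f` in `ℂ ∖ {0}` this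
says that its winding number around `0` vanishes. -/
def HasLog {X : Type*} [TopologicalSpace X] (f : X → ℂ) : Prop :=
  ∃ g : X → ℂ, Continuous g ∧ ∀ x, Complex.exp (g x) = f x

theorem HasLog.of_norm_sub_lt {X : Type*} [TopologicalSpace X] {f f' : X → ℂ}
    (hf : HasLog f) (hf' : Continuous f') (h : ∀ x, ‖f' x - f x‖ < ‖f x‖) : HasLog f' := by
  obtain ⟨g, hg, hgf⟩ := hf
  have hne : ∀ x, f x ≠ 0 := fun x => hgf x ▸ Complex.exp_ne_zero _
  have hfc : Continuous f := by
    have : f = fun x => Complex.exp (g x) := funext fun x => (hgf x).symm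
    rw [this]; fun_prop
  have hsl : ∀ x, f' x / f x ∈ Complex.slitPlane := by
    intro x
    have h1 : ‖(f' x - f x) / f x‖ < 1 := by
      rw [norm_div, div_lt_one (norm_pos_iff.2 (hne x))]; exact h x
    have h2 := Complex.mem_slitPlane_of_norm_lt_one h1
    have h3 : 1 + (f' x - f x) / f x = f' x / f x := by
      field_simp [hne x]; ring
    rwa [h3] at h2
  refine ⟨fun x => g x + Complex.log (f' x / f x), ?_, fun x => ?_⟩
  · exact hg.add ((hf'.div hfc hne).clog hsl)
  · rw [Complex.exp_add, hgf, Complex.exp_log (Complex.slitPlane_ne_zero (hsl x))]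
    field_simp [hne x]

theorem hasLog_const {X : Type*} [TopologicalSpace X] {c : ℂ} (hc : c ≠ 0) :
    HasLog (fun _ : X => c) :=
  ⟨fun _ => Complex.log c, continuous_const, fun _ => Complex.exp_log hc⟩

/-- Along a family of maps into `ℂ ∖ {0}`, having a logarithm is an open and closed condition on
the parameter. -/
theorem hasLog_iff_of_family {X Y : Type*} [TopologicalSpace X] [CompactSpace X]
    [TopologicalSpace Y] {S : Set Y} (hS : IsPreconnected S) (H : Y → X → ℂ)
    (hH : ContinuousOn (Function.uncurry H) (S ×ˢ univ)) (h0 : ∀ y ∈ S, ∀ x, H y x ≠ 0)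
    {y y' : Y} (hy : y ∈ S) (hy' : y' ∈ S) : HasLog (H y) ↔ HasLog (H y') := by
  have : PreconnectedSpace S := isPreconnected_iff_preconnectedSpace.1 hS
  let K : S → X → ℂ := fun y => H y
  have hK : Continuous (Function.uncurry K) := by
    have := hH.comp_continuous (f := fun q : S × X => ((q.1 : Y), q.2)) (by fun_prop)
      (fun q => ⟨q.1.2, mem_univ _⟩)
    exact this
  have hKy : ∀ y, Continuous (K y) := fun y => hK.comp (by fun_prop : Continuous fun x => (y, x))
  have key : ∀ y : S, ∀ᶠ z in 𝓝 y, HasLog (K z) ↔ HasLog (K y) := by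
    intro y
    have hloc : ∀ᶠ z in 𝓝 y, ∀ x ∈ (univ : Set X),
        ‖K z x - K y x‖ < ‖K y x‖ ∧ ‖K y x - K z x‖ < ‖K z x‖ := by
      refine isCompact_univ.eventually_forall_of_forall_eventually fun x _ => ?_
      have c1 : Continuous fun q : S × X => ‖K q.1 q.2 - K y q.2‖ :=
        (hK.sub ((hKy y).comp continuous_snd)).norm
      have c2 : Continuous fun q : S × X => ‖K y q.2‖ := ((hKy y).comp continuous_snd).norm
      have c3 : Continuous fun q : S × X => ‖K q.1 q.2‖ := hK.norm
      have c4 : Continuous fun q : S × X => ‖K y q.2 - K q.1 q.2‖ :=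
        (((hKy y).comp continuous_snd).sub hK).norm
      have hpos : 0 < ‖K y x‖ := norm_pos_iff.2 (h0 y y.2 x)
      exact ((isOpen_lt c1 c2).inter (isOpen_lt c4 c3)).mem_nhds (by simpa using hpos)
    filter_upwards [hloc] with z hz
    exact ⟨fun h => h.of_norm_sub_lt (hKy y) fun x => (hz x (mem_univ x)).2,
      fun h => h.of_norm_sub_lt (hKy z) fun x => (hz x (mem_univ x)).1⟩
  have hlc : IsLocallyConstant fun z : S => HasLog (K z) := by
    rw [IsLocallyConstant.iff_eventually_eq]
    intro z
    filter_upwards [key z] with w hw using propext hw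
  exact iff_of_eq (hlc.apply_eq_of_isPreconnected isPreconnected_univ
    (mem_univ (⟨y, hy⟩ : S)) (mem_univ (⟨y', hy'⟩ : S)))

/-- The plane with coordinates `(x, y)` as the complex plane. -/
def toComplex (w : ℝ × ℝ) : ℂ := Complex.equivRealProdCLM.symm w

theorem continuous_toComplex : Continuous toComplex := Complex.equivRealProdCLM.symm.continuous

theorem toComplex_sub (w z : ℝ × ℝ) : toComplex (w - z) = toComplex w - toComplex z :=
  map_sub Complex.equivRealProdCLM.symm w z

theorem toComplex_eq_zero {w : ℝ × ℝ} : toComplex w = 0 ↔ w = 0 := by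
  unfold toComplex; simp

/-- The set enclosed by the curve `f`, together with the curve itself: the points around which `f`
has a non-zero winding number are those `p` for which `f - p` has no logarithm. -/
def filled {X : Type*} [TopologicalSpace X] (f : X → ℝ × ℝ) : Set (ℝ × ℝ) :=
  range f ∪ {p | ¬ HasLog fun x => toComplex (f x - p)}

section filled

variable {X : Type*} [TopologicalSpace X] [CompactSpace X] {f : X → ℝ × ℝ}

/-- Whether `f` winds around a point depends only on the component of the point off the curve. -/
theorem hasLog_sub_iff (hf : Continuous f) {S : Set (ℝ × ℝ)} (hS : IsPreconnected S)
    (hSf : Disjoint S (range f)) {p q : ℝ × ℝ} (hp : p ∈ S) (hq : q ∈ S) :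
    (HasLog fun x => toComplex (f x - p)) ↔ HasLog fun x => toComplex (f x - q) := by
  refine hasLog_iff_of_family hS (fun p x => toComplex (f x - p)) ?_ ?_ hp hq
  · refine (continuous_toComplex.comp ?_).continuousOn
    fun_prop
  · intro y hy x h
    rw [toComplex_eq_zero, sub_eq_zero] at h
    exact (disjoint_left.1 hSf) hy ⟨x, h⟩

theorem eventually_hasLog_sub_iff (hf : Continuous f) {p : ℝ × ℝ} (hp : p ∉ range f) :
    ∀ᶠ q in 𝓝 p, q ∉ range f ∧
      ((HasLog fun x => toComplex (f x - q)) ↔ HasLog fun x => toComplex (f x - p)) := by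
  have ho : IsOpen (range f)ᶜ := (isCompact_range hf).isClosed.isOpen_compl
  obtain ⟨ε, hε, hb⟩ := Metric.isOpen_iff.1 ho p hp
  filter_upwards [Metric.ball_mem_nhds p hε] with q hq
  exact ⟨hb hq, hasLog_sub_iff hf (convex_ball p ε).isPreconnected
    (disjoint_left.2 fun z hz hz' => hb hz hz') hq (Metric.mem_ball_self hε)⟩

/-- Off the curve, both the points that it winds around and the others form open sets; this gives the
topological properties of the filled curve. -/
theorem isClosed_filled (hf : Continuous f) : IsClosed (filled f) := by
  rw [← isOpen_compl_iff, isOpen_iff_mem_nhds]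
  intro p hp
  simp only [filled, compl_union, mem_inter_iff, mem_compl_iff, mem_ofPred_eq, not_not] at hp
  filter_upwards [eventually_hasLog_sub_iff hf hp.1] with q hq
  simp only [filled, compl_union, mem_inter_iff, mem_compl_iff, mem_ofPred_eq, not_not]
  exact ⟨hq.1, hq.2.2 hp.2⟩

theorem frontier_filled_subset (hf : Continuous f) : frontier (filled f) ⊆ range f := by
  intro p hp
  by_contra hpf
  rw [(isClosed_filled hf).frontier_eq] at hp
  refine hp.2 (mem_interior_iff_mem_nhds.2 ?_)
  have hp' : ¬ HasLog fun x => toComplex (f x - p) := hp.1.resolve_left hpf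
  filter_upwards [eventually_hasLog_sub_iff hf hpf] with q hq
  exact Or.inr fun h => hp' (hq.2.1 h)

theorem isCompact_filled (hf : Continuous f) : IsCompact (filled f) := by
  obtain ⟨C, hC⟩ := (((isCompact_range hf).image continuous_toComplex).isBounded).exists_norm_le
  have hsub : filled f ⊆ toComplex ⁻¹' Metric.closedBall 0 C := by
    rintro p (⟨x, rfl⟩ | hp)
    · simpa using hC _ ⟨f x, ⟨x, rfl⟩, rfl⟩
    · by_contra hpC
      simp only [mem_preimage, mem_closedBall_zero_iff, not_le] at hpC
      refine hp ((hasLog_const (X := X) (c := -toComplex p) ?_).of_norm_sub_lt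
        (continuous_toComplex.comp (hf.sub continuous_const)) fun x => ?_)
      · rw [neg_ne_zero]
        intro h0
        rcases isEmpty_or_nonempty X with hX | ⟨⟨x⟩⟩
        · exact hp ⟨fun _ => 0, continuous_const, fun x => hX.elim x⟩
        · have := hC _ ⟨f x, ⟨x, rfl⟩, rfl⟩
          rw [h0, norm_zero] at hpC
          exact absurd (norm_nonneg (toComplex (f x))) (by linarith)
      · rw [toComplex_sub, sub_neg_eq_add, sub_add_cancel, norm_neg]
        exact (hC _ ⟨f x, ⟨x, rfl⟩, rfl⟩).trans_lt hpC
  refine IsCompact.of_isClosed_subset ?_ (isClosed_filled hf) hsub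
  exact Complex.equivRealProdCLM.symm.toHomeomorph.isCompact_preimage.2 (isCompact_closedBall _ _)

/-- A loop around `p` with a logarithm contracts in the complement of `p`, hence so does its image
under a homeomorphism `G` in the complement of `G p`. -/
theorem hasLog_comp_homeomorph (G : (ℝ × ℝ) ≃ₜ (ℝ × ℝ)) {p : ℝ × ℝ}
    (h : HasLog fun x => toComplex (f x - p)) :
    HasLog fun x => toComplex (G (f x) - G p) := by
  obtain ⟨g, hg, hgf⟩ := h
  let e := Complex.equivRealProdCLM
  have he : ∀ w, e (toComplex w) = w := fun w => e.apply_symm_apply w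
  let H : ℝ → X → ℂ := fun s x => toComplex (G (p + e (Complex.exp (s * g x))) - G p)
  have hne : ∀ s x, H s x ≠ 0 := by
    intro s x h0
    rw [toComplex_eq_zero, sub_eq_zero, G.injective.eq_iff, add_eq_left,
      map_eq_zero_iff e e.injective] at h0
    exact Complex.exp_ne_zero _ h0
  have hc : Continuous (Function.uncurry H) := by
    refine continuous_toComplex.comp ((G.continuous.comp (continuous_const.add
      (e.continuous.comp ?_))).sub continuous_const)
    fun_prop
  have h1 : H 1 = fun x => toComplex (G (f x) - G p) := by
    funext x
    have : p + e (Complex.exp (((1 : ℝ) : ℂ) * g x)) = f x := by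
      rw [Complex.ofReal_one, one_mul, hgf, he]; abel
    simp only [H, this]
  have h0 : HasLog (H 0) := by
    have : H 0 = fun x => toComplex (G (p + e 1) - G p) := by
      funext x; simp [H]
    rw [this]
    refine hasLog_const ?_
    rw [Ne, toComplex_eq_zero, sub_eq_zero, G.injective.eq_iff, add_eq_left,
      map_eq_zero_iff e e.injective]
    exact one_ne_zero
  rw [← h1]
  exact (hasLog_iff_of_family isPreconnected_univ H hc.continuousOn (fun s _ x => hne s x)
    (mem_univ 0) (mem_univ 1)).1 h0

theorem filled_comp_homeomorph (G : (ℝ × ℝ) ≃ₜ (ℝ × ℝ)) : filled (G ∘ f) = G '' filled f := by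
  ext q
  obtain ⟨p, rfl⟩ := G.surjective q
  rw [G.injective.mem_set_image]
  refine or_congr ?_ (not_congr ⟨fun h => ?_, fun h => hasLog_comp_homeomorph G h⟩)
  · simp [mem_range, G.injective.eq_iff]
  · simpa using hasLog_comp_homeomorph (f := G ∘ f) G.symm (p := G p) h

end filled

theorem subset_interior_or_disjoint {E : Type*} [TopologicalSpace E] {A K : Set E}
    (hA : IsPreconnected A) (hK : Disjoint A (frontier K)) :
    A ⊆ interior K ∨ Disjoint A K := by
  have h := hA.subset_or_subset (u := interior K) (v := (closure K)ᶜ) isOpen_interior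
    isClosed_closure.isOpen_compl
    (disjoint_left.2 fun x hx hx' => hx' (subset_closure (interior_subset hx)))
    (fun x hx => by
      by_contra hcon
      simp only [mem_union, mem_compl_iff, not_or, not_not] at hcon
      exact disjoint_left.1 hK hx ⟨hcon.2, hcon.1⟩)
  exact h.imp id fun h => disjoint_left.2 fun x hx hx' => h hx (subset_closure hx')

theorem not_isClopen_of_isCompact {K : Set (ℝ × ℝ)} (hK : IsCompact K) (hne : K.Nonempty)
    (hf : frontier K = ∅) : False := by
  rcases isClopen_iff.1 (isClopen_iff_frontier_eq_empty.2 hf) with h | h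
  · exact hne.ne_empty h
  · rw [h] at hK
    exact noncompact_univ (ℝ × ℝ) hK

theorem volume_lt_of_subset_interior {K L : Set (ℝ × ℝ)} (hL : IsCompact L)
    (hne : L.Nonempty) (h : L ⊆ interior K) : volume L < volume K := by
  have hne' : (interior K \ L).Nonempty := by
    rw [nonempty_iff_ne_empty]
    intro h0
    have hLK : L = interior K := h.antisymm (sdiff_eq_empty.1 h0)
    refine not_isClopen_of_isCompact hL hne (isClopen_iff_frontier_eq_empty.1 ⟨hL.isClosed, ?_⟩)
    rw [hLK]; exact isOpen_interior
  have hpos : 0 < volume (interior K \ L) :=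
    (isOpen_interior.sdiff hL.isClosed).measure_pos _ hne'
  calc volume L < volume L + volume (interior K \ L) :=
        ENNReal.lt_add_right hL.measure_lt_top.ne hpos.ne'
    _ = volume (L ∪ (interior K \ L)) :=
        (measure_union disjoint_sdiff_right
          (isOpen_interior.measurableSet.diff hL.measurableSet)).symm
    _ ≤ volume K := measure_mono (union_subset (h.trans interior_subset)
        (sdiff_subset.trans interior_subset))

/-- Two compact plane sets of the same area that overlap cannot have disjoint connected
boundaries. -/
theorem boundaries_meet {K K' A A' : Set (ℝ × ℝ)} (hK : IsCompact K) (hK' : IsCompact K')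
    (hA : frontier K ⊆ A) (hA' : frontier K' ⊆ A') (hAc : IsPreconnected A)
    (hAc' : IsPreconnected A') (hvol : volume K' = volume K) (hne : (K ∩ K').Nonempty) :
    (A' ∩ A).Nonempty := by
  by_contra hcon
  have hd : Disjoint A A' := by
    rw [disjoint_comm, disjoint_iff_inter_eq_empty]
    exact not_nonempty_iff_eq_empty.1 hcon
  -- `L` cannot lie in the interior of `M` by the equality of the areas.
  have aux : ∀ {L M B B' : Set (ℝ × ℝ)}, IsCompact L → frontier L ⊆ B →
      frontier M ⊆ B' → B ⊆ interior M → Disjoint B' L → L.Nonempty →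
      volume L = volume M → False := by
    intro L M B B' hL hB hB' hBM hB'L hLne hv
    refine (volume_lt_of_subset_interior hL hLne ?_).ne hv
    -- the part of `L` outside the interior of `M` has no boundary
    by_contra hsub
    obtain ⟨x, hxL, hxM⟩ := not_subset.1 hsub
    refine not_isClopen_of_isCompact (hL.diff isOpen_interior) ⟨x, hxL, hxM⟩
      (subset_empty_iff.1 ?_)
    rw [sdiff_eq]
    refine (frontier_inter_subset _ _).trans ?_
    rintro y (⟨h1, h2⟩ | ⟨h1, h2⟩)
    · rw [isOpen_interior.isClosed_compl.closure_eq] at h2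
      exact h2 (hBM (hB h1))
    · rw [frontier_compl] at h2
      rw [hL.isClosed.closure_eq] at h1
      exact disjoint_left.1 hB'L (hB' (frontier_interior_subset h2)) h1
  rcases subset_interior_or_disjoint hAc (K := K') (hd.mono_right hA') with h1 | h1 <;>
    rcases subset_interior_or_disjoint hAc' (K := K)
      (hd.symm.mono_right hA) with h2 | h2
  · refine not_isClopen_of_isCompact (hK.union hK') (hne.mono fun x hx => Or.inl hx.1)
      (subset_empty_iff.1 ((frontier_union_subset _ _).trans ?_))
    rintro y (⟨h3, h4⟩ | ⟨h3, h4⟩)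
    · rw [closure_compl] at h4
      exact h4 (h1 (hA h3))
    · rw [closure_compl] at h3
      exact h3 (h2 (hA' h4))
  · exact aux hK hA hA' h1 h2 (hne.mono fun x hx => hx.1) hvol.symm
  · exact aux hK' hA' hA h2 h1 (hne.mono fun x hx => hx.2) hvol
  · refine not_isClopen_of_isCompact (hK.inter hK') hne
      (subset_empty_iff.1 ((frontier_inter_subset _ _).trans ?_))
    rw [hK.isClosed.closure_eq, hK'.isClosed.closure_eq]
    rintro y (⟨h3, h4⟩ | ⟨h3, h4⟩)
    · exact disjoint_left.1 h1 (hA h3) h4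
    · exact disjoint_left.1 h2 (hA' h4) h3

/-- A closed plane curve meets its image under an area-preserving homeomorphism if both of them
enclose a common point. -/
theorem range_inter_range_nonempty {X : Type*} [TopologicalSpace X] [CompactSpace X]
    [PreconnectedSpace X] {f : X → ℝ × ℝ} (hf : Continuous f) (G : (ℝ × ℝ) ≃ₜ (ℝ × ℝ))
    (hG : ∀ K, IsCompact K → volume (G '' K) = volume K) {p : ℝ × ℝ}
    (h1 : ¬ HasLog fun x => toComplex (f x - p))
    (h2 : ¬ HasLog fun x => toComplex (G (f x) - p)) :
    (range (G ∘ f) ∩ range f).Nonempty := by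
  have hGf : Continuous (G ∘ f) := G.continuous.comp hf
  refine boundaries_meet (isCompact_filled hf) (isCompact_filled hGf)
    (frontier_filled_subset hf) (frontier_filled_subset hGf) (isPreconnected_range hf)
    (isPreconnected_range hGf) ?_ ⟨p, Or.inr h1, Or.inr h2⟩
  rw [filled_comp_homeomorph]
  exact hG _ (isCompact_filled hf)

/-! ### Proper local homeomorphisms of the plane -/

/-- Over a simply connected base, a proper local homeomorphism with connected total space is
injective and surjective, since it is a covering map and so has a section through any point. -/
theorem bijective_of_tendsto_cocompact {f : ℝ × ℝ → ℝ × ℝ}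
    (hf : IsLocalHomeomorph f) (hp : Tendsto f (cocompact (ℝ × ℝ)) (cocompact (ℝ × ℝ))) :
    Function.Bijective f := by
  have hprop : IsProperMap f := isProperMap_iff_tendsto_cocompact.2 ⟨hf.continuous, hp⟩
  have hcov : IsCoveringMap f := by
    rw [isCoveringMap_iff_isCoveringMapOn_univ]
    refine hprop.isClosedMap.isCoveringMapOn_of_isLocalHomeomorphOn (fun x _ => ?_)
      (by simpa [isLocalHomeomorph_iff_isLocalHomeomorphOn_univ] using hf)
    refine (hprop.isCompact_preimage isCompact_singleton).finite ?_
    refine IsDiscrete.of_openPartialHomeomorph f subset_rfl fun e _ => ?_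
    obtain ⟨φ, h1, h2⟩ := hf e
    exact ⟨φ, h1, h2.symm⟩
  obtain ⟨s, ⟨hs0, hs⟩, -⟩ :=
    hcov.existsUnique_continuousMap_lifts (ContinuousMap.id (ℝ × ℝ)) (f 0) 0 rfl
  have hs' : ∀ y, f (s y) = y := fun y => congrFun hs y
  refine ⟨Function.LeftInverse.injective (g := s) fun x => ?_, fun y => ⟨s y, hs' y⟩⟩
  refine congrFun (hcov.eq_of_comp_eq (g₁ := s ∘ f) (g₂ := id) (s.continuous.comp hf.continuous)
    continuous_id ?_ 0 hs0) x
  funext x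
  exact hs' (f x)

/-! ### Flows of plane vector fields with trace-free derivative -/

theorem continuousLinearMap_prod_apply (L : ℝ × ℝ →L[ℝ] ℝ × ℝ) (h : ℝ × ℝ) :
    L h = h.1 • L (1, 0) + h.2 • L (0, 1) := by
  rw [← map_smul, ← map_smul, ← map_add]
  congr 1
  ext <;> simp

theorem det_prod_eq (L : ℝ × ℝ →L[ℝ] ℝ × ℝ) :
    L.det = (L (1, 0)).1 * (L (0, 1)).2 - (L (0, 1)).1 * (L (1, 0)).2 := by
  rw [ContinuousLinearMap.det, ← LinearMap.det_toMatrix (Module.Basis.finTwoProd ℝ),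
    Matrix.det_fin_two]
  simp [LinearMap.toMatrix_apply]

/-- A bounded field that is Lipschitz in space has solutions over the whole time interval. -/
theorem exists_isIntegralCurveOn_of_bounded {E : Type*} [NormedAddCommGroup E] [NormedSpace ℝ E]
    [CompleteSpace E] {F : ℝ → E → E} {a b : ℝ} (hab : a ≤ b) {K : NNReal} {L : ℝ}
    (hK : ∀ t ∈ Icc a b, LipschitzWith K (F t)) (hc : ∀ x, ContinuousOn (fun t => F t x) (Icc a b))
    (hL : ∀ t ∈ Icc a b, ∀ x, ‖F t x‖ ≤ L) (x : E) :
    ∃ γ : ℝ → E, γ a = x ∧ IsIntegralCurveOn γ F (Icc a b) := by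
  have hL0 : 0 ≤ L := (norm_nonneg _).trans (hL a (left_mem_Icc.2 hab) x)
  let L' : NNReal := ⟨L, hL0⟩
  let d : NNReal := ⟨b - a, sub_nonneg.2 hab⟩
  have hP : IsPicardLindelof F (⟨a, left_mem_Icc.2 hab⟩ : Icc a b) x (L' * d) 0 L' K :=
    { lipschitzOnWith := fun t ht => (hK t ht).lipschitzOnWith
      continuousOn := fun x _ => hc x
      norm_le := fun t ht x _ => hL t ht x
      mul_max_le := by
        rw [sub_self, max_eq_left (sub_nonneg.2 hab), NNReal.coe_zero, sub_zero]
        exact le_rfl }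
  exact hP.exists_eq_forall_mem_Icc_hasDerivWithinAt (Metric.mem_closedBall_self le_rfl)

theorem hasDerivWithinAt_Ici_of_Icc {E : Type*} [NormedAddCommGroup E]
    [NormedSpace ℝ E] {γ : ℝ → E} {g : E} {a b t : ℝ} (h : HasDerivWithinAt γ g (Icc a b) t)
    (ht : t ∈ Ico a b) : HasDerivWithinAt γ g (Ici t) t :=
  h.mono_of_mem_nhdsWithin (Icc_mem_nhdsGE_of_mem ht)

/-- The nearest-point retraction, coordinate by coordinate, of the plane to the sup norm ball of
radius `R`. -/
def clamp (R : ℝ) (w : ℝ × ℝ) : ℝ × ℝ := (max (-R) (min w.1 R), max (-R) (min w.2 R))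

theorem lipschitzWith_clamp (R : ℝ) : LipschitzWith 1 (clamp R) := by
  have h := (((LipschitzWith.prod_fst (α := ℝ) (β := ℝ)).min_const R).const_max (-R)).prodMk
    (((LipschitzWith.prod_snd (α := ℝ) (β := ℝ)).min_const R).const_max (-R))
  rw [max_self] at h
  exact h

theorem norm_clamp_le {R : ℝ} (hR : 0 ≤ R) (w : ℝ × ℝ) : ‖clamp R w‖ ≤ R := by
  simp only [clamp, Prod.norm_def, Real.norm_eq_abs, max_le_iff, abs_le]
  refine ⟨⟨le_max_left _ _, ?_⟩, le_max_left _ _, ?_⟩ <;>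
  exact ⟨(neg_nonpos.2 hR).trans hR, min_le_right _ _⟩

theorem clamp_of_norm_le {R : ℝ} {w : ℝ × ℝ} (hw : ‖w‖ ≤ R) : clamp R w = w := by
  simp only [Prod.norm_def, Real.norm_eq_abs, max_le_iff, abs_le] at hw
  ext <;> simp [clamp, hw]

theorem norm_clamp_le_norm {R : ℝ} (hR : 0 ≤ R) (w : ℝ × ℝ) : ‖clamp R w‖ ≤ ‖w‖ := by
  have h := (lipschitzWith_clamp R).dist_le_mul w 0
  have h0 : clamp R 0 = 0 := clamp_of_norm_le (by simpa using hR)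
  simpa [h0] using h

/-- A trace-free plane field that is `C¹` and complete over `[a, b]`, completeness being witnessed
by a positive coercive function `V` that grows and decays at most exponentially on solutions. -/
structure IsTame (F : ℝ → ℝ × ℝ → ℝ × ℝ) (a b : ℝ) : Prop where
  contDiff : ContDiff ℝ 1 (Function.uncurry F)
  trace : ∀ t w, (fderiv ℝ (F t) w (1, 0)).1 + (fderiv ℝ (F t) w (0, 1)).2 = 0
  lyapunov : ∃ (V : ℝ × ℝ × ℝ → ℝ) (C : ℝ), ContDiff ℝ 1 V ∧
    (∀ t ∈ Icc a b, ∀ w, 0 < V (t, w) ∧ |fderiv ℝ V (t, w) (1, F t w)| ≤ C * V (t, w)) ∧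
    ∀ B, ∃ R, ∀ t ∈ Icc a b, ∀ w, V (t, w) ≤ B → ‖w‖ ≤ R

namespace IsTame

variable {F : ℝ → ℝ × ℝ → ℝ × ℝ} {a b : ℝ}

theorem reverse (h : IsTame F a b) : IsTame (fun t w => -F (a + b - t) w) a b where
  contDiff := by
    have := h.contDiff.comp (by fun_prop : ContDiff ℝ 1 fun q : ℝ × ℝ × ℝ => (a + b - q.1, q.2))
    exact this.neg
  trace t w := by
    rw [fderiv_fun_neg]
    have := h.trace (a + b - t) w
    simp only [_root_.neg_apply, Prod.fst_neg, Prod.snd_neg]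
    linarith
  lyapunov := by
    obtain ⟨V, C, hV, hV', hR⟩ := h.lyapunov
    have hmem : ∀ t ∈ Icc a b, a + b - t ∈ Icc a b := fun t ht => ⟨by linarith [ht.2], by
      linarith [ht.1]⟩
    refine ⟨fun q => V (a + b - q.1, q.2), C, hV.comp (by fun_prop), fun t ht w =>
      ⟨(hV' _ (hmem t ht) w).1, ?_⟩, fun B => ?_⟩
    · have hd : HasFDerivAt (fun q : ℝ × ℝ × ℝ => (a + b - q.1, q.2))
          ((-ContinuousLinearMap.fst ℝ ℝ (ℝ × ℝ)).prod (ContinuousLinearMap.snd ℝ ℝ (ℝ × ℝ)))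
          (t, w) := by
        refine HasFDerivAt.prodMk ?_ hasFDerivAt_snd
        simpa using (hasFDerivAt_fst (𝕜 := ℝ) (p := (t, w))).const_sub (a + b)
      have hc := ((hV.differentiable one_ne_zero).differentiableAt
        (x := (a + b - t, w))).hasFDerivAt.comp (t, w) hd
      have he : fderiv ℝ (fun q : ℝ × ℝ × ℝ => V (a + b - q.1, q.2)) (t, w) = _ := hc.fderiv
      rw [he]
      have := (hV' _ (hmem t ht) w).2
      rw [← abs_neg, ← map_neg] at this
      simpa using this
    · obtain ⟨R, hR⟩ := hR B
      exact ⟨R, fun t ht w hw => hR _ (hmem t ht) w hw⟩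

theorem continuous_fderiv (h : IsTame F a b) :
    Continuous fun q : ℝ × ℝ × ℝ => fderiv ℝ (F q.1) q.2 :=
  (ContDiff.fderiv (m := 1) (n := 0) (f := fun q : ℝ × ℝ × ℝ => F q.1) (g := fun q => q.2)
    (h.contDiff.comp (by fun_prop :
      ContDiff ℝ 1 fun q : (ℝ × ℝ × ℝ) × ℝ × ℝ => (q.1.1, q.2))) contDiff_snd (by simp)).continuous

theorem hasFDerivAt (h : IsTame F a b) (t : ℝ) (w : ℝ × ℝ) :
    HasFDerivAt (F t) (fderiv ℝ (F t) w) w := by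
  have hF : ContDiff ℝ 1 (F t) := h.contDiff.comp (by fun_prop : ContDiff ℝ 1 fun w => (t, w))
  exact ((hF.differentiable one_ne_zero) w).hasFDerivAt

theorem exists_lipschitzOnWith (h : IsTame F a b) (R : ℝ) :
    ∃ K : NNReal, ∀ t ∈ Icc a b, LipschitzOnWith K (F t) (Metric.closedBall 0 R) := by
  obtain ⟨K, hK⟩ := ((isCompact_Icc (a := a) (b := b)).prod
    (isCompact_closedBall (0 : ℝ × ℝ) R)).exists_bound_of_continuousOn h.continuous_fderiv.continuousOn
  refine ⟨K.toNNReal, fun t ht => Convex.lipschitzOnWith_of_nnnorm_fderiv_le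
    (fun w _ => (h.hasFDerivAt t w).differentiableAt) (fun w hw => ?_) (convex_closedBall _ _)⟩
  exact NNReal.coe_le_coe.1 ((hK (t, w) ⟨ht, hw⟩).trans (Real.le_coe_toNNReal K))

/-- The a priori bound that `V` gives for a curve which solves the equation as long as it stays in
a large ball. The curve may solve a modified equation outside the ball, which serves to construct
solutions by truncating the field; the bound is uniform near `w₀`. -/
theorem exists_bound (h : IsTame F a b) (w₀ : ℝ × ℝ) : ∃ R, 0 ≤ R ∧ ∀ᶠ w in 𝓝 w₀,
    ∀ γ g : ℝ → ℝ × ℝ, γ a = w → (∀ t ∈ Icc a b, HasDerivWithinAt γ (g t) (Icc a b) t) →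
      (∀ t ∈ Icc a b, ‖γ t‖ ≤ R → g t = F t (γ t)) → ∀ t ∈ Icc a b, ‖γ t‖ ≤ R := by
  obtain ⟨V, C, hV, hV', hR⟩ := h.lyapunov
  have hVc : Continuous fun w => V (a, w) := hV.continuous.comp (by fun_prop)
  set B := V (a, w₀) + 1 with hB
  obtain ⟨R, hR⟩ := hR (B * Real.exp ((|C| + 1) * (b - a)))
  refine ⟨max R 0, le_max_right _ _, ?_⟩
  filter_upwards [(hVc.tendsto w₀).eventually (gt_mem_nhds (lt_add_one _))] with w hw γ g hγa hγ hg
  have hE : ∀ t ∈ Icc a b, HasDerivWithinAt (fun t => V (t, γ t))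
      (fderiv ℝ V (t, γ t) (1, g t)) (Icc a b) t := fun t ht =>
    ((hV.differentiable one_ne_zero) (t, γ t)).hasFDerivAt.comp_hasDerivWithinAt t
      ((hasDerivWithinAt_id t _).prodMk (hγ t ht))
  have hBd : ∀ t, HasDerivAt (fun t => B * Real.exp ((|C| + 1) * (t - a)))
      (B * (Real.exp ((|C| + 1) * (t - a)) * ((|C| + 1) * 1))) t := fun t =>
    ((((hasDerivAt_id t).sub_const a).const_mul (|C| + 1)).exp).const_mul B
  intro t₁ ht₁
  have hBpos : 0 < B := by
    have := (hV' a ⟨le_rfl, ht₁.1.trans ht₁.2⟩ w₀).1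
    linarith
  have hBle : ∀ t ∈ Icc a b, B * Real.exp ((|C| + 1) * (t - a)) ≤
      B * Real.exp ((|C| + 1) * (b - a)) := by
    intro t ht
    have := ht.2
    gcongr
  -- the rate `|C| + 1 > C` makes `V` grow strictly slower than the barrier wherever they meet
  have key := image_le_of_deriv_right_lt_deriv_boundary
    (f := fun t => V (t, γ t)) (f' := fun t => fderiv ℝ V (t, γ t) (1, g t))
    (a := a) (b := b) (fun t ht => (hE t ht).continuousWithinAt)
    (fun t ht => hasDerivWithinAt_Ici_of_Icc (hE t (Ico_subset_Icc_self ht)) ht)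
    (B := fun t => B * Real.exp ((|C| + 1) * (t - a)))
    (B' := fun t => B * (Real.exp ((|C| + 1) * (t - a)) * ((|C| + 1) * 1)))
    (by simpa [hγa] using hw.le) hBd (fun t ht hEq => by
      have ht' := Ico_subset_Icc_self ht
      have hgt : g t = F t (γ t) := hg t ht' ((hR t ht' _ (hEq.trans_le (hBle t ht'))).trans
        (le_max_left _ _))
      have h1 := (hV' t ht' (γ t)).2
      have h2 := (hV' t ht' (γ t)).1
      rw [hgt]
      have h3 : C * V (t, γ t) ≤ |C| * V (t, γ t) := by gcongr; exact le_abs_self C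
      have h4 := le_abs_self (fderiv ℝ V (t, γ t) (1, F t (γ t)))
      have h5 : B * (Real.exp ((|C| + 1) * (t - a)) * ((|C| + 1) * 1))
        = (|C| + 1) * V (t, γ t) := by rw [hEq]; ring
      rw [h5]
      linarith)
  exact (hR t₁ ht₁ _ ((key ht₁).trans (hBle t₁ ht₁))).trans (le_max_left _ _)

theorem exists_isIntegralCurveOn (h : IsTame F a b) (hab : a ≤ b) (w : ℝ × ℝ) :
    ∃ γ : ℝ → ℝ × ℝ, γ a = w ∧ IsIntegralCurveOn γ F (Icc a b) := by
  obtain ⟨R, hR0, hR⟩ := h.exists_bound w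
  obtain ⟨K, hK⟩ := h.exists_lipschitzOnWith R
  obtain ⟨L, hL⟩ := ((isCompact_Icc (a := a) (b := b)).prod
    (isCompact_closedBall (0 : ℝ × ℝ) R)).exists_bound_of_continuousOn h.contDiff.continuous.continuousOn
  have hcl : ∀ w, clamp R w ∈ Metric.closedBall 0 R := fun w => by
    simpa using norm_clamp_le hR0 w
  obtain ⟨γ, hγa, hγ⟩ := exists_isIntegralCurveOn_of_bounded (F := fun t w => F t (clamp R w)) hab
    (K := K * 1) (L := L) (fun t ht => by
      rw [← lipschitzOnWith_univ]
      exact (hK t ht).comp (lipschitzWith_clamp R).lipschitzOnWith (fun w _ => hcl w))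
    (fun w => (h.contDiff.continuous.comp (by fun_prop : Continuous fun t =>
      (t, clamp R w))).continuousOn)
    (fun t ht w => hL (t, clamp R w) ⟨ht, hcl w⟩) w
  refine ⟨γ, hγa, fun t ht => ?_⟩
  have hb := hR.self_of_nhds γ _ hγa hγ (fun t _ hle => by simp only [clamp_of_norm_le hle]) t ht
  have := hγ t ht
  simp only [clamp_of_norm_le hb] at this
  exact this

theorem eqOn_of_isIntegralCurveOn (h : IsTame F a b) {γ₁ γ₂ : ℝ → ℝ × ℝ}
    (h₁ : IsIntegralCurveOn γ₁ F (Icc a b)) (h₂ : IsIntegralCurveOn γ₂ F (Icc a b))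
    (heq : γ₁ a = γ₂ a) : EqOn γ₁ γ₂ (Icc a b) := by
  obtain ⟨R₁, hR₁⟩ := isCompact_Icc.exists_bound_of_continuousOn h₁.continuousOn
  obtain ⟨R₂, hR₂⟩ := isCompact_Icc.exists_bound_of_continuousOn h₂.continuousOn
  obtain ⟨K, hK⟩ := h.exists_lipschitzOnWith (max R₁ R₂)
  refine ODE_solution_unique_of_mem_Icc_right (v := F)
    (s := fun _ => Metric.closedBall 0 (max R₁ R₂)) (K := K)
    (fun t ht => hK t (Ico_subset_Icc_self ht)) h₁.continuousOn
    (fun t ht => hasDerivWithinAt_Ici_of_Icc (h₁ t (Ico_subset_Icc_self ht)) ht)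
    (fun t ht => ?_) h₂.continuousOn
    (fun t ht => hasDerivWithinAt_Ici_of_Icc (h₂ t (Ico_subset_Icc_self ht)) ht)
    (fun t ht => ?_) heq
  · simpa using Or.inl (hR₁ t (Ico_subset_Icc_self ht))
  · simpa using Or.inr (hR₂ t (Ico_subset_Icc_self ht))

end IsTame

theorem exists_isIntegralCurveOn_linear {A : ℝ → ℝ × ℝ →L[ℝ] ℝ × ℝ} {a b : ℝ} (hab : a ≤ b)
    (hA : ContinuousOn A (Icc a b)) (w : ℝ × ℝ) :
    ∃ m : ℝ → ℝ × ℝ, m a = w ∧ IsIntegralCurveOn m (fun t w => A t w) (Icc a b) := by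
  obtain ⟨K, hK⟩ := isCompact_Icc.exists_bound_of_continuousOn hA
  have hK0 : 0 ≤ K := (norm_nonneg _).trans (hK a (left_mem_Icc.2 hab))
  set R := ‖w‖ * Real.exp (K * (b - a)) with hR
  have hR0 : 0 ≤ R := by positivity
  obtain ⟨m, hma, hm⟩ := exists_isIntegralCurveOn_of_bounded
    (F := fun t w => A t (clamp R w)) hab (K := K.toNNReal * 1) (L := K * R) (fun t ht => by
      refine LipschitzWith.comp ((A t).lipschitz.weaken ?_) (lipschitzWith_clamp R)
      rw [← NNReal.coe_le_coe, coe_nnnorm, Real.coe_toNNReal K hK0]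
      exact hK t ht)
    (fun w => hA.clm_apply continuousOn_const)
    (fun t ht w => (A t).le_of_opNorm_le_of_le (hK t ht) (norm_clamp_le hR0 w)) w
  refine ⟨m, hma, fun t ht => ?_⟩
  have hb := norm_le_gronwallBound_of_norm_deriv_right_le (f := m)
    (f' := fun t => A t (clamp R (m t))) (δ := ‖w‖) (K := K) (ε := 0) hm.continuousOn
    (fun t ht => hasDerivWithinAt_Ici_of_Icc (hm t (Ico_subset_Icc_self ht)) ht)
    (by rw [hma]) (fun t ht => by
      rw [add_zero]
      exact (A t).le_of_opNorm_le_of_le (hK t (Ico_subset_Icc_self ht))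
        (norm_clamp_le_norm hR0 _)) t ht
  rw [gronwallBound_ε0] at hb
  have hle : ‖m t‖ ≤ R := hb.trans (by rw [hR]; have := ht.2; gcongr)
  have := hm t ht
  simp only [clamp_of_norm_le hle] at this
  exact this

/-- Liouville's formula for a trace-free linear equation. -/
theorem wronskian_eq {A : ℝ → ℝ × ℝ →L[ℝ] ℝ × ℝ} {a b : ℝ}
    (htr : ∀ t, (A t (1, 0)).1 + (A t (0, 1)).2 = 0) {m₁ m₂ : ℝ → ℝ × ℝ}
    (h₁ : IsIntegralCurveOn m₁ (fun t w => A t w) (Icc a b))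
    (h₂ : IsIntegralCurveOn m₂ (fun t w => A t w) (Icc a b)) {t : ℝ} (ht : t ∈ Icc a b) :
    (m₁ t).1 * (m₂ t).2 - (m₂ t).1 * (m₁ t).2
      = (m₁ a).1 * (m₂ a).2 - (m₂ a).1 * (m₁ a).2 := by
  have hd : ∀ s ∈ Icc a b, HasDerivWithinAt
      (fun s => (m₁ s).1 * (m₂ s).2 - (m₂ s).1 * (m₁ s).2) 0 (Icc a b) s := by
    intro s hs
    have e₁ := h₁ s hs
    have e₂ := h₂ s hs
    have f₁ := hasFDerivAt_fst.comp_hasDerivWithinAt s e₁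
    have s₁ := hasFDerivAt_snd.comp_hasDerivWithinAt s e₁
    have f₂ := hasFDerivAt_fst.comp_hasDerivWithinAt s e₂
    have s₂ := hasFDerivAt_snd.comp_hasDerivWithinAt s e₂
    refine ((f₁.mul s₂).sub (f₂.mul s₁)).congr_deriv ?_
    simp only [Function.comp_apply, ContinuousLinearMap.coe_fst', ContinuousLinearMap.coe_snd']
    rw [continuousLinearMap_prod_apply (A s) (m₁ s), continuousLinearMap_prod_apply (A s) (m₂ s)]
    simp only [Prod.fst_add, Prod.snd_add, Prod.smul_fst, Prod.smul_snd, smul_eq_mul]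
    have := htr s
    linear_combination ((m₁ s).1 * (m₂ s).2 - (m₂ s).1 * (m₁ s).2) * this
  exact constant_of_has_deriv_right_zero (fun s hs => (hd s hs).continuousWithinAt)
    (fun s hs => hasDerivWithinAt_Ici_of_Icc (hd s (Ico_subset_Icc_self hs)) hs) t ht

theorem gronwallBound_zero_left (K ε x : ℝ) :
    gronwallBound 0 K ε x = ε * gronwallBound 0 K 1 x := by
  unfold gronwallBound
  split_ifs <;> ring

namespace IsTame

variable {F : ℝ → ℝ × ℝ → ℝ × ℝ} {a b : ℝ}

/-- The flow map is differentiable: its derivative is the solution of the variational equation,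
because the linearization solves the equation up to an error of smaller order. -/
theorem exists_hasFDerivAt (h : IsTame F a b) (hab : a ≤ b) {Φ : ℝ × ℝ → ℝ × ℝ}
    (hΦ : ∀ γ, IsIntegralCurveOn γ F (Icc a b) → γ b = Φ (γ a)) (w₀ : ℝ × ℝ) :
    ∃ L : ℝ × ℝ →L[ℝ] ℝ × ℝ, HasFDerivAt Φ L w₀ ∧ L.det = 1 := by
  obtain ⟨R, hR0, hR⟩ := h.exists_bound w₀
  choose γ hγa hγ using h.exists_isIntegralCurveOn hab
  have hγR : ∀ᶠ w in 𝓝 w₀, ∀ t ∈ Icc a b, ‖γ w t‖ ≤ R := by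
    filter_upwards [hR] with w hw
    exact hw (γ w) _ (hγa w) (hγ w) fun _ _ _ => rfl
  have hγ₀ : ∀ t ∈ Icc a b, ‖γ w₀ t‖ ≤ R := hγR.self_of_nhds
  -- the fundamental matrix `M` of the variational equation along the orbit of `w₀`
  let A : ℝ → ℝ × ℝ →L[ℝ] ℝ × ℝ := fun t => fderiv ℝ (F t) (γ w₀ t)
  have hA : ContinuousOn A (Icc a b) := h.continuous_fderiv.comp_continuousOn
    (continuousOn_id.prodMk (hγ w₀).continuousOn)
  obtain ⟨m₁, hm₁a, hm₁⟩ := exists_isIntegralCurveOn_linear hab hA (1, 0)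
  obtain ⟨m₂, hm₂a, hm₂⟩ := exists_isIntegralCurveOn_linear hab hA (0, 1)
  let M : ℝ → ℝ × ℝ →L[ℝ] ℝ × ℝ := fun t =>
    (ContinuousLinearMap.fst ℝ ℝ ℝ).smulRight (m₁ t) + (ContinuousLinearMap.snd ℝ ℝ ℝ).smulRight (m₂ t)
  have hM : ∀ t k, M t k = k.1 • m₁ t + k.2 • m₂ t := fun t k => rfl
  have hMb : ∀ k, IsIntegralCurveOn (fun t => M t k) (fun t w => A t w) (Icc a b) := by
    intro k t ht
    refine (((hm₁ t ht).const_smul k.1).add ((hm₂ t ht).const_smul k.2)).congr_deriv ?_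
    simp only [hM, map_add, map_smul]
  have hMa : ∀ k, M a k = k := fun k => by rw [hM, hm₁a, hm₂a]; ext <;> simp
  obtain ⟨m, hm⟩ : ∃ m, ∀ t ∈ Icc a b, ‖M t‖ ≤ m := by
    refine isCompact_Icc.exists_bound_of_continuousOn (E := ℝ × ℝ →L[ℝ] ℝ × ℝ) ?_
    have c₁ : ContinuousOn m₁ (Icc a b) := hm₁.continuousOn
    have c₂ : ContinuousOn m₂ (Icc a b) := hm₂.continuousOn
    exact ((ContinuousLinearMap.smulRightL ℝ (ℝ × ℝ) (ℝ × ℝ)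
      (ContinuousLinearMap.fst ℝ ℝ ℝ)).continuous.comp_continuousOn c₁).add
      ((ContinuousLinearMap.smulRightL ℝ (ℝ × ℝ) (ℝ × ℝ)
      (ContinuousLinearMap.snd ℝ ℝ ℝ)).continuous.comp_continuousOn c₂)
  have hm0 : 0 ≤ m := (norm_nonneg _).trans (hm a (left_mem_Icc.2 hab))
  refine ⟨M b, ?_, ?_⟩
  · obtain ⟨K, hK⟩ := h.exists_lipschitzOnWith (R + 1)
    set G := gronwallBound 0 K 1 (b - a) with hG
    have hG0 : 0 ≤ G := by
      have := gronwallBound_mono (δ := 0) (ε := 1) (K := K) le_rfl zero_le_one K.2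
        (sub_nonneg.2 hab)
      rwa [gronwallBound_x0] at this
    rw [hasFDerivAt_iff_isLittleO_nhds_zero, Asymptotics.isLittleO_iff]
    intro c hc
    -- `m` bounds the linear flow and `G` is the Gronwall factor: an error of `ε` per unit of `m ‖k‖`
    -- in the equation becomes at most `ε m G ‖k‖ ≤ c ‖k‖` in the solution
    set ε := c / (m * G + 1) with hε
    have hε0 : 0 < ε := by positivity
    obtain ⟨δ, hδ0, hδ⟩ := Metric.uniformContinuousOn_iff.1
      (((isCompact_Icc (a := a) (b := b)).prod
        (isCompact_closedBall (0 : ℝ × ℝ) (R + 1))).uniformContinuousOn_of_continuous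
          h.continuous_fderiv.continuousOn) ε hε0
    have hsmall : ∀ᶠ k in 𝓝 (0 : ℝ × ℝ), m * ‖k‖ < min δ 1 := by
      have : Tendsto (fun k : ℝ × ℝ => m * ‖k‖) (𝓝 0) (𝓝 (m * ‖(0 : ℝ × ℝ)‖)) :=
        (continuous_const.mul continuous_norm).tendsto _
      rw [norm_zero, mul_zero] at this
      exact this.eventually (gt_mem_nhds (lt_min hδ0 one_pos))
    have hnear : ∀ᶠ k in 𝓝 (0 : ℝ × ℝ), ∀ t ∈ Icc a b, ‖γ (w₀ + k) t‖ ≤ R := by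
      have : Tendsto (fun k : ℝ × ℝ => w₀ + k) (𝓝 0) (𝓝 (w₀ + 0)) :=
        (continuous_const.add continuous_id).tendsto _
      rw [add_zero] at this
      exact this.eventually hγR
    filter_upwards [hsmall, hnear] with k hk hγk
    have hMk : ∀ t ∈ Icc a b, ‖M t k‖ ≤ m * ‖k‖ := fun t ht => (M t).le_of_opNorm_le (hm t ht) k
    have hball : ∀ t ∈ Icc a b, Metric.ball (γ w₀ t) (min δ 1) ⊆ Metric.closedBall 0 (R + 1) := by
      intro t ht w hw
      rw [mem_closedBall_zero_iff]
      rw [mem_ball_iff_norm] at hw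
      have h1 := norm_add_le (w - γ w₀ t) (γ w₀ t)
      rw [sub_add_cancel] at h1
      linarith [hγ₀ t ht, hw.trans_le (min_le_right δ 1)]
    have hmem : ∀ t ∈ Icc a b, γ w₀ t + M t k ∈ Metric.ball (γ w₀ t) (min δ 1) := by
      intro t ht
      rw [mem_ball_iff_norm, add_sub_cancel_left]
      exact (hMk t ht).trans_lt hk
    have hmem0 : ∀ t, γ w₀ t ∈ Metric.ball (γ w₀ t) (min δ 1) := fun t =>
      Metric.mem_ball_self (lt_min hδ0 one_pos)
    have hlin : IsIntegralCurveOn (fun t => γ w₀ t + M t k)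
        (fun t _ => F t (γ w₀ t) + A t (M t k)) (Icc a b) := fun t ht =>
      (hγ w₀ t ht).add (hMb k t ht)
    have hdist := dist_le_of_approx_trajectories_ODE_of_mem (v := F)
      (s := fun _ => Metric.closedBall 0 (R + 1)) (K := K) (f := γ (w₀ + k))
      (g := fun t => γ w₀ t + M t k) (f' := fun t => F t (γ (w₀ + k) t))
      (g' := fun t => F t (γ w₀ t) + A t (M t k)) (a := a) (b := b)
      (εf := 0) (εg := ε * (m * ‖k‖)) (δ := 0)
      (fun t ht => hK t (Ico_subset_Icc_self ht)) (hγ (w₀ + k)).continuousOn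
      (fun t ht => hasDerivWithinAt_Ici_of_Icc (hγ _ t (Ico_subset_Icc_self ht)) ht)
      (fun t _ => by simp)
      (fun t ht => by
        have := hγk t (Ico_subset_Icc_self ht)
        rw [mem_closedBall_zero_iff]; linarith)
      hlin.continuousOn
      (fun t ht => hasDerivWithinAt_Ici_of_Icc (hlin t (Ico_subset_Icc_self ht)) ht)
      (fun t ht => by
        have ht' := Ico_subset_Icc_self ht
        have := Convex.norm_image_sub_le_of_norm_fderiv_le' (f := F t) (C := ε)
          (s := Metric.ball (γ w₀ t) (min δ 1)) (φ := A t)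
          (fun w _ => (h.hasFDerivAt t w).differentiableAt)
          (fun w hw => by
            have := hδ (t, w) ⟨ht', hball t ht' hw⟩ (t, γ w₀ t)
              ⟨ht', hball t ht' (hmem0 t)⟩ (by
                rw [Prod.dist_eq, dist_self, max_lt_iff]
                exact ⟨hδ0, (Metric.mem_ball.1 hw).trans_le (min_le_left _ _)⟩)
            rw [dist_eq_norm] at this
            exact this.le)
          (convex_ball _ _) (hmem0 t) (hmem t ht')
        rw [add_sub_cancel_left] at this
        rw [dist_comm, dist_eq_norm]
        calc ‖F t (γ w₀ t + M t k) - (F t (γ w₀ t) + A t (M t k))‖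
            = ‖F t (γ w₀ t + M t k) - F t (γ w₀ t) - A t (M t k)‖ := by rw [sub_sub]
          _ ≤ ε * ‖M t k‖ := this
          _ ≤ ε * (m * ‖k‖) := by gcongr; exact hMk t ht')
      (fun t ht => hball t (Ico_subset_Icc_self ht) (hmem t (Ico_subset_Icc_self ht)))
      (by rw [hγa, hγa, hMa, dist_self]) b (right_mem_Icc.2 hab)
    rw [zero_add, gronwallBound_zero_left, ← hG, dist_eq_norm, hΦ _ (hγ (w₀ + k)), hγa,
      hΦ _ (hγ w₀), hγa, ← sub_sub] at hdist
    calc ‖Φ (w₀ + k) - Φ w₀ - M b k‖ ≤ ε * (m * ‖k‖) * G := hdist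
      _ = c * ‖k‖ * (m * G / (m * G + 1)) := by rw [hε]; ring
      _ ≤ c * ‖k‖ * 1 := by
          gcongr
          rw [div_le_one (by positivity)]
          linarith
      _ = c * ‖k‖ := mul_one _
  · rw [det_prod_eq]
    have hw := wronskian_eq (fun t => h.trace t (γ w₀ t)) hm₁ hm₂ (right_mem_Icc.2 hab)
    rw [hm₁a, hm₂a] at hw
    simpa [hM] using hw

/-- The flow over `[a, b]` is a homeomorphism of the plane with derivatives of determinant `1`. -/
theorem exists_flow (h : IsTame F a b) (hab : a ≤ b) : ∃ Φ : (ℝ × ℝ) ≃ₜ (ℝ × ℝ),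
    (∀ γ, IsIntegralCurveOn γ F (Icc a b) → γ b = Φ (γ a)) ∧
    ∀ w, ∃ L : ℝ × ℝ →L[ℝ] ℝ × ℝ, HasFDerivAt Φ L w ∧ L.det = 1 := by
  have key : ∀ {F : ℝ → ℝ × ℝ → ℝ × ℝ}, IsTame F a b → ∃ Φ : ℝ × ℝ → ℝ × ℝ,
      ∀ γ, IsIntegralCurveOn γ F (Icc a b) → γ b = Φ (γ a) := by
    intro F h
    choose γ hγa hγ using h.exists_isIntegralCurveOn hab
    refine ⟨fun w => γ w b, fun η hη => ?_⟩
    exact h.eqOn_of_isIntegralCurveOn hη (hγ (η a)) (hγa _).symm (right_mem_Icc.2 hab)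
  have hrev : ∀ {F : ℝ → ℝ × ℝ → ℝ × ℝ} {γ : ℝ → ℝ × ℝ}, IsIntegralCurveOn γ F (Icc a b) →
      IsIntegralCurveOn (fun t => γ (a + b - t)) (fun t w => -F (a + b - t) w) (Icc a b) := by
    intro F γ hγ t ht
    have hmem : ∀ s ∈ Icc a b, a + b - s ∈ Icc a b := fun s hs =>
      ⟨by linarith [hs.2], by linarith [hs.1]⟩
    have h1 := HasDerivWithinAt.scomp t (hγ _ (hmem t ht))
      (((hasDerivWithinAt_id t (Icc a b)).const_sub (a + b))) hmem
    simpa [Function.comp_def] using h1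
  obtain ⟨Φ, hΦ⟩ := key h
  obtain ⟨Ψ, hΨ⟩ := key h.reverse
  have hdΦ := h.exists_hasFDerivAt hab hΦ
  have hdΨ := h.reverse.exists_hasFDerivAt hab hΨ
  have h1 : ∀ w, Ψ (Φ w) = w := by
    intro w
    obtain ⟨γ, hγa, hγ⟩ := h.exists_isIntegralCurveOn hab w
    have := hΨ _ (hrev hγ)
    simp only [add_sub_cancel_right, add_sub_cancel_left] at this
    rw [hΦ γ hγ, hγa] at this
    exact this.symm
  have h2 : ∀ w, Φ (Ψ w) = w := by
    intro w
    obtain ⟨γ, hγa, hγ⟩ := h.reverse.exists_isIntegralCurveOn hab w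
    have h3 := hrev hγ
    have := hΦ _ (by simpa using h3)
    simp only [add_sub_cancel_right, add_sub_cancel_left] at this
    rw [hΨ γ hγ, hγa] at this
    exact this.symm
  refine ⟨⟨⟨Φ, Ψ, h1, h2⟩, ?_, ?_⟩, hΦ, hdΦ⟩
  · exact continuous_iff_continuousAt.2 fun w => (hdΦ w).choose_spec.1.continuousAt
  · exact continuous_iff_continuousAt.2 fun w => (hdΨ w).choose_spec.1.continuousAt

end IsTame

/-! ### Maps with invertible derivative -/

theorem exists_openPartialHomeomorph {f : ℝ × ℝ → ℝ × ℝ} {L : ℝ × ℝ →L[ℝ] ℝ × ℝ} {z : ℝ × ℝ}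
    (hf : HasStrictFDerivAt f L z) (hL : L.det ≠ 0) :
    ∃ e : OpenPartialHomeomorph (ℝ × ℝ) (ℝ × ℝ), z ∈ e.source ∧ ⇑e = f := by
  have hf' : HasStrictFDerivAt f
      (L.toContinuousLinearEquivOfDetNeZero hL : ℝ × ℝ →L[ℝ] ℝ × ℝ) z := by simpa using hf
  exact ⟨hf'.toOpenPartialHomeomorph f, hf'.mem_toOpenPartialHomeomorph_source, rfl⟩

theorem image_mem_nhds_of_det_ne_zero {f : ℝ × ℝ → ℝ × ℝ} {L : ℝ × ℝ →L[ℝ] ℝ × ℝ} {z : ℝ × ℝ}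
    (hf : HasStrictFDerivAt f L z) (hL : L.det ≠ 0) {U : Set (ℝ × ℝ)} (hU : U ∈ 𝓝 z) :
    f '' U ∈ 𝓝 (f z) := by
  obtain ⟨e, hz, rfl⟩ := exists_openPartialHomeomorph hf hL
  rw [← e.map_nhds_eq hz]
  exact image_mem_map hU

/-! ### The reference solution and the action-angle map -/

theorem expα_pos (n : ℕ) : 0 < expα n := by unfold expα; positivity

theorem expβ_eq (n : ℕ) : expβ n = (n + 1) / (n + 2) := by
  have : (n : ℝ) + 2 ≠ 0 := by positivity
  unfold expβ expα; field_simp; ring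

theorem expβ_pos (n : ℕ) : 0 < expβ n := by rw [expβ_eq]; positivity

theorem expα_add_expβ (n : ℕ) : expα n + expβ n = 1 := by unfold expβ; ring

theorem expα_mul (n : ℕ) : expα n * (2 * n + 2 : ℕ) = 2 * expβ n := by
  rw [expβ_eq]; unfold expα; push_cast; ring

/-- A continuous logarithm of a differentiable function is differentiable. -/
theorem hasDerivAt_of_exp_eq {g : ℝ → ℂ} {f : ℝ → ℂ} {f' : ℂ} {θ : ℝ} (hg : Continuous g)
    (hgf : ∀ s, Complex.exp (g s) = f s) (hf : HasDerivAt f f' θ) :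
    HasDerivAt g (f' / f θ) θ := by
  have hne : f θ ≠ 0 := hgf θ ▸ Complex.exp_ne_zero _
  have h1 : HasDerivAt (fun s => Complex.log (f s / f θ) + g θ) (f' / f θ) θ := by
    have h2 : HasDerivAt (fun s => f s / f θ) (f' / f θ) θ := hf.div_const _
    have h3 := (h2.clog_real (by rw [div_self hne]; exact Complex.one_mem_slitPlane)).add_const (g θ)
    rwa [div_self hne, div_one] at h3
  refine h1.congr_of_eventuallyEq ?_
  have hc : Tendsto (fun s => (g s - g θ).im) (𝓝 θ) (𝓝 0) := by
    have : Continuous fun s => (g s - g θ).im := Complex.continuous_im.comp (hg.sub continuous_const)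
    simpa using this.tendsto θ
  filter_upwards [hc.eventually (Ioo_mem_nhds (neg_lt_zero.2 Real.pi_pos) Real.pi_pos)] with s hs
  rw [← hgf s, ← hgf θ, ← Complex.exp_sub, Complex.log_exp hs.1 hs.2.le]
  ring

namespace IsReferenceSolution

variable {n : ℕ} {x₀ y₀ : ℝ → ℝ} {T₀ : ℝ}

theorem period_pos (h : IsReferenceSolution n x₀ y₀ T₀) : 0 < T₀ := h.period.1.1

theorem actionConst_pos (h : IsReferenceSolution n x₀ y₀ T₀) : 0 < actionConst n T₀ :=
  one_div_pos.2 (mul_pos (expα_pos n) h.period_pos)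

theorem energy (h : IsReferenceSolution n x₀ y₀ T₀) (t : ℝ) :
    (n + 1) * y₀ t ^ 2 + x₀ t ^ (2 * n + 2) = 1 := by
  have hd : ∀ t, HasDerivAt (fun t => (n + 1) * y₀ t ^ 2 + x₀ t ^ (2 * n + 2)) 0 t := fun t => by
    refine ((((h.deriv_y t).pow 2).const_mul ((n : ℝ) + 1)).add
      ((h.deriv_x t).pow (2 * n + 2))).congr_deriv ?_
    push_cast
    simp only [pow_one]
    ring
  have := is_const_of_deriv_eq_zero (fun t => (hd t).differentiableAt) (fun t => (hd t).deriv) t 0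
  simpa [h.x_zero, h.y_zero] using this

theorem contDiff_one (h : IsReferenceSolution n x₀ y₀ T₀) : ContDiff ℝ 1 x₀ ∧ ContDiff ℝ 1 y₀ := by
  have hx : Differentiable ℝ x₀ := fun t => (h.deriv_x t).differentiableAt
  have hy : Differentiable ℝ y₀ := fun t => (h.deriv_y t).differentiableAt
  have hxd : deriv x₀ = y₀ := funext fun t => (h.deriv_x t).deriv
  have hyd : deriv y₀ = fun t => -(x₀ t) ^ (2 * n + 1) := funext fun t => (h.deriv_y t).deriv
  rw [contDiff_one_iff_deriv, contDiff_one_iff_deriv, hxd, hyd]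
  exact ⟨⟨hx, hy.continuous⟩, hy, by have := hx.continuous; fun_prop⟩

theorem abs_le_one (h : IsReferenceSolution n x₀ y₀ T₀) (t : ℝ) : |x₀ t| ≤ 1 ∧ |y₀ t| ≤ 1 := by
  have he := h.energy t
  have h1 : 0 ≤ x₀ t ^ (2 * n + 2) := by
    rw [show 2 * n + 2 = 2 * (n + 1) by ring, pow_mul]; positivity
  have hn : (0 : ℝ) ≤ n := Nat.cast_nonneg n
  have h2 := sq_nonneg (y₀ t)
  constructor
  · have : |x₀ t| ^ (2 * n + 2) ≤ 1 := by
      rw [← abs_pow, abs_of_nonneg h1]; nlinarith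
    exact (pow_le_one_iff_of_nonneg (abs_nonneg _) (by omega)).1 this
  · rw [abs_le_one_iff_mul_self_le_one]
    nlinarith

/-- A shift of the reference solution that agrees with it at one time is a multiple of the
period. -/
theorem exists_int_of_eq (h : IsReferenceSolution n x₀ y₀ T₀) {s t : ℝ}
    (hx : x₀ (s * T₀) = x₀ (t * T₀)) (hy : y₀ (s * T₀) = y₀ (t * T₀)) : ∃ k : ℤ, s - t = k := by
  let F : ℝ × ℝ → ℝ × ℝ := fun w => (w.2, -w.1 ^ (2 * n + 1))
  have hF : ContDiff ℝ 1 F := by fun_prop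
  obtain ⟨K, hK⟩ := (isCompact_closedBall (0 : ℝ × ℝ) 1).exists_bound_of_continuousOn
    (hF.continuous_fderiv one_ne_zero).continuousOn
  have hlip : LipschitzOnWith K.toNNReal F (Metric.closedBall 0 1) :=
    Convex.lipschitzOnWith_of_nnnorm_fderiv_le
      (fun w _ => (hF.differentiable one_ne_zero) w)
      (fun w hw => NNReal.coe_le_coe.1 ((hK w hw).trans (Real.le_coe_toNNReal K)))
      (convex_closedBall _ _)
  have hsol : ∀ d τ, HasDerivAt (fun τ => (x₀ (τ + d), y₀ (τ + d)))
      (F (x₀ (τ + d), y₀ (τ + d))) τ ∧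
      (x₀ (τ + d), y₀ (τ + d)) ∈ Metric.closedBall (0 : ℝ × ℝ) 1 := fun d τ => by
    refine ⟨((h.deriv_x (τ + d)).comp_add_const τ d).prodMk
      ((h.deriv_y (τ + d)).comp_add_const τ d), ?_⟩
    rw [mem_closedBall_zero_iff, Prod.norm_def, max_le_iff]
    exact h.abs_le_one _
  have hE := ODE_solution_unique_univ (v := fun _ => F) (s := fun _ => Metric.closedBall 0 1)
    (t₀ := t * T₀) (fun _ => hlip) (hsol ((s - t) * T₀)) (hsol 0) (by
      simp only [add_zero]
      rw [show t * T₀ + (s - t) * T₀ = s * T₀ by ring, hx, hy])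
  have hper : Function.Periodic x₀ ((s - t) * T₀) ∧ Function.Periodic y₀ ((s - t) * T₀) := by
    constructor <;> intro τ <;> have := congrFun hE τ <;> simp only [Prod.mk.injEq, add_zero] at this
    exacts [this.1, this.2]
  have hT := h.period.1
  have hfr : Int.fract (s - t) * T₀ = (s - t) * T₀ - ⌊s - t⌋ • T₀ := by
    rw [Int.fract, zsmul_eq_mul]; ring
  by_contra hcon
  have hpos : 0 < Int.fract (s - t) := by
    refine lt_of_le_of_ne (Int.fract_nonneg _) fun h0 => hcon ⟨⌊s - t⌋, ?_⟩
    rw [Int.fract] at h0; linarith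
  have hle : T₀ ≤ Int.fract (s - t) * T₀ := h.period.2 ⟨mul_pos hpos h.period_pos, by
    rw [hfr]; exact hper.1.sub_period (hT.2.1.zsmul _), by
    rw [hfr]; exact hper.2.sub_period (hT.2.2.zsmul _)⟩
  have h1 := Int.fract_lt_one (s - t)
  have := h.period_pos
  nlinarith

end IsReferenceSolution

/-- The action of a point of the plane, recovered from its energy. -/
def actionOf (n : ℕ) (T₀ : ℝ) (w : ℝ × ℝ) : ℝ :=
  ((n + 1) * w.2 ^ 2 + w.1 ^ (2 * n + 2)) ^ (1 / (2 * expβ n)) / actionConst n T₀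

/-- The derivative of the action-angle map. -/
def actionAngleDeriv (n : ℕ) (x₀ y₀ : ℝ → ℝ) (T₀ : ℝ) (z : ℝ × ℝ) : ℝ × ℝ →L[ℝ] ℝ × ℝ :=
  ((actionConst n T₀ ^ expα n * (expα n * z.1 ^ (expα n - 1)) * x₀ (z.2 * T₀)) •
      ContinuousLinearMap.fst ℝ ℝ ℝ +
    (actionConst n T₀ ^ expα n * z.1 ^ expα n * (y₀ (z.2 * T₀) * T₀)) •
      ContinuousLinearMap.snd ℝ ℝ ℝ).prod
  ((actionConst n T₀ ^ expβ n * (expβ n * z.1 ^ (expβ n - 1)) * y₀ (z.2 * T₀)) •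
      ContinuousLinearMap.fst ℝ ℝ ℝ +
    (actionConst n T₀ ^ expβ n * z.1 ^ expβ n * (-(x₀ (z.2 * T₀)) ^ (2 * n + 1) * T₀)) •
      ContinuousLinearMap.snd ℝ ℝ ℝ)

namespace IsReferenceSolution

variable {n : ℕ} {x₀ y₀ : ℝ → ℝ} {T₀ : ℝ}

theorem hasFDerivAt_actionAngle (h : IsReferenceSolution n x₀ y₀ T₀) {z : ℝ × ℝ} (hz : 0 < z.1) :
    HasFDerivAt (actionAngle n x₀ y₀ T₀) (actionAngleDeriv n x₀ y₀ T₀ z) z := by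
  have hp : ∀ r : ℝ, HasFDerivAt (fun z : ℝ × ℝ => z.1 ^ r)
      ((r * z.1 ^ (r - 1)) • ContinuousLinearMap.fst ℝ ℝ ℝ) z := fun r =>
    (Real.hasDerivAt_rpow_const (Or.inl hz.ne')).comp_hasFDerivAt z hasFDerivAt_fst
  have hs : HasFDerivAt (fun z : ℝ × ℝ => z.2 * T₀) (T₀ • ContinuousLinearMap.snd ℝ ℝ ℝ) z :=
    hasFDerivAt_snd.mul_const T₀
  have hx := (h.deriv_x (z.2 * T₀)).comp_hasFDerivAt z hs
  have hy := (h.deriv_y (z.2 * T₀)).comp_hasFDerivAt z hs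
  refine HasFDerivAt.prodMk ?_ ?_
  · refine (((hp _).const_mul _).mul hx).congr_fderiv ?_
    ext <;> simp
    ring
  · refine (((hp _).const_mul _).mul hy).congr_fderiv ?_
    ext <;> simp
    ring

theorem contDiffAt_actionAngle (h : IsReferenceSolution n x₀ y₀ T₀) {z : ℝ × ℝ} (hz : 0 < z.1) :
    ContDiffAt ℝ 1 (actionAngle n x₀ y₀ T₀) z := by
  have hp : ∀ r : ℝ, ContDiffAt ℝ 1 (fun z : ℝ × ℝ => z.1 ^ r) z := fun r =>
    (contDiffAt_fst (𝕜 := ℝ) (E := ℝ) (F := ℝ) (n := 1) (p := z)).rpow_const_of_ne hz.ne'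
  have hs : ContDiffAt ℝ 1 (fun z : ℝ × ℝ => z.2 * T₀) z := by fun_prop
  exact ((contDiffAt_const.mul (hp _)).mul (h.contDiff_one.1.contDiffAt.comp z hs)).prodMk
    ((contDiffAt_const.mul (hp _)).mul (h.contDiff_one.2.contDiffAt.comp z hs))

theorem rpow_mul_cancel {l r s : ℝ} (hl : 0 < l) (hrs : r + s = 1) :
    l ^ (r - 1) * l ^ s = 1 := by
  rw [← Real.rpow_add hl, show r - 1 + s = 0 by linarith, Real.rpow_zero]

theorem det_actionAngleDeriv (h : IsReferenceSolution n x₀ y₀ T₀) {z : ℝ × ℝ} (hz : 0 < z.1) :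
    (actionAngleDeriv n x₀ y₀ T₀ z).det = -1 := by
  rw [det_prod_eq]
  simp only [actionAngleDeriv, ContinuousLinearMap.prod_apply, _root_.add_apply,
    _root_.smul_apply, ContinuousLinearMap.coe_fst', ContinuousLinearMap.coe_snd', smul_eq_mul,
    mul_one, mul_zero, add_zero, zero_add]
  have hc := h.actionConst_pos
  have h1 := rpow_mul_cancel hz (expα_add_expβ n)
  have h2 := rpow_mul_cancel hz ((add_comm _ _).trans (expα_add_expβ n))
  have h3 : actionConst n T₀ ^ expα n * actionConst n T₀ ^ expβ n = actionConst n T₀ := by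
    rw [← Real.rpow_add hc, expα_add_expβ, Real.rpow_one]
  have h4 : actionConst n T₀ * T₀ * expα n = 1 := by
    have := h.period_pos.ne'
    have := (expα_pos n).ne'
    unfold actionConst; field_simp
  have h5 : expβ n = (n + 1) * expα n := by rw [expβ_eq]; unfold expα; ring
  have he := h.energy (z.2 * T₀)
  generalize x₀ (z.2 * T₀) = X at *
  generalize y₀ (z.2 * T₀) = Y at *
  calc _ = -(actionConst n T₀ ^ expα n * actionConst n T₀ ^ expβ n) * T₀ *
        (expα n * (z.1 ^ (expα n - 1) * z.1 ^ expβ n) * X ^ (2 * n + 2) +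
          expβ n * (z.1 ^ (expβ n - 1) * z.1 ^ expα n) * Y ^ 2) := by ring
    _ = -(actionConst n T₀ * T₀ * expα n) * ((n + 1) * Y ^ 2 + X ^ (2 * n + 2)) := by
        rw [h1, h2, h3, h5]; ring
    _ = -1 := by rw [h4, he]; ring

theorem actionOf_actionAngle (h : IsReferenceSolution n x₀ y₀ T₀) {z : ℝ × ℝ} (hz : 0 < z.1) :
    actionOf n T₀ (actionAngle n x₀ y₀ T₀ z) = z.1 := by
  have hc := h.actionConst_pos
  have hcz : 0 < actionConst n T₀ * z.1 := mul_pos hc hz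
  have hβ := expβ_pos n
  have e1 : (actionConst n T₀ ^ expβ n * z.1 ^ expβ n) ^ 2 =
      (actionConst n T₀ * z.1) ^ (2 * expβ n) := by
    rw [← Real.mul_rpow hc.le hz.le, ← Real.rpow_natCast, ← Real.rpow_mul hcz.le]
    congr 1; push_cast; ring
  have e2 : (actionConst n T₀ ^ expα n * z.1 ^ expα n) ^ (2 * n + 2) =
      (actionConst n T₀ * z.1) ^ (2 * expβ n) := by
    rw [← Real.mul_rpow hc.le hz.le, ← Real.rpow_natCast, ← Real.rpow_mul hcz.le, expα_mul]
  have e3 : (n + 1) * (actionAngle n x₀ y₀ T₀ z).2 ^ 2 + (actionAngle n x₀ y₀ T₀ z).1 ^ (2 * n + 2)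
      = (actionConst n T₀ * z.1) ^ (2 * expβ n) := by
    simp only [actionAngle]
    rw [mul_pow _ (y₀ _), mul_pow _ (x₀ _), e1, e2]
    linear_combination (actionConst n T₀ * z.1) ^ (2 * expβ n) * h.energy (z.2 * T₀)
  rw [actionOf, e3, ← Real.rpow_mul hcz.le, mul_one_div_cancel (by positivity), Real.rpow_one]
  field_simp

theorem continuous_actionOf (n : ℕ) (T₀ : ℝ) : Continuous (actionOf n T₀) := by
  have hβ := expβ_pos n
  unfold actionOf
  exact ((by fun_prop : Continuous fun w : ℝ × ℝ =>
    ((n : ℝ) + 1) * w.2 ^ 2 + w.1 ^ (2 * n + 2)).rpow_const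
      fun _ => Or.inr (by positivity)).div_const _

theorem actionOf_pos (h : IsReferenceSolution n x₀ y₀ T₀) {w : ℝ × ℝ} (hw : w ≠ 0) :
    0 < actionOf n T₀ w := by
  refine div_pos (Real.rpow_pos_of_pos ?_ _) h.actionConst_pos
  have h1 : 0 ≤ w.1 ^ (2 * n + 2) := by
    rw [show 2 * n + 2 = 2 * (n + 1) by ring, pow_mul]; positivity
  by_cases h2 : w.2 = 0
  · have h3 : w.1 ≠ 0 := fun h3 => hw (Prod.ext h3 h2)
    have : 0 < w.1 ^ (2 * n + 2) := lt_of_le_of_ne h1 (pow_ne_zero _ h3).symm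
    positivity
  · positivity

theorem actionAngle_ne_zero (h : IsReferenceSolution n x₀ y₀ T₀) {z : ℝ × ℝ} (hz : 0 < z.1) :
    actionAngle n x₀ y₀ T₀ z ≠ 0 := by
  intro h0
  have h1 := h.actionOf_actionAngle hz
  have hβ := expβ_pos n
  rw [h0, actionOf] at h1
  simp only [Prod.fst_zero, Prod.snd_zero, ne_eq, OfNat.ofNat_ne_zero, not_false_eq_true, zero_pow,
    mul_zero, Nat.add_eq_zero_iff, and_false, add_zero] at h1
  rw [Real.zero_rpow (by positivity), zero_div] at h1
  exact hz.ne h1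

theorem proj_eq_of_actionAngle_eq (h : IsReferenceSolution n x₀ y₀ T₀) {z z' : ℝ × ℝ}
    (hz : 0 < z.1) (hz' : 0 < z'.1)
    (heq : actionAngle n x₀ y₀ T₀ z = actionAngle n x₀ y₀ T₀ z') : proj z = proj z' := by
  have h1 : z.1 = z'.1 := by
    rw [← h.actionOf_actionAngle hz, ← h.actionOf_actionAngle hz', heq]
  have hc := h.actionConst_pos
  have h2 : x₀ (z.2 * T₀) = x₀ (z'.2 * T₀) := by
    have := congrArg Prod.fst heq
    simp only [actionAngle, h1] at this
    exact mul_left_cancel₀ (by positivity) this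
  have h3 : y₀ (z.2 * T₀) = y₀ (z'.2 * T₀) := by
    have := congrArg Prod.snd heq
    simp only [actionAngle, h1] at this
    exact mul_left_cancel₀ (by positivity) this
  obtain ⟨k, hk⟩ := h.exists_int_of_eq h2 h3
  refine Prod.ext h1 ?_
  change (z.2 : UnitAddCircle) = (z'.2 : UnitAddCircle)
  rw [← sub_eq_zero, ← AddCircle.coe_sub, AddCircle.coe_eq_zero_iff]
  exact ⟨k, by rw [hk]; simp⟩

theorem actionAngle_add_one (h : IsReferenceSolution n x₀ y₀ T₀) (l θ : ℝ) :
    actionAngle n x₀ y₀ T₀ (l, θ + 1) = actionAngle n x₀ y₀ T₀ (l, θ) := by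
  simp only [actionAngle, add_mul, one_mul]
  rw [h.period.1.2.1, h.period.1.2.2]

/-- The action-angle map covers the punctured plane: its range is open, it is closed in the punctured
plane because the action is bounded away from `0` and `∞` near each point, and the punctured plane is
connected. -/
theorem exists_actionAngle_eq (h : IsReferenceSolution n x₀ y₀ T₀) {w : ℝ × ℝ} (hw : w ≠ 0) :
    ∃ z : ℝ × ℝ, 0 < z.1 ∧ actionAngle n x₀ y₀ T₀ z = w := by
  set S := actionAngle n x₀ y₀ T₀ '' {z | 0 < z.1} with hS
  have hopen : IsOpen S := by
    rw [isOpen_iff_mem_nhds]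
    rintro _ ⟨z, hz, rfl⟩
    have hst := (h.contDiffAt_actionAngle hz).hasStrictFDerivAt' (h.hasFDerivAt_actionAngle hz)
      one_ne_zero
    exact image_mem_nhds_of_det_ne_zero hst (by rw [h.det_actionAngleDeriv hz]; norm_num)
      ((isOpen_lt continuous_const continuous_fst).mem_nhds hz)
  have hconn : IsPreconnected ({0}ᶜ : Set (ℝ × ℝ)) := by
    refine (isConnected_compl_singleton_of_one_lt_rank ?_ 0).isPreconnected
    rw [← Module.finrank_eq_rank]
    norm_num
  have hsub := hconn.subset_of_closure_inter_subset hopen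
    ⟨actionAngle n x₀ y₀ T₀ (1, 0), h.actionAngle_ne_zero (z := (1, 0)) one_pos, (1, 0),
      one_pos (α := ℝ), rfl⟩ (by
      rintro w ⟨hwS, hw0⟩
      have hl := h.actionOf_pos hw0
      set l := actionOf n T₀ w with hl'
      have hc : IsCompact (actionAngle n x₀ y₀ T₀ '' Icc (l / 2) (2 * l) ×ˢ Icc 0 1) := by
        refine (isCompact_Icc.prod isCompact_Icc).image_of_continuousOn fun z hz => ?_
        exact (h.hasFDerivAt_actionAngle (z := z)
          ((half_pos hl).trans_le hz.1.1)).continuousAt.continuousWithinAt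
      have hU : actionOf n T₀ ⁻¹' Ioo (l / 2) (2 * l) ∈ 𝓝 w :=
        (isOpen_Ioo.preimage (continuous_actionOf n T₀)).mem_nhds ⟨by linarith, by linarith⟩
      have hw' : w ∈ closure (S ∩ actionOf n T₀ ⁻¹' Ioo (l / 2) (2 * l)) :=
        mem_closure_iff_nhds.2 fun V hV => by
          obtain ⟨x, hx1, hx2⟩ := mem_closure_iff_nhds.1 hwS _ (inter_mem hV hU)
          exact ⟨x, hx1.1, hx2, hx1.2⟩
      have hsub : S ∩ actionOf n T₀ ⁻¹' Ioo (l / 2) (2 * l) ⊆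
          actionAngle n x₀ y₀ T₀ '' Icc (l / 2) (2 * l) ×ˢ Icc 0 1 := by
        rintro _ ⟨⟨z, hz, rfl⟩, hz'⟩
        rw [mem_preimage, h.actionOf_actionAngle hz] at hz'
        have hper : Function.Periodic (fun θ => actionAngle n x₀ y₀ T₀ (z.1, θ)) 1 :=
          fun θ => h.actionAngle_add_one z.1 θ
        refine ⟨(z.1, Int.fract z.2), ⟨Ioo_subset_Icc_self hz', Int.fract_nonneg _,
          (Int.fract_lt_one _).le⟩, ?_⟩
        have := hper.sub_zsmul_eq (x := z.2) ⌊z.2⌋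
        rw [zsmul_eq_mul, mul_one] at this
        exact this
      obtain ⟨z, hz, hzw⟩ := (closure_minimal hsub hc.isClosed) hw'
      exact ⟨z, (half_pos hl).trans_le hz.1.1, hzw⟩)
  exact hsub hw

theorem tendsto_actionOf (h : IsReferenceSolution n x₀ y₀ T₀) :
    Tendsto (actionOf n T₀) (cocompact (ℝ × ℝ)) atTop := by
  have hβ := expβ_pos n
  have h1 : Tendsto (fun w : ℝ × ℝ => ‖w‖ ^ (1 / (2 * expβ n)) / actionConst n T₀)
      (cocompact (ℝ × ℝ)) atTop :=
    ((tendsto_rpow_atTop (by positivity)).comp (tendsto_norm_cocompact_atTop (E := ℝ × ℝ))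
      ).atTop_div_const h.actionConst_pos
  refine tendsto_atTop_mono' _ ?_ h1
  filter_upwards [tendsto_norm_cocompact_atTop.eventually_ge_atTop 1] with w hw
  have hc := h.actionConst_pos
  have hx : 0 ≤ w.1 ^ (2 * n + 2) := by
    rw [show 2 * n + 2 = 2 * (n + 1) by ring, pow_mul]; positivity
  have hy := sq_nonneg w.2
  have hn : (0 : ℝ) ≤ n := Nat.cast_nonneg n
  have hle : ‖w‖ ≤ (n + 1) * w.2 ^ 2 + w.1 ^ (2 * n + 2) := by
    rw [Prod.norm_def, Real.norm_eq_abs, Real.norm_eq_abs] at hw ⊢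
    rcases le_total |w.2| |w.1| with hc | hc
    · rw [max_eq_left hc] at hw ⊢
      have h2 : |w.1| ≤ |w.1| ^ (2 * n + 2) := le_self_pow₀ hw (by omega)
      rw [← abs_pow, abs_of_nonneg hx] at h2
      nlinarith
    · rw [max_eq_right hc] at hw ⊢
      have h2 : |w.2| ≤ |w.2| ^ 2 := le_self_pow₀ hw (by omega)
      rw [sq_abs] at h2
      nlinarith
  unfold actionOf
  gcongr

/-- The level curves of the action wind around the origin: along them the polar angle is strictly
monotone. -/
theorem not_hasLog_actionAngle (h : IsReferenceSolution n x₀ y₀ T₀) {m : ℝ} (hm : 0 < m)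
    {f : UnitAddCircle → ℂ}
    (hf : ∀ θ : ℝ, f θ = toComplex (actionAngle n x₀ y₀ T₀ (m, θ))) : ¬ HasLog f := by
  rintro ⟨g, hg, hgf⟩
  have hd : ∀ θ : ℝ, HasDerivAt (fun θ : ℝ => f θ)
      (toComplex (actionAngleDeriv n x₀ y₀ T₀ (m, θ) (0, 1))) θ := by
    intro θ
    simp only [hf]
    have h1 : HasDerivAt (fun θ : ℝ => (m, θ)) ((0 : ℝ), (1 : ℝ)) θ :=
      (hasDerivAt_const θ m).prodMk (hasDerivAt_id θ)
    have h2 := (h.hasFDerivAt_actionAngle (z := (m, θ)) hm).comp_hasDerivAt θ h1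
    exact Complex.equivRealProdCLM.symm.hasFDerivAt.comp_hasDerivAt θ h2
  have hgd := fun θ : ℝ => hasDerivAt_of_exp_eq (g := fun θ : ℝ => g θ) (f := fun θ : ℝ => f θ)
    (hg.comp (AddCircle.continuous_mk' 1)) (fun s => hgf s) (hd θ)
  have him : ∀ θ : ℝ, HasDerivAt (fun θ : ℝ => (g θ).im)
      (toComplex (actionAngleDeriv n x₀ y₀ T₀ (m, θ) (0, 1)) / f θ).im θ := fun θ =>
    Complex.imCLM.hasFDerivAt.comp_hasDerivAt θ (hgd θ)
  have hanti : StrictAnti fun θ : ℝ => (g θ).im := by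
    refine strictAnti_of_deriv_neg fun θ => ?_
    rw [(him θ).deriv, Complex.div_im, ← sub_div]
    refine div_neg_of_neg_of_pos ?_ (Complex.normSq_pos.2 (hgf θ ▸ Complex.exp_ne_zero _))
    have hc := h.actionConst_pos
    have hA : 0 < actionConst n T₀ ^ expα n * m ^ expα n := by positivity
    have hB : 0 < actionConst n T₀ ^ expβ n * m ^ expβ n := by positivity
    have hre : ∀ w : ℝ × ℝ, (toComplex w).re = w.1 := fun w => rfl
    have him : ∀ w : ℝ × ℝ, (toComplex w).im = w.2 := fun w => rfl
    rw [hf, hre, him, hre, him]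
    simp only [actionAngleDeriv, actionAngle, ContinuousLinearMap.prod_apply, _root_.add_apply,
      _root_.smul_apply, ContinuousLinearMap.coe_fst', ContinuousLinearMap.coe_snd', smul_eq_mul,
      mul_one, mul_zero, zero_add]
    have he := h.energy (θ * T₀)
    generalize x₀ (θ * T₀) = X at *
    generalize y₀ (θ * T₀) = Y at *
    generalize actionConst n T₀ ^ expα n * m ^ expα n = A at *
    generalize actionConst n T₀ ^ expβ n * m ^ expβ n = B at *
    have hT := h.period_pos
    have hX : 0 ≤ X ^ (2 * n + 2) := by
      rw [show 2 * n + 2 = 2 * (n + 1) by ring, pow_mul]; positivity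
    have hpos : 0 < X ^ (2 * n + 2) + Y ^ 2 := by
      by_contra hcon
      have h1 := sq_nonneg Y
      have h2 : Y ^ 2 = 0 := by linarith
      have h3 : X ^ (2 * n + 2) = 0 := by linarith
      rw [h2, h3] at he
      norm_num at he
    have : 0 < A * B * T₀ * (X ^ (2 * n + 2) + Y ^ 2) := by positivity
    calc _ = -(A * B * T₀ * (X ^ (2 * n + 2) + Y ^ 2)) := by ring
      _ < 0 := by linarith
  have h01 := hanti (zero_lt_one (α := ℝ))
  have hper : ((1 : ℝ) : UnitAddCircle) = ((0 : ℝ) : UnitAddCircle) := by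
    rw [AddCircle.coe_period, AddCircle.coe_zero]
  simp only [hper] at h01
  exact lt_irrefl _ h01

end IsReferenceSolution

/-! ### The chart of the cylinder in the plane -/

theorem continuous_proj : Continuous proj :=
  continuous_fst.prodMk ((AddCircle.continuous_mk' 1).comp continuous_snd)

theorem isOpenMap_proj : IsOpenMap proj :=
  IsOpenMap.id.prodMap (QuotientAddGroup.isOpenMap_coe (N := AddSubgroup.zmultiples (1 : ℝ)))

theorem proj_eq_iff {z z' : ℝ × ℝ} : proj z = proj z' ↔ z.1 = z'.1 ∧ ∃ k : ℤ, z.2 - z'.2 = k := by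
  have : (z.2 : UnitAddCircle) = z'.2 ↔ ∃ k : ℤ, z.2 - z'.2 = k := by
    rw [← sub_eq_zero, ← AddCircle.coe_sub, AddCircle.coe_eq_zero_iff]
    simp [eq_comm]
  rw [← this]
  exact Prod.ext_iff

/-- A representative of a point of the cylinder in its universal cover. -/
def lift (z : Cyl) : ℝ × ℝ := (z.1, Function.surjInv QuotientAddGroup.mk_surjective z.2)

theorem proj_lift (z : Cyl) : proj (lift z) = z :=
  Prod.ext rfl (Function.surjInv_eq QuotientAddGroup.mk_surjective z.2)

/-- The map `φ₀ ∘ ψ_t` from the universal cover of the cylinder to the `(x, y)`-plane. -/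
def planeMap (n : ℕ) (x₀ y₀ : ℝ → ℝ) (T₀ : ℝ) (u v : ℝ → ℝ → ℝ → ℝ) (t : ℝ) (z : ℝ × ℝ) : ℝ × ℝ :=
  actionAngle n x₀ y₀ T₀ (nearId u v t z)

/-- The map `φ₀ ∘ ψ_t` from the cylinder to the `(x, y)`-plane, by way of representatives; it is
meaningful for actions above `μs`, where the choice of the representative does not matter. -/
def chart (n : ℕ) (x₀ y₀ : ℝ → ℝ) (T₀ : ℝ) (u v : ℝ → ℝ → ℝ → ℝ) (t : ℝ) (z : Cyl) : ℝ × ℝ :=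
  planeMap n x₀ y₀ T₀ u v t (lift z)

/-- The part of the cylinder on which the normal form is defined. -/
def upperCyl (μs : ℝ) : Set Cyl := {z | μs < z.1}

theorem isOpen_upperCyl (μs : ℝ) : IsOpen (upperCyl μs) :=
  isOpen_lt continuous_const continuous_fst

theorem SymbolClass.add_int {r l₀ : ℝ} {f : ℝ → ℝ → ℝ → ℝ} (hf : SymbolClass r l₀ f) {l : ℝ}
    (hl : l₀ < l) (θ t : ℝ) (k : ℤ) : f l (θ + k) t = f l θ t := by
  have hp : Function.Periodic (fun θ => f l θ t) 1 := fun θ => (hf.2.1 l θ t hl).1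
  simpa using hp.zsmul k θ

section chart

variable {D : ImpulsiveDuffing} {x₀ y₀ : ℝ → ℝ} {T₀ : ℝ} {u v : ℝ → ℝ → ℝ → ℝ} {h₁ : ℝ → ℝ → ℝ}
  {h₂ : ℝ → ℝ → ℝ → ℝ} {μs ε₁ : ℝ}

theorem IsNormalForm.contDiffAt_nearId (hψ : IsNormalForm D x₀ y₀ T₀ u v h₁ h₂ μs ε₁)
    {q : ℝ × ℝ × ℝ} (hq : μs < q.1) :
    ContDiffAt ℝ ∞ (fun q : ℝ × ℝ × ℝ => nearId u v q.2.2 (q.1, q.2.1)) q := by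
  have ho : {q : ℝ × ℝ × ℝ | μs < q.1} ∈ 𝓝 q :=
    (isOpen_lt continuous_const continuous_fst).mem_nhds hq
  have hu := hψ.u_mem.1.contDiffAt ho
  have hv := hψ.v_mem.1.contDiffAt ho
  exact (contDiffAt_fst.add hu).prodMk (ContDiffAt.add (by fun_prop) hv)

theorem IsNormalForm.contDiffAt_nearId_slice (hψ : IsNormalForm D x₀ y₀ T₀ u v h₁ h₂ μs ε₁)
    (t : ℝ) {z : ℝ × ℝ} (hz : μs < z.1) : ContDiffAt ℝ ∞ (nearId u v t) z :=
  ContDiffAt.comp (f := fun z : ℝ × ℝ => (z.1, z.2, t)) z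
    (hψ.contDiffAt_nearId (q := (z.1, z.2, t)) hz) (by fun_prop)

theorem IsNormalForm.nearId_add_int (hψ : IsNormalForm D x₀ y₀ T₀ u v h₁ h₂ μs ε₁) {t m : ℝ}
    (hm : μs < m) (φ : ℝ) (k : ℤ) :
    nearId u v t (m, φ + k) = nearId u v t (m, φ) + (0, (k : ℝ)) := by
  simp only [nearId, hψ.u_mem.add_int hm, hψ.v_mem.add_int hm]
  ext <;> simp; ring

variable (href : IsReferenceSolution D.n x₀ y₀ T₀) (hψ : IsNormalForm D x₀ y₀ T₀ u v h₁ h₂ μs ε₁)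
include href hψ

theorem exists_hasStrictFDerivAt_planeMap (t : ℝ) {z : ℝ × ℝ} (hz : μs < z.1) :
    ∃ L : ℝ × ℝ →L[ℝ] ℝ × ℝ, HasStrictFDerivAt (planeMap D.n x₀ y₀ T₀ u v t) L z ∧
      |L.det| = 1 := by
  have hpos := hψ.action_pos t z hz
  have h1 := (href.contDiffAt_actionAngle hpos).hasStrictFDerivAt'
    (href.hasFDerivAt_actionAngle hpos) one_ne_zero
  have h2 := (hψ.contDiffAt_nearId_slice t hz).hasStrictFDerivAt (by simp)
  refine ⟨_, h1.comp z h2, ?_⟩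
  have h3 := LinearMap.det_comp
    (actionAngleDeriv D.n x₀ y₀ T₀ (nearId u v t z) : ℝ × ℝ →ₗ[ℝ] ℝ × ℝ)
    (fderiv ℝ (nearId u v t) z : ℝ × ℝ →ₗ[ℝ] ℝ × ℝ)
  have h4 := href.det_actionAngleDeriv hpos
  have h5 := hψ.symplectic t z hz
  simp only [ContinuousLinearMap.det, ContinuousLinearMap.toLinearMap_comp] at h4 h5 ⊢
  rw [h3, h4, h5]
  norm_num

theorem planeMap_eq_of_proj_eq (t : ℝ) {z z' : ℝ × ℝ} (hz : μs < z.1) (h : proj z = proj z') :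
    planeMap D.n x₀ y₀ T₀ u v t z = planeMap D.n x₀ y₀ T₀ u v t z' := by
  obtain ⟨h1, k, hk⟩ := proj_eq_iff.1 h
  have hz2 : z = (z'.1, z'.2 + k) := Prod.ext h1 (by simp only; linarith)
  have h3 := hψ.nearId_add_int (t := t) (h1 ▸ hz) z'.2 k
  have hper : Function.Periodic (fun θ => actionAngle D.n x₀ y₀ T₀ ((nearId u v t z').1, θ)) 1 :=
    fun θ => href.actionAngle_add_one _ θ
  have h4 := hper.zsmul k (nearId u v t z').2
  rw [zsmul_eq_mul, mul_one] at h4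
  unfold planeMap
  rw [hz2, h3, ← h4]
  congr 1
  ext <;> simp

theorem proj_eq_of_planeMap_eq (t : ℝ) {z z' : ℝ × ℝ} (hz : μs < z.1) (hz' : μs < z'.1)
    (h : planeMap D.n x₀ y₀ T₀ u v t z = planeMap D.n x₀ y₀ T₀ u v t z') : proj z = proj z' :=
  hψ.injective t z z' hz hz' (href.proj_eq_of_actionAngle_eq (hψ.action_pos t z hz)
    (hψ.action_pos t z' hz') h)

theorem chart_proj (t : ℝ) {z : ℝ × ℝ} (hz : μs < z.1) :
    chart D.n x₀ y₀ T₀ u v t (proj z) = planeMap D.n x₀ y₀ T₀ u v t z :=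
  planeMap_eq_of_proj_eq href hψ t hz (proj_lift _)

theorem chart_ne_zero (t : ℝ) {z : Cyl} (hz : μs < z.1) : chart D.n x₀ y₀ T₀ u v t z ≠ 0 :=
  href.actionAngle_ne_zero (hψ.action_pos t _ hz)

omit href in
/-- By periodicity in time, the charts at the times `0` and `1` agree. -/
theorem chart_one {z : Cyl} (hz : μs < z.1) :
    chart D.n x₀ y₀ T₀ u v 1 z = chart D.n x₀ y₀ T₀ u v 0 z := by
  have h1 := (hψ.u_mem.2.1 (lift z).1 (lift z).2 0 hz).2
  have h2 := (hψ.v_mem.2.1 (lift z).1 (lift z).2 0 hz).2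
  rw [zero_add] at h1 h2
  simp only [chart, planeMap, nearId, h1, h2]

theorem injOn_chart (t : ℝ) : InjOn (chart D.n x₀ y₀ T₀ u v t) (upperCyl μs) := by
  intro z hz z' hz' h
  rw [← proj_lift z, ← proj_lift z']
  exact proj_eq_of_planeMap_eq href hψ t hz hz' h

theorem continuousOn_chart (t : ℝ) : ContinuousOn (chart D.n x₀ y₀ T₀ u v t) (upperCyl μs) := by
  intro z hz
  refine ContinuousAt.continuousWithinAt ?_
  rw [← proj_lift z] at hz ⊢
  have hz' : μs < (lift z).1 := hz
  obtain ⟨L, hL, -⟩ := exists_hasStrictFDerivAt_planeMap href hψ t hz'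
  have hmap : map proj (𝓝 (lift z)) = 𝓝 (proj (lift z)) :=
    isOpenMap_proj.map_nhds_eq continuous_proj.continuousAt
  rw [ContinuousAt, ← hmap, tendsto_map'_iff, chart_proj href hψ t hz']
  refine hL.hasFDerivAt.continuousAt.tendsto.congr' ?_
  filter_upwards [(isOpen_lt continuous_const continuous_fst).mem_nhds hz'] with w hw
  exact (chart_proj href hψ t hw).symm

/-- The chart preserves area. -/
theorem measurableSet_and_volume_image_chart (t : ℝ) {S : Set Cyl} (hS : S ⊆ upperCyl μs)
    (hSm : MeasurableSet S) : MeasurableSet (chart D.n x₀ y₀ T₀ u v t '' S) ∧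
      volume (chart D.n x₀ y₀ T₀ u v t '' S) = volume S := by
  -- a fundamental domain of the preimage of `S`
  set S' : Set (ℝ × ℝ) := proj ⁻¹' S ∩ univ ×ˢ Ioc 0 (0 + 1) with hS'
  have hm' : MeasurableSet (proj ⁻¹' S) := continuous_proj.measurable hSm
  have hS'm : MeasurableSet S' := hm'.inter (MeasurableSet.univ.prod measurableSet_Ioc)
  have hμ : ∀ z ∈ S', μs < z.1 := fun z hz => hS hz.1
  have himg : chart D.n x₀ y₀ T₀ u v t '' S = planeMap D.n x₀ y₀ T₀ u v t '' S' := by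
    ext w
    constructor
    · rintro ⟨z, hz, rfl⟩
      have : Fact (0 < (1 : ℝ)) := ⟨one_pos⟩
      have hco := AddCircle.coe_equivIoc (p := (1 : ℝ)) (a := 0) (y := z.2)
      have hp : proj (z.1, (AddCircle.equivIoc 1 0 z.2 : ℝ)) = z := Prod.ext rfl hco
      refine ⟨(z.1, (AddCircle.equivIoc 1 0 z.2 : ℝ)), ⟨?_, mem_univ _,
        (AddCircle.equivIoc 1 0 z.2).2⟩, ?_⟩
      · rw [mem_preimage, hp]; exact hz
      · have hz' : μs < z.1 := hS hz
        rw [← chart_proj href hψ t (z := (z.1, _)) hz', hp]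
    · rintro ⟨z, hz, rfl⟩
      exact ⟨proj z, hz.1, chart_proj href hψ t (hμ z hz)⟩
  have hinj : InjOn (planeMap D.n x₀ y₀ T₀ u v t) S' := by
    intro z hz z' hz' h
    obtain ⟨h1, k, hk⟩ := proj_eq_iff.1 (proj_eq_of_planeMap_eq href hψ t (hμ z hz) (hμ z' hz') h)
    have a1 := hz.2.2
    have a2 := hz'.2.2
    simp only [zero_add, mem_Ioc] at a1 a2
    have hk0 : k = 0 := by
      have b1 : (k : ℝ) < 1 := by linarith
      have b2 : (-1 : ℝ) < k := by linarith
      have c1 : k < 1 := by exact_mod_cast b1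
      have c2 : -1 < k := by exact_mod_cast b2
      omega
    rw [hk0, Int.cast_zero, sub_eq_zero] at hk
    exact Prod.ext h1 hk
  choose! L hL hdet using fun z (hz : z ∈ S') =>
    exists_hasStrictFDerivAt_planeMap href hψ t (hμ z hz)
  have hd : ∀ z ∈ S', HasFDerivWithinAt (planeMap D.n x₀ y₀ T₀ u v t) (L z) S' z := fun z hz =>
    (hL z hz).hasFDerivAt.hasFDerivWithinAt
  rw [himg]
  refine ⟨hS'm.image_of_continuousOn_injOn (fun z hz => (hd z hz).continuousWithinAt) hinj, ?_⟩
  rw [← lintegral_abs_det_fderiv_eq_addHaar_image volume hS'm hd hinj,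
    setLIntegral_congr_fun (g := fun _ => 1) hS'm
      (fun z hz => by simp only [hdet z hz, ENNReal.ofReal_one]), setLIntegral_one]
  have hmp : MeasurePreserving proj (volume.restrict (univ ×ˢ Ioc (0 : ℝ) (0 + 1))) volume := by
    have : Fact (0 < (1 : ℝ)) := ⟨one_pos⟩
    have h := (MeasurePreserving.id (volume : Measure ℝ)).prod (AddCircle.measurePreserving_mk 1 0)
    rw [← Measure.restrict_univ (μ := (volume : Measure ℝ)), Measure.prod_restrict,
      Measure.restrict_univ] at h
    exact h
  rw [← hmp.measure_preimage hSm.nullMeasurableSet, Measure.restrict_apply hm']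

end chart

/-! ### Area-preserving relations from plane maps -/

/-- A differentiable, locally injective plane map with derivatives of determinant `±1`. -/
structure IsLocallyUnimodular (G : ℝ × ℝ → ℝ × ℝ) : Prop where
  hasFDerivAt : ∀ p, ∃ L : ℝ × ℝ →L[ℝ] ℝ × ℝ, HasFDerivAt G L p ∧ |L.det| = 1
  injOn : ∀ p, ∃ U ∈ 𝓝 p, InjOn G U

namespace IsLocallyUnimodular

variable {G G' : ℝ × ℝ → ℝ × ℝ}

theorem continuous (hG : IsLocallyUnimodular G) : Continuous G :=
  continuous_iff_continuousAt.2 fun p => (hG.hasFDerivAt p).choose_spec.1.continuousAt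

theorem comp (hG : IsLocallyUnimodular G) (hG' : IsLocallyUnimodular G') :
    IsLocallyUnimodular (G ∘ G') where
  hasFDerivAt p := by
    obtain ⟨L', hL', hd'⟩ := hG'.hasFDerivAt p
    obtain ⟨L, hL, hd⟩ := hG.hasFDerivAt (G' p)
    refine ⟨_, hL.comp p hL', ?_⟩
    have h3 := LinearMap.det_comp (L : ℝ × ℝ →ₗ[ℝ] ℝ × ℝ) (L' : ℝ × ℝ →ₗ[ℝ] ℝ × ℝ)
    simp only [ContinuousLinearMap.det, ContinuousLinearMap.toLinearMap_comp] at hd hd' ⊢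
    rw [h3, abs_mul, hd, hd', one_mul]
  injOn p := by
    obtain ⟨U', hU', hi'⟩ := hG'.injOn p
    obtain ⟨U, hU, hi⟩ := hG.injOn (G' p)
    exact ⟨U' ∩ G' ⁻¹' U, inter_mem hU' (hG'.continuous.continuousAt hU),
      hi.comp (hi'.mono inter_subset_left) fun z hz => hz.2⟩

theorem measurableSet_and_volume_image (hG : IsLocallyUnimodular G) {T : Set (ℝ × ℝ)}
    (hT : MeasurableSet T) (hi : InjOn G T) :
    MeasurableSet (G '' T) ∧ volume (G '' T) = volume T := by
  choose L hL hdet using hG.hasFDerivAt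
  refine ⟨hT.image_of_continuousOn_injOn hG.continuous.continuousOn hi, ?_⟩
  rw [← lintegral_abs_det_fderiv_eq_addHaar_image volume hT
    (fun z _ => (hL z).hasFDerivWithinAt) hi]
  simp [hdet]

end IsLocallyUnimodular

theorem isLocallyUnimodular_of_contDiff {G : ℝ × ℝ → ℝ × ℝ} (hG : ContDiff ℝ 1 G)
    (hdet : ∀ p, (fderiv ℝ G p).det = 1) : IsLocallyUnimodular G where
  hasFDerivAt p := ⟨_, (hG.differentiable one_ne_zero p).hasFDerivAt, by rw [hdet, abs_one]⟩
  injOn p := by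
    obtain ⟨e, hp, rfl⟩ := exists_openPartialHomeomorph
      (hG.contDiffAt.hasStrictFDerivAt (x := p) one_ne_zero) (by rw [hdet]; exact one_ne_zero)
    exact ⟨e.source, e.open_source.mem_nhds hp, e.injOn⟩

section relations

variable {D : ImpulsiveDuffing} {x₀ y₀ : ℝ → ℝ} {T₀ : ℝ} {u v : ℝ → ℝ → ℝ → ℝ} {h₁ : ℝ → ℝ → ℝ}
  {h₂ : ℝ → ℝ → ℝ → ℝ} {μs ε₁ : ℝ}

/-- The relation `R` on the cylinder is a restriction of the plane map `G`, in the charts at the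
times `s` and `t`. -/
def IsChartOf (D : ImpulsiveDuffing) (x₀ y₀ : ℝ → ℝ) (T₀ : ℝ) (u v : ℝ → ℝ → ℝ → ℝ) (μs s t : ℝ)
    (R : Cyl → Cyl → Prop) (G : ℝ × ℝ → ℝ × ℝ) : Prop :=
  ∀ z w, R z w → μs < z.1 ∧ μs < w.1 ∧
    chart D.n x₀ y₀ T₀ u v t w = G (chart D.n x₀ y₀ T₀ u v s z)

/-- A restriction of a plane map with derivatives of determinant `±1` preserves area wherever that map
is injective. -/
theorem isAreaPreservingOn_of_isChartOf (href : IsReferenceSolution D.n x₀ y₀ T₀)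
    (hψ : IsNormalForm D x₀ y₀ T₀ u v h₁ h₂ μs ε₁) {s t : ℝ} {R : Cyl → Cyl → Prop}
    {G : ℝ × ℝ → ℝ × ℝ} (hR : IsChartOf D x₀ y₀ T₀ u v μs s t R G) (hG : IsLocallyUnimodular G)
    {A : Set Cyl} (hA : A ⊆ dom R) (hi : InjOn G (chart D.n x₀ y₀ T₀ u v s '' A)) :
    IsAreaPreservingOn R A := by
  have hAu : A ⊆ upperCyl μs := fun z hz => by
    obtain ⟨w, hw⟩ := hA hz
    exact (hR z w hw).1
  have huniq : ∀ z w w', R z w → R z w' → w = w' := fun z w w' h h' =>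
    injOn_chart href hψ t (hR z w h).2.1 (hR z w' h').2.1
      ((hR z w h).2.2.trans (hR z w' h').2.2.symm)
  refine ⟨fun z hz => ?_, fun z hz z' hz' w h h' => ?_, fun S hS hSm => ?_⟩
  · obtain ⟨w, hw⟩ := hA hz
    exact ⟨w, hw, fun w' hw' => huniq z w' w hw' hw⟩
  · exact injOn_chart href hψ s (hR z w h).1 (hR z' w h').1 (hi ⟨z, hz, rfl⟩ ⟨z', hz', rfl⟩
      ((hR z w h).2.2.symm.trans (hR z' w h').2.2))
  · obtain ⟨hm1, hv1⟩ := measurableSet_and_volume_image_chart href hψ s (hS.trans hAu) hSm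
    obtain ⟨hm2, hv2⟩ := hG.measurableSet_and_volume_image hm1 (hi.mono (image_mono hS))
    have him : image R S = Subtype.val '' ((upperCyl μs).domRestrict
        (chart D.n x₀ y₀ T₀ u v t) ⁻¹' (G '' (chart D.n x₀ y₀ T₀ u v s '' S))) := by
      ext w
      constructor
      · rintro ⟨z, hz, h⟩
        exact ⟨⟨w, (hR z w h).2.1⟩, ⟨_, ⟨z, hz, rfl⟩, (hR z w h).2.2.symm⟩, rfl⟩
      · rintro ⟨⟨w, hw⟩, ⟨_, ⟨z, hz, rfl⟩, h⟩, rfl⟩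
        obtain ⟨w', hw'⟩ := hA (hS hz)
        have : w' = w := injOn_chart href hψ t (hR z w' hw').2.1 hw ((hR z w' hw').2.2.trans h)
        exact ⟨z, hz, this ▸ hw'⟩
    have hm : MeasurableSet (image R S) := by
      rw [him]
      exact (isOpen_upperCyl μs).measurableSet.subtype_image
        ((continuousOn_iff_continuous_domRestrict.1 (continuousOn_chart href hψ t)).measurable hm2)
    have hsub : image R S ⊆ upperCyl μs := by
      rintro w ⟨z, -, h⟩
      exact (hR z w h).2.1
    refine ⟨hm, ?_⟩
    rw [← (measurableSet_and_volume_image_chart href hψ t hsub hm).2, ← hv1, ← hv2]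
    congr 1
    ext p
    constructor
    · rintro ⟨w, ⟨z, hz, h⟩, rfl⟩
      exact ⟨_, ⟨z, hz, rfl⟩, (hR z w h).2.2.symm⟩
    · rintro ⟨_, ⟨z, hz, rfl⟩, rfl⟩
      obtain ⟨w, hw⟩ := hA (hS hz)
      exact ⟨w, ⟨z, hz, hw⟩, (hR z w hw).2.2⟩

theorem isLocallyAreaPreserving_of_isChartOf (href : IsReferenceSolution D.n x₀ y₀ T₀)
    (hψ : IsNormalForm D x₀ y₀ T₀ u v h₁ h₂ μs ε₁) {s t : ℝ} {R : Cyl → Cyl → Prop}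
    {G : ℝ × ℝ → ℝ × ℝ} (hR : IsChartOf D x₀ y₀ T₀ u v μs s t R G)
    (hG : IsLocallyUnimodular G) : IsLocallyAreaPreserving R := by
  intro z hz
  obtain ⟨w, hw⟩ := hz
  obtain ⟨V, hV, hi⟩ := hG.injOn (chart D.n x₀ y₀ T₀ u v s z)
  have hzu : z ∈ upperCyl μs := (hR z w hw).1
  have hc := (continuousOn_chart href hψ s).continuousAt ((isOpen_upperCyl μs).mem_nhds hzu)
  refine ⟨_, hc hV, isAreaPreservingOn_of_isChartOf href hψ hR hG inter_subset_left
    (hi.mono ?_)⟩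
  rintro _ ⟨z', hz', rfl⟩
  exact hz'.2

end relations

/-! ### The Duffing flow and the jumps in the plane -/

namespace ImpulsiveDuffing

variable (D : ImpulsiveDuffing)

/-- The restoring force `x ^ (2n+1) + ∑ p_i(t) x ^ i`. -/
def force (t x : ℝ) : ℝ := x ^ (2 * D.n + 1) + ∑ i ∈ Finset.range (2 * D.n + 1), D.p i t * x ^ i

/-- The vector field of the Duffing equation in the plane. -/
def field (t : ℝ) (w : ℝ × ℝ) : ℝ × ℝ := (w.2, -D.force t w.1)

theorem contDiff_p {i : ℕ} (hi : i ∈ Finset.range (2 * D.n + 1)) : ContDiff ℝ ∞ (D.p i) :=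
  D.p_smooth i (by have := Finset.mem_range.1 hi; omega)

theorem contDiff_force : ContDiff ℝ 1 fun q : ℝ × ℝ => D.force q.1 q.2 := by
  unfold force
  refine (contDiff_snd.pow _).add (ContDiff.sum fun i hi => ?_)
  exact (((D.contDiff_p hi).of_le (by simp)).comp contDiff_fst).mul (contDiff_snd.pow i)

theorem contDiff_planeHam : ContDiff ℝ 1 fun q : ℝ × ℝ × ℝ => D.planeHam q.2 q.1 := by
  unfold planeHam
  refine ContDiff.add (by fun_prop) (ContDiff.sum fun i hi => ?_)
  have := ((D.contDiff_p hi).of_le (n := ∞) (m := 1) (by simp)).comp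
    (contDiff_fst (𝕜 := ℝ) (E := ℝ) (F := ℝ × ℝ))
  exact (this.mul (by fun_prop)).div_const _

/-- The derivative of the Hamiltonian along an arbitrary curve. -/
theorem hasDerivAt_planeHam {x y τ : ℝ → ℝ} {s x' y' τ' : ℝ} (hx : HasDerivAt x x' s)
    (hy : HasDerivAt y y' s) (hτ : HasDerivAt τ τ' s) :
    HasDerivAt (fun s => D.planeHam (x s, y s) (τ s))
      (D.force (τ s) (x s) * x' + y s * y' +
        ∑ i ∈ Finset.range (2 * D.n + 1), deriv (D.p i) (τ s) * τ' * x s ^ (i + 1) / (i + 1)) s := by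
  have h1 : HasDerivAt (fun s => y s ^ 2 / 2) (y s * y') s :=
    ((hy.pow 2).div_const 2).congr_deriv (by simp; ring)
  have h2 : HasDerivAt (fun s => x s ^ (2 * D.n + 2) / (2 * D.n + 2)) (x s ^ (2 * D.n + 1) * x') s :=
    ((hx.pow (2 * D.n + 2)).div_const _).congr_deriv (by
      have : (2 * (D.n : ℝ) + 2) ≠ 0 := by positivity
      push_cast; field_simp)
  have h3 : HasDerivAt (fun s => ∑ i ∈ Finset.range (2 * D.n + 1),
      D.p i (τ s) * x s ^ (i + 1) / (i + 1))
      (∑ i ∈ Finset.range (2 * D.n + 1), (D.p i (τ s) * x s ^ i * x' +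
        deriv (D.p i) (τ s) * τ' * x s ^ (i + 1) / (i + 1))) s := by
    refine HasDerivAt.fun_sum fun i hi => ?_
    have hp : HasDerivAt (D.p i) (deriv (D.p i) (τ s)) (τ s) :=
      (((D.contDiff_p hi).differentiable (by simp)) _).hasDerivAt
    refine (((hp.comp s hτ).mul (hx.pow (i + 1))).div_const _).congr_deriv ?_
    have : ((i : ℝ) + 1) ≠ 0 := by positivity
    simp only [Function.comp_apply, Pi.pow_apply, Nat.add_succ_sub_one, add_zero]
    push_cast
    field_simp
    ring
  refine ((h1.add h2).add h3).congr_deriv ?_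
  rw [Finset.sum_add_distrib, force, add_mul, Finset.sum_mul]
  ring

/-- Young-type bound of the lower order terms of the Hamiltonian by the leading one. -/
theorem abs_sum_le {a : ℕ → ℝ} {P : ℝ} (ha : ∀ i ∈ Finset.range (2 * D.n + 1), |a i| ≤ P) (x : ℝ)
    {ε : ℝ} (hε : 0 < ε) (hε1 : ε ≤ 1) :
    |∑ i ∈ Finset.range (2 * D.n + 1), a i * x ^ (i + 1) / (i + 1)| ≤
      (2 * D.n + 1) * P * (ε * x ^ (2 * D.n + 2) + (1 / ε) ^ (2 * D.n + 1)) := by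
  have hx0 : 0 ≤ x ^ (2 * D.n + 2) := by
    rw [show 2 * D.n + 2 = 2 * (D.n + 1) by ring, pow_mul]; positivity
  have hε1' : 1 ≤ 1 / ε := by rwa [le_div_iff₀ hε, one_mul]
  have hterm : ∀ i ∈ Finset.range (2 * D.n + 1), |a i * x ^ (i + 1) / (i + 1)| ≤
      P * (ε * x ^ (2 * D.n + 2) + (1 / ε) ^ (2 * D.n + 1)) := by
    intro i hi
    have hi' : i + 1 ≤ 2 * D.n + 1 := by have := Finset.mem_range.1 hi; omega
    have hpow : |x| ^ (i + 1) ≤ ε * x ^ (2 * D.n + 2) + (1 / ε) ^ (2 * D.n + 1) := by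
      rcases le_total |x| (1 / ε) with h | h
      · have h1 : |x| ^ (i + 1) ≤ (1 / ε) ^ (i + 1) := pow_le_pow_left₀ (abs_nonneg _) h _
        have h2 : (1 / ε) ^ (i + 1) ≤ (1 / ε) ^ (2 * D.n + 1) := pow_le_pow_right₀ hε1' hi'
        have : 0 ≤ ε * x ^ (2 * D.n + 2) := by positivity
        linarith
      · have h1 : |x| ^ (i + 1) ≤ |x| ^ (2 * D.n + 1) := pow_le_pow_right₀ (hε1'.trans h) hi'
        have h2 : 1 ≤ ε * |x| := by
          rw [div_le_iff₀ hε] at h; linarith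
        have h3 : x ^ (2 * D.n + 2) = |x| ^ (2 * D.n + 1) * |x| := by
          rw [← pow_succ, ← abs_pow, abs_of_nonneg hx0]
        have h4 : 0 ≤ |x| ^ (2 * D.n + 1) := by positivity
        have h5 : 0 ≤ (1 / ε) ^ (2 * D.n + 1) := by positivity
        rw [h3]
        nlinarith
    rw [abs_div, abs_mul, abs_pow, abs_of_pos (by positivity : (0 : ℝ) < i + 1)]
    have h0 : 0 ≤ |a i| * |x| ^ (i + 1) := by positivity
    calc |a i| * |x| ^ (i + 1) / (i + 1) ≤ |a i| * |x| ^ (i + 1) :=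
          div_le_self h0 (by have : (0 : ℝ) ≤ i := Nat.cast_nonneg i
                             linarith)
      _ ≤ P * (ε * x ^ (2 * D.n + 2) + (1 / ε) ^ (2 * D.n + 1)) := by
          have := ha i hi
          have h1 := abs_nonneg (a i)
          gcongr
          linarith
  refine (Finset.abs_sum_le_sum_abs _ _).trans ((Finset.sum_le_sum hterm).trans_eq ?_)
  rw [Finset.sum_const, Finset.card_range, nsmul_eq_mul]
  push_cast
  ring

theorem exists_bound_coeff (s t : ℝ) : ∃ P, 0 ≤ P ∧ ∀ i ∈ Finset.range (2 * D.n + 1),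
    ∀ τ ∈ Icc s t, |D.p i τ| ≤ P ∧ |deriv (D.p i) τ| ≤ P := by
  have h : ∀ i ∈ Finset.range (2 * D.n + 1), ∃ P, ∀ τ ∈ Icc s t,
      |D.p i τ| ≤ P ∧ |deriv (D.p i) τ| ≤ P := by
    intro i hi
    obtain ⟨P, hP⟩ := (isCompact_Icc (a := s) (b := t)).exists_bound_of_continuousOn
      (D.contDiff_p hi).continuous.continuousOn
    obtain ⟨Q, hQ⟩ := (isCompact_Icc (a := s) (b := t)).exists_bound_of_continuousOn
      ((D.contDiff_p hi).continuous_deriv (by simp)).continuousOn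
    exact ⟨max P Q, fun τ hτ => ⟨(hP τ hτ).trans (le_max_left _ _),
      (hQ τ hτ).trans (le_max_right _ _)⟩⟩
  choose! P hP using h
  refine ⟨∑ i ∈ Finset.range (2 * D.n + 1), |P i|, Finset.sum_nonneg fun i _ => abs_nonneg _,
    fun i hi τ hτ => ?_⟩
  have h1 : |P i| ≤ ∑ i ∈ Finset.range (2 * D.n + 1), |P i| :=
    Finset.single_le_sum (f := fun i => |P i|) (fun i _ => abs_nonneg _) hi
  exact ⟨((hP i hi τ hτ).1.trans (le_abs_self _)).trans h1,
    ((hP i hi τ hτ).2.trans (le_abs_self _)).trans h1⟩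

/-- The Duffing equation without impulses is complete: its Hamiltonian, shifted by a constant,
bounds its own time derivative. -/
theorem isTame_field (s t : ℝ) : IsTame D.field s t where
  contDiff := (contDiff_snd.comp contDiff_snd).prodMk
    (D.contDiff_force.comp (by fun_prop : ContDiff ℝ 1 fun q : ℝ × ℝ × ℝ => (q.1, q.2.1))).neg
  trace τ w := by
    have hf : ContDiff ℝ 1 fun x => D.force τ x :=
      D.contDiff_force.comp (by fun_prop : ContDiff ℝ 1 fun x : ℝ => (τ, x))
    have h1 := ((hf.differentiable one_ne_zero) w.1).hasFDerivAt.comp w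
      (hasFDerivAt_fst (𝕜 := ℝ) (E := ℝ) (F := ℝ) (p := w))
    have h2 := (hasFDerivAt_snd (𝕜 := ℝ) (E := ℝ) (F := ℝ) (p := w)).prodMk h1.neg
    have h3 : fderiv ℝ (D.field τ) w = _ := h2.fderiv
    rw [h3]
    simp
  lyapunov := by
    obtain ⟨P, hP0, hP⟩ := D.exists_bound_coeff s t
    -- `N` bounds the sum of the lower order coefficients, and `ε` is so small that the lower order
    -- terms take, up to a constant, at most half of the leading term `x ^ (2n+2) / (2n+2)`
    set N : ℝ := (2 * D.n + 1) * P with hN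
    have hN0 : 0 ≤ N := by positivity
    set ε : ℝ := 1 / (4 * (D.n + 1) * (N + 1)) with hε
    have hε0 : 0 < ε := by positivity
    have hε1 : ε ≤ 1 := by
      rw [hε, div_le_one (by positivity)]
      have : (0 : ℝ) ≤ D.n := Nat.cast_nonneg _
      nlinarith
    have hNε : N * ε ≤ 1 / (4 * (D.n + 1)) := by
      rw [hε, mul_one_div, div_le_div_iff₀ (by positivity) (by positivity)]
      have : (0 : ℝ) ≤ D.n := Nat.cast_nonneg _
      nlinarith
    set C₀ : ℝ := N * (1 / ε) ^ (2 * D.n + 1) with hC₀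
    have hC₀0 : 0 ≤ C₀ := by positivity
    have hlow : ∀ τ ∈ Icc s t, ∀ w : ℝ × ℝ, w.2 ^ 2 / 2 + w.1 ^ (2 * D.n + 2) / (4 * (D.n + 1)) + 1
        ≤ D.planeHam w τ + (C₀ + 1) := by
      intro τ hτ w
      have hx0 : 0 ≤ w.1 ^ (2 * D.n + 2) := by
        rw [show 2 * D.n + 2 = 2 * (D.n + 1) by ring, pow_mul]; positivity
      have h1 := D.abs_sum_le (a := fun i => D.p i τ) (fun i hi => (hP i hi τ hτ).1) w.1 hε0 hε1
      have h2 := neg_le_of_abs_le h1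
      rw [← hN, mul_add, ← hC₀, ← mul_assoc] at h2
      have h3 : N * ε * w.1 ^ (2 * D.n + 2) ≤ 1 / (4 * (D.n + 1)) * w.1 ^ (2 * D.n + 2) := by gcongr
      have h4 : w.1 ^ (2 * D.n + 2) / (2 * D.n + 2) =
          w.1 ^ (2 * D.n + 2) / (4 * (D.n + 1)) + 1 / (4 * (D.n + 1)) * w.1 ^ (2 * D.n + 2) := by
        field_simp; ring
      unfold planeHam
      linarith
    refine ⟨fun q => D.planeHam q.2 q.1 + (C₀ + 1), N * (4 * (D.n + 1)),
      D.contDiff_planeHam.add contDiff_const, fun τ hτ w => ⟨?_, ?_⟩, fun B => ?_⟩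
    · have := hlow τ hτ w
      have hx0 : 0 ≤ w.1 ^ (2 * D.n + 2) := by
        rw [show 2 * D.n + 2 = 2 * (D.n + 1) by ring, pow_mul]; positivity
      have : 0 ≤ w.2 ^ 2 / 2 + w.1 ^ (2 * D.n + 2) / (4 * (D.n + 1)) := by positivity
      simp only
      linarith
    · -- along the field only the explicit time dependence contributes to the derivative of `h`
      have hline : HasDerivAt (fun r : ℝ => (τ + r * 1, w + r • D.field τ w))
          ((1 : ℝ), D.field τ w) 0 := by
        refine HasDerivAt.prodMk ?_ ?_
        · simpa using (hasDerivAt_mul_const (1 : ℝ) (x := 0)).const_add τ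
        · simpa using (((hasDerivAt_id (0 : ℝ)).smul_const (D.field τ w)).const_add w)
      have hV := ((D.contDiff_planeHam.add (contDiff_const (c := C₀ + 1))).differentiable
        one_ne_zero (τ + 0 * 1, w + (0 : ℝ) • D.field τ w)).hasFDerivAt.comp_hasDerivAt 0 hline
      have hx := (hasFDerivAt_fst (𝕜 := ℝ) (E := ℝ) (F := ℝ) (p := w + (0 : ℝ) • D.field τ w)
        ).comp_hasDerivAt (0 : ℝ) hline.snd
      have hy := (hasFDerivAt_snd (𝕜 := ℝ) (E := ℝ) (F := ℝ) (p := w + (0 : ℝ) • D.field τ w)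
        ).comp_hasDerivAt (0 : ℝ) hline.snd
      have hW := (D.hasDerivAt_planeHam hx hy hline.fst).add_const (C₀ + 1)
      have heq := hV.unique hW
      simp only [zero_mul, add_zero, zero_smul] at heq
      have h1 := D.abs_sum_le (a := fun i => deriv (D.p i) τ) (fun i hi => (hP i hi τ hτ).2) w.1
        one_pos le_rfl
      have hlo := hlow τ hτ w
      have hy0 := sq_nonneg w.2
      have hn : (0 : ℝ) < 4 * (D.n + 1) := by positivity
      have h2 : w.1 ^ (2 * D.n + 2) + 1 ≤ 4 * (D.n + 1) * (D.planeHam w τ + (C₀ + 1)) := by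
        have h3 : 4 * ((D.n : ℝ) + 1) * (w.1 ^ (2 * D.n + 2) / (4 * (D.n + 1))) =
          w.1 ^ (2 * D.n + 2) := by field_simp
        have h4 : (0 : ℝ) ≤ D.n := Nat.cast_nonneg _
        nlinarith
      have heq' : fderiv ℝ (fun q : ℝ × ℝ × ℝ => D.planeHam q.2 q.1 + (C₀ + 1)) (τ, w)
          (1, D.field τ w) = ∑ i ∈ Finset.range (2 * D.n + 1),
            deriv (D.p i) τ * w.1 ^ (i + 1) / (i + 1) := by
        refine heq.trans ?_
        simp [field]
        ring
      rw [heq']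
      refine h1.trans ?_
      calc (2 * D.n + 1) * P * (1 * w.1 ^ (2 * D.n + 2) + (1 / 1) ^ (2 * D.n + 1))
          = N * (w.1 ^ (2 * D.n + 2) + 1) := by rw [hN, one_mul, div_one, one_pow]
        _ ≤ N * (4 * (D.n + 1) * (D.planeHam w τ + (C₀ + 1))) := mul_le_mul_of_nonneg_left h2 hN0
        _ = N * (4 * (D.n + 1)) * (D.planeHam w τ + (C₀ + 1)) := (mul_assoc _ _ _).symm
    · refine ⟨1 + (2 + 4 * (D.n + 1)) * |B|, fun τ hτ w hw => ?_⟩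
      have hlo := (hlow τ hτ w).trans hw
      have hx0 : 0 ≤ w.1 ^ (2 * D.n + 2) := by
        rw [show 2 * D.n + 2 = 2 * (D.n + 1) by ring, pow_mul]; positivity
      have hy0 := sq_nonneg w.2
      have hn : (0 : ℝ) ≤ D.n := Nat.cast_nonneg _
      have hq : 0 ≤ w.1 ^ (2 * D.n + 2) / (4 * (D.n + 1)) := by positivity
      have hB : B ≤ |B| := le_abs_self B
      have hx1 : w.1 ^ (2 * D.n + 2) ≤ 4 * (D.n + 1) * |B| := by
        have h3 : 4 * ((D.n : ℝ) + 1) * (w.1 ^ (2 * D.n + 2) / (4 * (D.n + 1))) =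
          w.1 ^ (2 * D.n + 2) := by field_simp
        rw [← h3]
        gcongr
        linarith
      have hB0 := abs_nonneg B
      have hnB : 0 ≤ D.n * |B| := by positivity
      rw [Prod.norm_def, Real.norm_eq_abs, Real.norm_eq_abs, max_le_iff]
      constructor
      · rcases le_total |w.1| 1 with h | h
        · nlinarith
        · have h2 : |w.1| ≤ |w.1| ^ (2 * D.n + 2) := le_self_pow₀ h (by omega)
          rw [← abs_pow, abs_of_nonneg hx0] at h2
          nlinarith
      · have h2 : |w.2| ≤ 1 + w.2 ^ 2 := by
          have := sq_nonneg (|w.2| - 1)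
          rw [← sq_abs]
          nlinarith
        nlinarith

end ImpulsiveDuffing

section conjugation

variable {D : ImpulsiveDuffing} {x₀ y₀ : ℝ → ℝ} {T₀ : ℝ}

/-- In action-angle variables the Hamiltonian system of `H` is the Duffing equation. The map reverses
the orientation, which the sign convention of `hamField` compensates. -/
theorem actionAngleDeriv_hamField (href : IsReferenceSolution D.n x₀ y₀ T₀) (t : ℝ) {z : ℝ × ℝ}
    (hz : 0 < z.1) : actionAngleDeriv D.n x₀ y₀ T₀ z (hamField (D.actionHam x₀ y₀ T₀) t z) =
      D.field t (actionAngle D.n x₀ y₀ T₀ z) := by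
  set L := actionAngleDeriv D.n x₀ y₀ T₀ z with hL
  have hd := href.hasFDerivAt_actionAngle hz
  have hθ : HasDerivAt (fun θ => actionAngle D.n x₀ y₀ T₀ (z.1, θ)) (L (0, 1)) z.2 :=
    HasFDerivAt.comp_hasDerivAt (f := fun θ => (z.1, θ)) z.2 hd
      ((hasDerivAt_const z.2 z.1).prodMk (hasDerivAt_id z.2))
  have hl : HasDerivAt (fun l => actionAngle D.n x₀ y₀ T₀ (l, z.2)) (L (1, 0)) z.1 :=
    HasFDerivAt.comp_hasDerivAt (f := fun l => (l, z.2)) z.1 hd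
      ((hasDerivAt_id z.1).prodMk (hasDerivAt_const z.1 z.2))
  have hdet := href.det_actionAngleDeriv hz
  rw [← hL, det_prod_eq] at hdet
  have e1 : deriv (fun θ => D.actionHam x₀ y₀ T₀ z.1 θ t) z.2 = _ :=
    (D.hasDerivAt_planeHam hθ.fst hθ.snd (hasDerivAt_const z.2 t)).deriv
  have e2 : deriv (fun l => D.actionHam x₀ y₀ T₀ l z.2 t) z.1 = _ :=
    (D.hasDerivAt_planeHam hl.fst hl.snd (hasDerivAt_const z.1 t)).deriv
  simp only [mul_zero, zero_mul, zero_div, Finset.sum_const_zero, add_zero] at e1 e2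
  rw [continuousLinearMap_prod_apply, hamField, e1, e2]
  simp only [ImpulsiveDuffing.field]
  generalize D.force t (actionAngle D.n x₀ y₀ T₀ z).1 = g
  generalize (actionAngle D.n x₀ y₀ T₀ z).2 = y
  ext
  · simp only [Prod.fst_add, Prod.smul_fst, smul_eq_mul]
    linear_combination (-y) * hdet
  · simp only [Prod.snd_add, Prod.smul_snd, smul_eq_mul]
    linear_combination g * hdet

variable {u v : ℝ → ℝ → ℝ → ℝ} {h₁ : ℝ → ℝ → ℝ}
  {h₂ : ℝ → ℝ → ℝ → ℝ} {μs ε₁ : ℝ}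

/-- Solutions of the normal form are mapped to solutions of the Duffing equation. -/
theorem isIntegralCurveOn_planeMap (href : IsReferenceSolution D.n x₀ y₀ T₀)
    (hψ : IsNormalForm D x₀ y₀ T₀ u v h₁ h₂ μs ε₁) {γ : ℝ → ℝ × ℝ} {I : Set ℝ}
    (hγ : ∀ τ ∈ I, μs < (γ τ).1 ∧
      HasDerivWithinAt γ (hamField (normalHam D.n T₀ h₁ h₂) τ (γ τ)) I τ) :
    IsIntegralCurveOn (fun τ => planeMap D.n x₀ y₀ T₀ u v τ (γ τ)) D.field I := by
  intro τ hτ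
  obtain ⟨hμ, hd⟩ := hγ τ hτ
  have h1 : HasDerivWithinAt (fun τ => ((γ τ).1, (γ τ).2, τ))
      ((hamField (normalHam D.n T₀ h₁ h₂) τ (γ τ)).1,
        (hamField (normalHam D.n T₀ h₁ h₂) τ (γ τ)).2, 1) I τ :=
    hd.fst.prodMk (hd.snd.prodMk (hasDerivWithinAt_id τ I))
  have h2 := ((hψ.contDiffAt_nearId (q := ((γ τ).1, (γ τ).2, τ)) hμ).differentiableAt
    (by simp)).hasFDerivAt
  have h3 := HasFDerivAt.comp_hasDerivWithinAt (f := fun τ => ((γ τ).1, (γ τ).2, τ)) τ h2 h1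
  rw [hψ.conj τ (γ τ) hμ] at h3
  have hpos := hψ.action_pos τ (γ τ) hμ
  have h4 := HasFDerivAt.comp_hasDerivWithinAt (f := fun τ => nearId u v τ (γ τ)) τ
    (href.hasFDerivAt_actionAngle hpos) h3
  rw [actionAngleDeriv_hamField href τ hpos] at h4
  exact h4

/-- The flow map of the normal form is a restriction of the flow of the Duffing equation. -/
theorem exists_isChartOf_flowRel (href : IsReferenceSolution D.n x₀ y₀ T₀)
    (hψ : IsNormalForm D x₀ y₀ T₀ u v h₁ h₂ μs ε₁) {s t : ℝ} (hst : s ≤ t) :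
    ∃ Φ : (ℝ × ℝ) ≃ₜ (ℝ × ℝ), IsLocallyUnimodular Φ ∧
      IsChartOf D x₀ y₀ T₀ u v μs s t (flowRel (normalHam D.n T₀ h₁ h₂) μs s t) Φ := by
  obtain ⟨Φ, hΦ, hd⟩ := (D.isTame_field s t).exists_flow hst
  refine ⟨Φ, ⟨fun p => ?_, fun p => ⟨univ, univ_mem, Φ.injective.injOn⟩⟩, ?_⟩
  · obtain ⟨L, hL, hdet⟩ := hd p
    exact ⟨L, hL, by rw [hdet, abs_one]⟩
  · rintro z w ⟨γ, hγ, rfl, rfl⟩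
    have hs := (hγ s (left_mem_Icc.2 hst)).1
    have ht := (hγ t (right_mem_Icc.2 hst)).1
    refine ⟨hs, ht, ?_⟩
    rw [chart_proj href hψ s hs, chart_proj href hψ t ht]
    exact hΦ _ (isIntegralCurveOn_planeMap href hψ hγ)

theorem isChartOf_jumpRel (href : IsReferenceSolution D.n x₀ y₀ T₀)
    (hψ : IsNormalForm D x₀ y₀ T₀ u v h₁ h₂ μs ε₁) (j : ℕ) :
    IsChartOf D x₀ y₀ T₀ u v μs (D.t j) (D.t j) (jumpRel D x₀ y₀ T₀ u v μs j) (D.jump j) := by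
  rintro z w ⟨ζ, η, hζ, hη, rfl, rfl, h⟩
  refine ⟨hζ, hη, ?_⟩
  rw [chart_proj href hψ _ hζ, chart_proj href hψ _ hη]
  exact h

theorem contDiff_jump (hjump : D.JumpCondition) {j : ℕ} (h1 : 1 ≤ j) (hj : j ≤ D.k) :
    ContDiff ℝ 1 (D.jump j) :=
  (contDiff_fst.add (hjump j h1 hj).1).prodMk (contDiff_snd.add (hjump j h1 hj).2.1)

theorem det_fderiv_jump (hjump : D.JumpCondition) {j : ℕ} (h1 : 1 ≤ j) (hj : j ≤ D.k) (p : ℝ × ℝ) :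
    (fderiv ℝ (D.jump j) p).det = 1 := by
  obtain ⟨hI, hJ, hc⟩ := hjump j h1 hj
  have dI := (hI.differentiable one_ne_zero p).hasFDerivAt
  have dJ := (hJ.differentiable one_ne_zero p).hasFDerivAt
  have hx : HasDerivAt (fun s => (s, p.2)) ((1 : ℝ), (0 : ℝ)) p.1 :=
    (hasDerivAt_id p.1).prodMk (hasDerivAt_const p.1 p.2)
  have hy : HasDerivAt (fun s => (p.1, s)) ((0 : ℝ), (1 : ℝ)) p.2 :=
    (hasDerivAt_const p.2 p.1).prodMk (hasDerivAt_id p.2)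
  have e := hc p.1 p.2
  have eIx : deriv (fun s => D.I j (s, p.2)) p.1 = fderiv ℝ (D.I j) p (1, 0) :=
    (dI.comp_hasDerivAt p.1 hx).deriv
  have eIy : deriv (fun s => D.I j (p.1, s)) p.2 = fderiv ℝ (D.I j) p (0, 1) :=
    (dI.comp_hasDerivAt p.2 hy).deriv
  have eJx : deriv (fun s => D.J j (s, p.2)) p.1 = fderiv ℝ (D.J j) p (1, 0) :=
    (dJ.comp_hasDerivAt p.1 hx).deriv
  have eJy : deriv (fun s => D.J j (p.1, s)) p.2 = fderiv ℝ (D.J j) p (0, 1) :=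
    (dJ.comp_hasDerivAt p.2 hy).deriv
  rw [eIx, eIy, eJx, eJy] at e
  have hd : fderiv ℝ (D.jump j) p = _ :=
    ((hasFDerivAt_fst.add dI).prodMk (hasFDerivAt_snd.add dJ)).fderiv
  rw [hd, det_prod_eq]
  simp only [ContinuousLinearMap.prod_apply, _root_.add_apply, ContinuousLinearMap.coe_fst',
    ContinuousLinearMap.coe_snd']
  linear_combination e

theorem isLocallyUnimodular_jump (hjump : D.JumpCondition) {j : ℕ} (h1 : 1 ≤ j) (hj : j ≤ D.k) :
    IsLocallyUnimodular (D.jump j) :=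
  isLocallyUnimodular_of_contDiff (contDiff_jump hjump h1 hj) (det_fderiv_jump hjump h1 hj)

/-- A jump map that tends to infinity at infinity is a homeomorphism of the plane. -/
theorem exists_homeomorph_jump (hjump : D.JumpCondition) {j : ℕ} (h1 : 1 ≤ j) (hj : j ≤ D.k)
    (hp : Tendsto (D.jump j) (cocompact (ℝ × ℝ)) (cocompact (ℝ × ℝ))) :
    ∃ Φ : (ℝ × ℝ) ≃ₜ (ℝ × ℝ), ⇑Φ = D.jump j := by
  have hloc : IsLocalHomeomorph (D.jump j) := fun p => by
    obtain ⟨e, he, heq⟩ := exists_openPartialHomeomorph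
      ((contDiff_jump hjump h1 hj).contDiffAt.hasStrictFDerivAt (x := p) one_ne_zero)
      (by rw [det_fderiv_jump hjump h1 hj]; exact one_ne_zero)
    exact ⟨e, he, heq.symm⟩
  have hbij := bijective_of_tendsto_cocompact hloc hp
  exact ⟨(Equiv.ofBijective _ hbij).toHomeomorphOfContinuousOpen hloc.continuous hloc.isOpenMap, rfl⟩

end conjugation

/-! ### The time 1 map in the plane -/

namespace ImpulsiveDuffing

theorem tStart_zero (D : ImpulsiveDuffing) : D.tStart 0 = 0 := if_pos rfl

theorem tEnd_k (D : ImpulsiveDuffing) : D.tEnd D.k = 1 := if_pos rfl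

theorem tStart_succ (D : ImpulsiveDuffing) (j : ℕ) : D.tStart (j + 1) = D.t (j + 1) :=
  if_neg (Nat.succ_ne_zero j)

theorem tEnd_of_lt (D : ImpulsiveDuffing) {j : ℕ} (hj : j < D.k) : D.tEnd j = D.t (j + 1) :=
  if_neg hj.ne

theorem tStart_le_tEnd (D : ImpulsiveDuffing) {j : ℕ} (hj : j ≤ D.k) : D.tStart j ≤ D.tEnd j := by
  rcases hj.eq_or_lt with rfl | hlt
  · rw [tEnd_k]
    rcases Nat.eq_zero_or_pos D.k with h0 | h0
    · rw [h0, tStart_zero]; exact zero_le_one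
    · rw [tStart, if_neg h0.ne']
      exact (D.t_mem _ h0 le_rfl).2.le
  · rw [tEnd_of_lt D hlt]
    rcases Nat.eq_zero_or_pos j with rfl | h0
    · rw [tStart_zero]; exact (D.t_mem _ le_rfl hlt).1
    · rw [tStart, if_neg h0.ne']
      exact (D.t_lt _ _ h0 (Nat.lt_succ_self j) hlt).le

end ImpulsiveDuffing

/-- The composition `Φ_m ∘ jump_m ∘ ⋯ ∘ jump_1 ∘ Φ_0` of flow maps and jumps. -/
def composedMap (D : ImpulsiveDuffing) (Φ : ℕ → ℝ × ℝ → ℝ × ℝ) : ℕ → ℝ × ℝ → ℝ × ℝ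
  | 0 => Φ 0
  | m + 1 => Φ (m + 1) ∘ D.jump (m + 1) ∘ composedMap D Φ m

section composed

variable {D : ImpulsiveDuffing} {x₀ y₀ : ℝ → ℝ} {T₀ : ℝ} {u v : ℝ → ℝ → ℝ → ℝ} {h₁ : ℝ → ℝ → ℝ}
  {h₂ : ℝ → ℝ → ℝ → ℝ} {μs ε₁ : ℝ} {Φ : ℕ → ℝ × ℝ → ℝ × ℝ}

theorem isLocallyUnimodular_composedMap (hjump : D.JumpCondition)
    (hΦ : ∀ j ≤ D.k, IsLocallyUnimodular (Φ j)) {m : ℕ} (hm : m ≤ D.k) :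
    IsLocallyUnimodular (composedMap D Φ m) := by
  induction m with
  | zero => exact hΦ 0 hm
  | succ m ih => exact (hΦ _ hm).comp ((isLocallyUnimodular_jump hjump (Nat.succ_pos m) hm).comp
      (ih (Nat.le_of_succ_le hm)))

theorem exists_homeomorph_composedMap {Φ : ℕ → (ℝ × ℝ) ≃ₜ (ℝ × ℝ)}
    (hJ : ∀ j, 1 ≤ j → j ≤ D.k → ∃ J : (ℝ × ℝ) ≃ₜ (ℝ × ℝ), ⇑J = D.jump j) {m : ℕ} (hm : m ≤ D.k) :
    ∃ G : (ℝ × ℝ) ≃ₜ (ℝ × ℝ), ⇑G = composedMap D (fun j => Φ j) m := by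
  induction m with
  | zero => exact ⟨Φ 0, rfl⟩
  | succ m ih =>
    obtain ⟨G, hG⟩ := ih (Nat.le_of_succ_le hm)
    obtain ⟨J, hJ⟩ := hJ (m + 1) (Nat.succ_pos m) hm
    refine ⟨(G.trans J).trans (Φ (m + 1)), ?_⟩
    rw [composedMap, ← hG, ← hJ]
    rfl

/-- The time 1 map is a restriction of the composition of the plane flow maps and plane jumps. -/
theorem isChartOf_timeOneRel (href : IsReferenceSolution D.n x₀ y₀ T₀)
    (hψ : IsNormalForm D x₀ y₀ T₀ u v h₁ h₂ μs ε₁)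
    (hΦ : ∀ j ≤ D.k, IsChartOf D x₀ y₀ T₀ u v μs (D.tStart j) (D.tEnd j)
      (flowRel (normalHam D.n T₀ h₁ h₂) μs (D.tStart j) (D.tEnd j)) (Φ j)) :
    IsChartOf D x₀ y₀ T₀ u v μs 0 0 (timeOneRel D x₀ y₀ T₀ u v h₁ h₂ μs)
      (composedMap D Φ D.k) := by
  rintro z w ⟨a, b, rfl, rfl, hflow, hjmp⟩
  have key : ∀ m ≤ D.k, chart D.n x₀ y₀ T₀ u v (D.tEnd m) (b m) =
      composedMap D Φ m (chart D.n x₀ y₀ T₀ u v 0 (a 0)) := by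
    intro m
    induction m with
    | zero =>
      intro hm
      have := (hΦ 0 hm _ _ (hflow 0 hm)).2.2
      rwa [D.tStart_zero] at this
    | succ m ih =>
      intro hm
      have h1 := (hΦ _ hm _ _ (hflow _ hm)).2.2
      have h2 := (isChartOf_jumpRel href hψ _ _ _ (hjmp m hm)).2.2
      have h3 := ih (Nat.le_of_succ_le hm)
      rw [D.tEnd_of_lt hm] at h3
      rw [h1, D.tStart_succ, h2, h3]
      rfl
  have hb := (hΦ _ le_rfl _ _ (hflow _ le_rfl)).2.1
  refine ⟨(hΦ 0 (Nat.zero_le _) _ _ (hflow 0 (Nat.zero_le _))).1, hb, ?_⟩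
  rw [← chart_one hψ hb, ← key D.k le_rfl, D.tEnd_k]

end composed

/-! ### Large actions -/

/-- The half space `{μ > μs}` of triples `(μ, φ, t)`. -/
def upperSpace (μs : ℝ) : Set (ℝ × ℝ × ℝ) := {q | μs < q.1}

theorem isOpen_upperSpace (μs : ℝ) : IsOpen (upperSpace μs) :=
  isOpen_lt continuous_const continuous_fst

/-- The function is 1-periodic in the angle for actions above `μs`. -/
def AnglePeriodicOn {E : Type*} (μs : ℝ) (f : ℝ × ℝ × ℝ → E) : Prop :=
  ∀ q ∈ upperSpace μs, f (q + (0, 1, 0)) = f q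

theorem AnglePeriodicOn.fderiv {E : Type*} [NormedAddCommGroup E] [NormedSpace ℝ E] {μs : ℝ}
    {f : ℝ × ℝ × ℝ → E} (hf : AnglePeriodicOn μs f) : AnglePeriodicOn μs (fderiv ℝ f) := by
  intro q hq
  rw [← fderiv_comp_add_right]
  refine Filter.EventuallyEq.fderiv_eq ?_
  filter_upwards [(isOpen_upperSpace μs).mem_nhds hq] with p hp using hf p hp

/-- A continuous function that is periodic in the angle is bounded on the strips `A ≤ μ ≤ B`,
`0 ≤ t ≤ 1`. -/
theorem AnglePeriodicOn.exists_bound {E : Type*} [NormedAddCommGroup E] {μs : ℝ}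
    {f : ℝ × ℝ × ℝ → E} (hf : AnglePeriodicOn μs f) (hc : ContinuousOn f (upperSpace μs))
    {A : ℝ} (hA : μs < A) (B : ℝ) :
    ∃ C, ∀ m φ t, m ∈ Icc A B → t ∈ Icc (0 : ℝ) 1 → ‖f (m, φ, t)‖ ≤ C := by
  have hsub : Icc A B ×ˢ Icc (0 : ℝ) 1 ×ˢ Icc (0 : ℝ) 1 ⊆ upperSpace μs :=
    fun q hq => hA.trans_le hq.1.1
  obtain ⟨C, hC⟩ := (isCompact_Icc.prod (isCompact_Icc.prod isCompact_Icc)).exists_bound_of_continuousOn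
    (hc.mono hsub)
  refine ⟨C, fun m φ t hm ht => ?_⟩
  have hp : Function.Periodic (fun φ => f (m, φ, t)) 1 := fun φ => by
    have h := hf (m, φ, t) (hA.trans_le hm.1)
    have e : (m, φ, t) + ((0 : ℝ), (1 : ℝ), (0 : ℝ)) = (m, φ + 1, t) := by ext <;> simp
    rwa [e] at h
  have h1 := hp.sub_zsmul_eq (x := φ) ⌊φ⌋
  rw [zsmul_eq_mul, mul_one] at h1
  have h2 := hC (m, Int.fract φ, t) ⟨hm, ⟨Int.fract_nonneg _, (Int.fract_lt_one _).le⟩, ht⟩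
  rw [← h1]
  exact h2

section largeAction

variable {D : ImpulsiveDuffing} {x₀ y₀ : ℝ → ℝ} {T₀ : ℝ} {u v : ℝ → ℝ → ℝ → ℝ} {h₁ : ℝ → ℝ → ℝ}
  {h₂ : ℝ → ℝ → ℝ → ℝ} {μs ε₁ : ℝ}

theorem contDiffOn_normalHam (hψ : IsNormalForm D x₀ y₀ T₀ u v h₁ h₂ μs ε₁) :
    ContDiffOn ℝ ∞ (fun q : ℝ × ℝ × ℝ => normalHam D.n T₀ h₁ h₂ q.1 q.2.1 q.2.2)
      (upperSpace μs) := by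
  have hp : ContDiffOn ℝ ∞ (fun q : ℝ × ℝ × ℝ => q.1 ^ (2 * expβ D.n)) (upperSpace μs) :=
    contDiffOn_fst.rpow_const_of_ne fun q hq => (hψ.nonneg.trans_lt hq).ne'
  exact ((contDiffOn_const.mul hp).add hψ.h₁_mem.1).add hψ.h₂_mem.1

/-- The field of the normal form, as a function of `(μ, φ, t)`, in terms of the total derivative of
the Hamiltonian. -/
def normalField (n : ℕ) (T₀ : ℝ) (h₁ : ℝ → ℝ → ℝ) (h₂ : ℝ → ℝ → ℝ → ℝ) (q : ℝ × ℝ × ℝ) : ℝ × ℝ :=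
  (-fderiv ℝ (fun q : ℝ × ℝ × ℝ => normalHam n T₀ h₁ h₂ q.1 q.2.1 q.2.2) q (0, 1, 0),
    fderiv ℝ (fun q : ℝ × ℝ × ℝ => normalHam n T₀ h₁ h₂ q.1 q.2.1 q.2.2) q (1, 0, 0))

theorem hamField_eq_normalField (hψ : IsNormalForm D x₀ y₀ T₀ u v h₁ h₂ μs ε₁) (t : ℝ) {z : ℝ × ℝ}
    (hz : μs < z.1) : hamField (normalHam D.n T₀ h₁ h₂) t z =
      normalField D.n T₀ h₁ h₂ (z.1, z.2, t) := by
  have hd := ((contDiffOn_normalHam hψ).contDiffAt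
    ((isOpen_upperSpace μs).mem_nhds (show (z.1, z.2, t) ∈ upperSpace μs from hz))).differentiableAt
      (by simp) |>.hasFDerivAt
  have h1 := (HasFDerivAt.comp_hasDerivAt (f := fun φ => (z.1, φ, t)) z.2 hd
    ((hasDerivAt_const z.2 z.1).prodMk ((hasDerivAt_id z.2).prodMk (hasDerivAt_const z.2 t)))).deriv
  have h2 := (HasFDerivAt.comp_hasDerivAt (f := fun m => (m, z.2, t)) z.1 hd
    ((hasDerivAt_id z.1).prodMk ((hasDerivAt_const z.1 z.2).prodMk (hasDerivAt_const z.1 t)))).deriv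
  exact Prod.ext (congrArg Neg.neg h1) h2

theorem contDiffOn_normalField (hψ : IsNormalForm D x₀ y₀ T₀ u v h₁ h₂ μs ε₁) :
    ContDiffOn ℝ 1 (normalField D.n T₀ h₁ h₂) (upperSpace μs) := by
  have h := (contDiffOn_normalHam hψ).fderiv_of_isOpen (m := 1) (isOpen_upperSpace μs)
    (by norm_cast)
  exact (h.clm_apply contDiffOn_const).neg.prodMk (h.clm_apply contDiffOn_const)

theorem anglePeriodicOn_normalField (hψ : IsNormalForm D x₀ y₀ T₀ u v h₁ h₂ μs ε₁) :
    AnglePeriodicOn μs (normalField D.n T₀ h₁ h₂) := by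
  have h : AnglePeriodicOn μs
      (fun q : ℝ × ℝ × ℝ => normalHam D.n T₀ h₁ h₂ q.1 q.2.1 q.2.2) := fun q hq => by
    have := (hψ.h₂_mem.2.1 q.1 q.2.1 q.2.2 hq).1
    simp only [Prod.fst_add, Prod.snd_add, add_zero, normalHam, this]
  intro q hq
  simp only [normalField, h.fderiv q hq]

/-- The action changes at a bounded rate under the normal form: `∂h₂/∂φ` is bounded. -/
theorem exists_bound_actionField (hψ : IsNormalForm D x₀ y₀ T₀ u v h₁ h₂ μs ε₁) :
    ∃ L C : ℝ, μs ≤ L ∧ 0 ≤ C ∧ ∀ t z, L < z.1 →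
      |(hamField (normalHam D.n T₀ h₁ h₂) t z).1| ≤ C := by
  obtain ⟨L, C, hL, hμL, hC⟩ := hψ.h₂_mem.2.2 0 1 0
  have hε : 0 < ε₁ := by
    refine lt_trans ?_ hψ.lt_ε₁
    have : expβ D.n < 1 := by have := expα_pos D.n; unfold expβ; linarith
    linarith
  have hb : ∀ t, ∀ z : ℝ × ℝ, max L 1 < z.1 → |(hamField (normalHam D.n T₀ h₁ h₂) t z).1| ≤ C := by
    intro t z hz
    have h1 := hC z.1 z.2 t ((le_max_left _ _).trans_lt hz)
    simp only [iteratedDeriv_zero, iteratedDeriv_one, Nat.cast_zero, zero_sub, neg_neg] at h1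
    have h2 : 1 ≤ z.1 ^ ε₁ := Real.one_le_rpow ((le_max_right _ _).trans hz.le) hε.le
    have h3 : (hamField (normalHam D.n T₀ h₁ h₂) t z).1 = -deriv (fun φ => h₂ z.1 φ t) z.2 := by
      simp only [hamField, normalHam]
      rw [deriv_const_add]
    rw [h3, abs_neg]
    have h4 := abs_nonneg (deriv (fun φ => h₂ z.1 φ t) z.2)
    nlinarith
  exact ⟨max L 1, C, hμL.trans (le_max_left _ _),
    (abs_nonneg _).trans (hb 0 (max L 1 + 1, 0) (lt_add_one _)), hb⟩

/-- The truncation of the action to `[A, B]`. -/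
def clampAction (A B : ℝ) (z : ℝ × ℝ) : ℝ × ℝ := (max A (min z.1 B), z.2)

theorem lipschitzWith_clampAction (A B : ℝ) : LipschitzWith 1 (clampAction A B) := by
  have h := (((LipschitzWith.prod_fst (α := ℝ) (β := ℝ)).min_const B).const_max A).prodMk
    (LipschitzWith.prod_snd (α := ℝ) (β := ℝ))
  rw [max_self] at h
  exact h

/-- For large actions the flow of the normal form exists over any part of a period, and changes the
action by at most a constant. -/
theorem exists_flowRel (hψ : IsNormalForm D x₀ y₀ T₀ u v h₁ h₂ μs ε₁) :
    ∃ M C : ℝ, ∀ s t, 0 ≤ s → s ≤ t → t ≤ 1 → ∀ z : Cyl, M ≤ z.1 →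
      ∃ w, flowRel (normalHam D.n T₀ h₁ h₂) μs s t z w ∧ z.1 - C ≤ w.1 := by
  obtain ⟨L, C, hL, hC0, hC⟩ := exists_bound_actionField hψ
  refine ⟨L + C + 1, C, fun s t hs hst ht z hz => ?_⟩
  -- the solution is found for the field truncated to the actions in `[A, B]`, which the bound on the
  -- rate of change of the action keeps it from leaving within one period
  set A := z.1 - C with hA
  set B := z.1 + C with hB
  have hLA : L < A := by linarith
  have hAμ : μs < A := hL.trans_lt hLA
  have hAB : A ≤ B := by linarith
  have hF := contDiffOn_normalField (T₀ := T₀) hψ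
  have hFp := anglePeriodicOn_normalField (T₀ := T₀) hψ
  obtain ⟨K, hK⟩ := hFp.fderiv.exists_bound
    (hF.continuousOn_fderiv_of_isOpen (isOpen_upperSpace μs) le_rfl) hAμ B
  obtain ⟨N, hN⟩ := hFp.exists_bound hF.continuousOn hAμ B
  have hcl : ∀ z, (clampAction A B z).1 ∈ Icc A B := fun z =>
    ⟨le_max_left _ _, max_le hAB (min_le_right _ _)⟩
  have htI : ∀ τ ∈ Icc s t, τ ∈ Icc (0 : ℝ) 1 := fun τ hτ => ⟨hs.trans hτ.1, hτ.2.trans ht⟩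
  have hlip : LipschitzOnWith K.toNNReal (normalField D.n T₀ h₁ h₂)
      (Icc A B ×ˢ univ ×ˢ Icc (0 : ℝ) 1) := by
    refine Convex.lipschitzOnWith_of_nnnorm_fderiv_le (𝕜 := ℝ) (fun q hq => ?_) (fun q hq => ?_)
      ((convex_Icc _ _).prod (convex_univ.prod (convex_Icc _ _)))
    · exact (hF.contDiffAt ((isOpen_upperSpace μs).mem_nhds (hAμ.trans_le hq.1.1))).differentiableAt
        one_ne_zero
    · exact NNReal.coe_le_coe.1 ((hK q.1 q.2.1 q.2.2 hq.1 hq.2.2).trans (Real.le_coe_toNNReal K))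
  obtain ⟨γ, hγs, hγ⟩ := exists_isIntegralCurveOn_of_bounded
    (F := fun τ z => normalField D.n T₀ h₁ h₂ ((clampAction A B z).1, (clampAction A B z).2, τ))
    hst (K := K.toNNReal * 1) (L := N) (fun τ hτ => by
      have hι : LipschitzWith 1 fun z : ℝ × ℝ => (z.1, z.2, τ) :=
        LipschitzWith.of_dist_le_mul fun a b => by
          simp [Prod.dist_eq]
      have hι' := hι.comp (lipschitzWith_clampAction A B)
      rw [one_mul] at hι'
      rw [← lipschitzOnWith_univ]
      exact hlip.comp hι'.lipschitzOnWith fun z _ => ⟨hcl z, mem_univ _, htI τ hτ⟩)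
    (fun z => hF.continuousOn.comp (by fun_prop) fun τ _ => hAμ.trans_le (hcl z).1)
    (fun τ hτ z => hN _ _ _ (hcl z) (htI τ hτ)) (lift z)
  have hbd : ∀ τ ∈ Icc s t, |(γ τ).1 - z.1| ≤ C := by
    intro τ hτ
    have h := norm_image_sub_le_of_norm_deriv_le_segment' (f := fun τ => (γ τ).1) (C := C)
      (fun τ hτ => (hγ τ hτ).fst) (fun τ hτ => by
        have hq := hcl (γ τ)
        have := hamField_eq_normalField (T₀ := T₀) hψ τ (z := clampAction A B (γ τ))
          (hAμ.trans_le hq.1)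
        simp only [← this]
        exact hC τ _ (hLA.trans_le hq.1)) τ hτ
    rw [hγs] at h
    refine h.trans ?_
    have : τ - s ≤ 1 := by linarith [hτ.2]
    nlinarith
  have hin : ∀ τ ∈ Icc s t, (γ τ).1 ∈ Icc A B := fun τ hτ => by
    have := abs_le.1 (hbd τ hτ)
    exact ⟨by linarith, by linarith⟩
  refine ⟨proj (γ t), ⟨γ, fun τ hτ => ?_, by rw [hγs, proj_lift], rfl⟩,
    (hin t (right_mem_Icc.2 hst)).1⟩
  have hμ : μs < (γ τ).1 := hAμ.trans_le (hin τ hτ).1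
  refine ⟨hμ, ?_⟩
  rw [hamField_eq_normalField hψ τ hμ]
  have h := hγ τ hτ
  have hcl : clampAction A B (γ τ) = γ τ := by
    have := hin τ hτ
    ext <;> simp [clampAction, this.1, this.2]
  simp only [hcl] at h
  exact h

/-- The transformation `ψ_t` at most halves large actions, as `u` is of lower order. -/
theorem exists_le_nearId (hψ : IsNormalForm D x₀ y₀ T₀ u v h₁ h₂ μs ε₁) :
    ∃ N, μs < N ∧ 0 < N ∧ ∀ t z, N ≤ z.1 → z.1 / 2 ≤ (nearId u v t z).1 := by
  obtain ⟨L, C, hL, hμL, hC⟩ := hψ.u_mem.2.2 0 0 0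
  have hα := expα_pos D.n
  have hlim : Tendsto (fun l : ℝ => C * l ^ (-expα D.n)) atTop (𝓝 0) := by
    simpa using (tendsto_rpow_neg_atTop hα).const_mul C
  obtain ⟨N, hN⟩ := (hlim.eventually (ge_mem_nhds (by norm_num : (0 : ℝ) < 1 / 2))).exists_forall_of_atTop
  refine ⟨max N (L + 1), by linarith [le_max_right N (L + 1)], by linarith [le_max_right N (L + 1)],
    fun t z hz => ?_⟩
  have hzL : L < z.1 := by linarith [le_max_right N (L + 1)]
  have hz0 : 0 < z.1 := hL.trans hzL
  have h1 := hC z.1 z.2 t hzL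
  simp only [iteratedDeriv_zero, Nat.cast_zero, zero_sub, neg_sub] at h1
  have h2 := hN z.1 ((le_max_left _ _).trans hz)
  have h3 : |u z.1 z.2 t| ≤ z.1 / 2 := by
    have e : z.1 ^ (-expα D.n) * z.1 * z.1 ^ (expα D.n - 1) = 1 := by
      nth_rw 2 [← Real.rpow_one z.1]
      rw [← Real.rpow_add hz0, ← Real.rpow_add hz0]
      ring_nf
      exact Real.rpow_zero _
    have hp1 : 0 < z.1 ^ (-expα D.n) := by positivity
    calc |u z.1 z.2 t|
        = z.1 ^ (-expα D.n) * z.1 * (z.1 ^ (expα D.n - 1) * |u z.1 z.2 t|) := by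
          rw [← mul_assoc, e, one_mul]
      _ ≤ z.1 ^ (-expα D.n) * z.1 * C := by gcongr
      _ = C * z.1 ^ (-expα D.n) * z.1 := by ring
      _ ≤ 1 / 2 * z.1 := by gcongr
      _ = z.1 / 2 := by ring
  have := neg_le_of_abs_le h3
  simp only [nearId]
  linarith

/-- The maps `φ₀ ∘ ψ_t` cover a neighbourhood of infinity, the points of large action being the images
of points of large action. -/
theorem exists_planeMap_eq (href : IsReferenceSolution D.n x₀ y₀ T₀)
    (hψ : IsNormalForm D x₀ y₀ T₀ u v h₁ h₂ μs ε₁) (N : ℝ) : ∃ Λ, ∀ t ∈ Icc (0 : ℝ) 1,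
      ∀ w, w ≠ 0 → Λ ≤ actionOf D.n T₀ w →
        ∃ η : ℝ × ℝ, μs < η.1 ∧ N ≤ η.1 ∧ planeMap D.n x₀ y₀ T₀ u v t η = w := by
  obtain ⟨μm, μ₁, μp, -, -, -, hμ₁, hann⟩ := hψ.annuli
  have hup : AnglePeriodicOn μs (fun q : ℝ × ℝ × ℝ => u q.1 q.2.1 q.2.2) := fun q hq => by
    simpa using (hψ.u_mem.2.1 q.1 q.2.1 q.2.2 hq).1
  obtain ⟨C, hC⟩ := hup.exists_bound hψ.u_mem.1.continuousOn hμ₁ N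
  refine ⟨max μp (N + C + 1), fun t ht w hw hΛ => ?_⟩
  obtain ⟨ξ, hξ, rfl⟩ := href.exists_actionAngle_eq hw
  rw [href.actionOf_actionAngle hξ] at hΛ
  obtain ⟨η, hη, rfl⟩ := (hann t).1 (show μp ≤ ξ.1 from (le_max_left _ _).trans hΛ)
  have hη' : μ₁ ≤ η.1 := hη
  refine ⟨η, hμ₁.trans_le hη', ?_, rfl⟩
  by_contra hcon
  rw [not_le] at hcon
  have h1 := hC η.1 η.2 t ⟨hη', hcon.le⟩ ht
  have h2 := (abs_le.1 h1).2
  have h3 := (le_max_right _ _).trans hΛ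
  simp only [nearId] at h3
  linarith

/-- The jumps keep large actions large. -/
theorem exists_jumpRel (href : IsReferenceSolution D.n x₀ y₀ T₀)
    (hψ : IsNormalForm D x₀ y₀ T₀ u v h₁ h₂ μs ε₁) {j : ℕ} (h1 : 1 ≤ j) (hj : j ≤ D.k)
    (hp : Tendsto (D.jump j) (cocompact (ℝ × ℝ)) (cocompact (ℝ × ℝ))) (N : ℝ) :
    ∃ N', ∀ z : Cyl, N' ≤ z.1 → ∃ w, jumpRel D x₀ y₀ T₀ u v μs j z w ∧ N ≤ w.1 := by
  obtain ⟨Λ, hΛ⟩ := exists_planeMap_eq href hψ N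
  obtain ⟨M, hMμ, hM0, hM⟩ := exists_le_nearId hψ
  have hev : ∀ᶠ w in cocompact (ℝ × ℝ), D.jump j w ≠ 0 ∧ Λ ≤ actionOf D.n T₀ (D.jump j w) :=
    hp.eventually (Filter.Eventually.and
      (isCompact_singleton (x := (0 : ℝ × ℝ))).compl_mem_cocompact (href.tendsto_actionOf.eventually_ge_atTop Λ))
  obtain ⟨K, hK, hKs⟩ := mem_cocompact.1 hev
  obtain ⟨B, hB⟩ := hK.exists_bound_of_continuousOn
    (IsReferenceSolution.continuous_actionOf D.n T₀).continuousOn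
  refine ⟨max M (2 * B + 1), fun z hz => ?_⟩
  have hzM : M ≤ (lift z).1 := (le_max_left _ _).trans hz
  have hzB : 2 * B + 1 ≤ (lift z).1 := (le_max_right _ _).trans hz
  have hlow := hM (D.t j) (lift z) hzM
  have hpos : 0 < (nearId u v (D.t j) (lift z)).1 := by linarith
  have hnot : planeMap D.n x₀ y₀ T₀ u v (D.t j) (lift z) ∉ K := by
    intro hmem
    have := (le_abs_self _).trans (hB _ hmem)
    rw [planeMap, href.actionOf_actionAngle hpos] at this
    linarith
  obtain ⟨hne, hge⟩ := hKs hnot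
  obtain ⟨η, hη, hηN, hηw⟩ := hΛ (D.t j) (Ico_subset_Icc_self (D.t_mem j h1 hj)) _ hne hge
  exact ⟨proj η, ⟨lift z, η, hMμ.trans_le hzM, hη, proj_lift z, rfl, hηw⟩, hηN⟩

/-- Orbits of large action survive the first `m` impulses and keep a large action. -/
theorem exists_orbit (href : IsReferenceSolution D.n x₀ y₀ T₀)
    (hψ : IsNormalForm D x₀ y₀ T₀ u v h₁ h₂ μs ε₁)
    (hp : ∀ j, 1 ≤ j → j ≤ D.k → Tendsto (D.jump j) (cocompact (ℝ × ℝ)) (cocompact (ℝ × ℝ)))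
    {m : ℕ} (hm : m ≤ D.k) (N : ℝ) : ∃ N', ∀ z : Cyl, N' ≤ z.1 → ∃ a b : ℕ → Cyl, a 0 = z ∧
      (∀ j ≤ m, flowRel (normalHam D.n T₀ h₁ h₂) μs (D.tStart j) (D.tEnd j) (a j) (b j)) ∧
      (∀ j < m, jumpRel D x₀ y₀ T₀ u v μs (j + 1) (b j) (a (j + 1))) ∧ N ≤ (b m).1 := by
  obtain ⟨M, C, hMC⟩ := exists_flowRel (T₀ := T₀) hψ
  have htimes : ∀ j ≤ D.k, 0 ≤ D.tStart j ∧ D.tEnd j ≤ 1 := by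
    intro j hj
    constructor
    · rcases Nat.eq_zero_or_pos j with rfl | h0
      · rw [D.tStart_zero]
      · rw [ImpulsiveDuffing.tStart, if_neg h0.ne']
        exact (D.t_mem j h0 hj).1
    · rcases hj.eq_or_lt with rfl | hlt
      · rw [D.tEnd_k]
      · rw [D.tEnd_of_lt hlt]
        exact (D.t_mem _ (Nat.succ_pos j) hlt).2.le
  induction m generalizing N with
  | zero =>
    refine ⟨max M (N + C), fun z hz => ?_⟩
    obtain ⟨w, hw, hwN⟩ := hMC _ _ (htimes 0 hm).1 (D.tStart_le_tEnd hm) (htimes 0 hm).2 z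
      ((le_max_left _ _).trans hz)
    refine ⟨fun _ => z, fun _ => w, rfl, fun j hj => ?_, fun j hj => absurd hj (Nat.not_lt_zero j), ?_⟩
    · rw [Nat.le_zero.1 hj]; exact hw
    · linarith [(le_max_right _ _).trans hz]
  | succ m ih =>
    obtain ⟨N₁, hN₁⟩ := exists_jumpRel href hψ (Nat.succ_pos m) hm (hp _ (Nat.succ_pos m) hm)
      (max M (N + C))
    obtain ⟨N₂, hN₂⟩ := ih (Nat.le_of_succ_le hm) N₁
    refine ⟨N₂, fun z hz => ?_⟩
    obtain ⟨a, b, ha, hflow, hjmp, hb⟩ := hN₂ z hz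
    obtain ⟨z', hz', hz'M⟩ := hN₁ _ hb
    obtain ⟨w, hw, hwN⟩ := hMC _ _ (htimes _ hm).1 (D.tStart_le_tEnd hm) (htimes _ hm).2 z'
      ((le_max_left _ _).trans hz'M)
    have hane : ∀ j ≤ m, Function.update a (m + 1) z' j = a j := fun j hj =>
      Function.update_of_ne (by omega) _ _
    have hbne : ∀ j ≤ m, Function.update b (m + 1) w j = b j := fun j hj =>
      Function.update_of_ne (by omega) _ _
    refine ⟨Function.update a (m + 1) z', Function.update b (m + 1) w, ?_, fun j hj => ?_,
      fun j hj => ?_, ?_⟩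
    · rw [hane 0 (Nat.zero_le _), ha]
    · rcases hj.eq_or_lt with rfl | hlt
      · rw [Function.update_self, Function.update_self]; exact hw
      · rw [hane j (Nat.lt_succ_iff.1 hlt), hbne j (Nat.lt_succ_iff.1 hlt)]
        exact hflow j (Nat.lt_succ_iff.1 hlt)
    · rw [hbne j (Nat.lt_succ_iff.1 hj)]
      rcases (Nat.lt_succ_iff.1 hj).eq_or_lt with rfl | hlt
      · rw [Function.update_self]; exact hz'
      · rw [hane (j + 1) hlt]; exact hjmp j hlt
    · rw [Function.update_self]
      linarith [(le_max_right _ _).trans hz'M]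

end largeAction

/-! ### The intersection property -/

section intersection

variable {D : ImpulsiveDuffing} {x₀ y₀ : ℝ → ℝ} {T₀ : ℝ} {u v : ℝ → ℝ → ℝ → ℝ} {h₁ : ℝ → ℝ → ℝ}
  {h₂ : ℝ → ℝ → ℝ → ℝ} {μs ε₁ : ℝ}

/-- The circle `μ = m` winds around the origin of the plane. -/
theorem not_hasLog_chart_circle (href : IsReferenceSolution D.n x₀ y₀ T₀)
    (hψ : IsNormalForm D x₀ y₀ T₀ u v h₁ h₂ μs ε₁) (t : ℝ) {m : ℝ} (hm : μs < m) :
    ¬ HasLog fun s : UnitAddCircle => toComplex (chart D.n x₀ y₀ T₀ u v t (m, s)) := by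
  have hm0 : 0 < m := hψ.nonneg.trans_lt hm
  -- the straight homotopy between the identity and `ψ_t`, which keeps the action positive
  let Z : unitInterval × ℝ → ℝ × ℝ := fun q =>
    (1 - (q.1 : ℝ)) • (m, q.2) + (q.1 : ℝ) • nearId u v t (m, q.2)
  have hZpos : ∀ q, 0 < (Z q).1 := by
    intro q
    have h1 := hψ.action_pos t (m, q.2) hm
    have h0 := q.1.2
    simp only [Z, Prod.fst_add, Prod.smul_fst, smul_eq_mul]
    rcases h0.1.eq_or_lt with h | h
    · rw [← h]; simpa using hm0
    · exact add_pos_of_nonneg_of_pos (mul_nonneg (by linarith [h0.2]) hm0.le) (mul_pos h h1)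
  have hnear : Continuous fun q : unitInterval × ℝ => nearId u v t (m, q.2) :=
    continuous_iff_continuousAt.2 fun q =>
      ContinuousAt.comp (f := fun q : unitInterval × ℝ => (m, q.2))
        (hψ.contDiffAt_nearId_slice t (z := (m, q.2)) hm).continuousAt (by fun_prop)
  have hZ : Continuous Z := by fun_prop
  have hA : Continuous fun q => toComplex (actionAngle D.n x₀ y₀ T₀ (Z q)) :=
    continuous_toComplex.comp (continuous_iff_continuousAt.2 fun q =>
      ContinuousAt.comp (href.contDiffAt_actionAngle (hZpos q)).continuousAt hZ.continuousAt)
  have hper : ∀ (σ : unitInterval) (φ : ℝ) (k : ℤ), actionAngle D.n x₀ y₀ T₀ (Z (σ, φ + k)) =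
      actionAngle D.n x₀ y₀ T₀ (Z (σ, φ)) := by
    intro σ φ k
    have h1 : Z (σ, φ + k) = ((Z (σ, φ)).1, (Z (σ, φ)).2 + k) := by
      simp only [Z, hψ.nearId_add_int hm]
      ext
      · simp
      · simp; ring
    have h2 : Function.Periodic (fun θ => actionAngle D.n x₀ y₀ T₀ ((Z (σ, φ)).1, θ)) 1 :=
      fun θ => href.actionAngle_add_one _ θ
    have h3 := h2.zsmul k (Z (σ, φ)).2
    rw [zsmul_eq_mul, mul_one] at h3
    rw [h1, h3]
  -- the induced homotopy of maps on the circle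
  let H : unitInterval → UnitAddCircle → ℂ := fun σ s =>
    toComplex (actionAngle D.n x₀ y₀ T₀ (Z (σ, (lift (m, s)).2)))
  have hHcoe : ∀ (σ : unitInterval) (φ : ℝ),
      H σ φ = toComplex (actionAngle D.n x₀ y₀ T₀ (Z (σ, φ))) := by
    intro σ φ
    obtain ⟨-, k, hk⟩ := proj_eq_iff.1 (proj_lift (proj (m, φ)))
    simp only [H]
    rw [← hper σ φ k, ← hk]
    congr 4
    change _ = φ + ((lift (m, (φ : UnitAddCircle))).2 - φ)
    ring
  have hHc : Continuous (Function.uncurry H) := by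
    have hq : IsOpenQuotientMap (Prod.map id ((↑) : ℝ → UnitAddCircle) :
        unitInterval × ℝ → unitInterval × UnitAddCircle) :=
      IsOpenQuotientMap.id.prodMap QuotientAddGroup.isOpenQuotientMap_mk
    rw [hq.isQuotientMap.continuous_iff]
    convert hA using 1
    ext1 q
    exact hHcoe q.1 q.2
  have hiff := hasLog_iff_of_family isPreconnected_univ H hHc.continuousOn
    (fun σ _ s => by
      rw [Ne, toComplex_eq_zero]
      exact href.actionAngle_ne_zero (hZpos _))
    (mem_univ (1 : unitInterval)) (mem_univ (0 : unitInterval))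
  have h1 : H 1 = fun s : UnitAddCircle => toComplex (chart D.n x₀ y₀ T₀ u v t (m, s)) := by
    funext s
    simp only [H, Z, chart, planeMap, lift, Icc.coe_one, sub_self, zero_smul, zero_add,
      one_smul]
  rw [← h1, hiff]
  refine href.not_hasLog_actionAngle hm0 fun θ => ?_
  rw [hHcoe]
  simp [Z]

/-- Homotopic circles in an annulus have the same winding behaviour under a map into `ℂ ∖ {0}`. -/
theorem hasLog_iff_of_homotopic {μ₀ : ℝ} {c c' : C(UnitAddCircle, annulus μ₀)}
    (h : c.Homotopic c') {F : Cyl → ℂ} (hF : ContinuousOn F (annulus μ₀))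
    (h0 : ∀ z ∈ annulus μ₀, F z ≠ 0) :
    (HasLog fun s => F (c s)) ↔ HasLog fun s => F (c' s) := by
  obtain ⟨K⟩ := h
  have hiff := hasLog_iff_of_family isPreconnected_univ
    (fun (σ : unitInterval) (s : UnitAddCircle) => F (K (σ, s)))
    (hF.comp_continuous (continuous_subtype_val.comp K.continuous) fun q =>
      (K q).2).continuousOn (fun σ _ s => h0 _ (K (σ, s)).2)
    (mem_univ (0 : unitInterval)) (mem_univ (1 : unitInterval))
  simpa using hiff

theorem hasLog_iff_of_circles {μ₀ m M : ℝ} (hm : μ₀ ≤ m) (hM : μ₀ ≤ M) {F : Cyl → ℂ}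
    (hF : ContinuousOn F (annulus μ₀)) (h0 : ∀ z ∈ annulus μ₀, F z ≠ 0) :
    (HasLog fun s : UnitAddCircle => F (m, s)) ↔ HasLog fun s : UnitAddCircle => F (M, s) :=
  hasLog_iff_of_family isPreconnected_Ici (fun m s => F (m, s))
    (hF.mono fun _ hz => hz.1) (fun _ hσ _ => h0 _ hσ) hm hM

/-- The image of a circle `μ = M` of large action under a homeomorphism of the plane winds around the
origin: otherwise the circle would not wind around the preimage `q` of the origin, which it
encloses. -/
theorem exists_not_hasLog_homeomorph_chart (href : IsReferenceSolution D.n x₀ y₀ T₀)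
    (hψ : IsNormalForm D x₀ y₀ T₀ u v h₁ h₂ μs ε₁) (t : ℝ) (G : (ℝ × ℝ) ≃ₜ (ℝ × ℝ)) (μ₀ : ℝ) :
    ∃ M, μ₀ ≤ M ∧ ¬ HasLog fun s : UnitAddCircle =>
      toComplex (G (chart D.n x₀ y₀ T₀ u v t (M, s))) := by
  set q := G.symm 0 with hq
  obtain ⟨B, hB⟩ := (isCompact_univ (X := unitInterval)).exists_bound_of_continuousOn
    (f := fun σ : unitInterval => actionOf D.n T₀ ((σ : ℝ) • q))
    ((IsReferenceSolution.continuous_actionOf D.n T₀).comp (by fun_prop)).continuousOn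
  obtain ⟨N, hNμ, hN0, hN⟩ := exists_le_nearId hψ
  set M := max (max μ₀ N) (2 * B + 1) with hM
  have hMN : N ≤ M := (le_max_right _ _).trans (le_max_left _ _)
  have hMB : 2 * B + 1 ≤ M := le_max_right _ _
  have hMμ : μs < M := hNμ.trans_le hMN
  refine ⟨M, (le_max_left _ _).trans (le_max_left _ _), fun hlog => ?_⟩
  have h1 := hasLog_comp_homeomorph G.symm (p := 0)
    (f := fun s : UnitAddCircle => G (chart D.n x₀ y₀ T₀ u v t (M, s))) (by simpa using hlog)
  simp only [Homeomorph.symm_apply_apply] at h1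
  have hcc : Continuous fun s : UnitAddCircle => chart D.n x₀ y₀ T₀ u v t (M, s) :=
    (continuousOn_chart href hψ t).comp_continuous (by fun_prop) fun _ => hMμ
  have hiff := hasLog_iff_of_family isPreconnected_univ
    (fun (σ : unitInterval) (s : UnitAddCircle) =>
      toComplex (chart D.n x₀ y₀ T₀ u v t (M, s) - (σ : ℝ) • q))
    (continuous_toComplex.comp ((hcc.comp continuous_snd).sub (by fun_prop))).continuousOn
    (fun σ _ s => ?_) (mem_univ (0 : unitInterval)) (mem_univ (1 : unitInterval))
  · simp only [Icc.coe_zero, Icc.coe_one, zero_smul, sub_zero, one_smul] at hiff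
    exact not_hasLog_chart_circle href hψ t hMμ (hiff.2 h1)
  · rw [Ne, toComplex_eq_zero, sub_eq_zero]
    intro h
    have h2 := (le_abs_self _).trans (hB σ (mem_univ _))
    have h3 : M / 2 ≤ (nearId u v t (lift (M, s))).1 := hN t (lift (M, s)) hMN
    rw [← h, chart, planeMap, href.actionOf_actionAngle (by linarith)] at h2
    linarith

/-- A restriction of an area-preserving homeomorphism of the plane has the intersection property: both
the plane curve of a circle in its domain and the image of this curve wind around the origin. -/
theorem intersectionProperty_of_isChartOf (href : IsReferenceSolution D.n x₀ y₀ T₀)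
    (hψ : IsNormalForm D x₀ y₀ T₀ u v h₁ h₂ μs ε₁) {t : ℝ} {R : Cyl → Cyl → Prop}
    {G : (ℝ × ℝ) ≃ₜ (ℝ × ℝ)} (hR : IsChartOf D x₀ y₀ T₀ u v μs t t R G)
    (hG : IsLocallyUnimodular G) {μ₀ : ℝ} (hμ₀ : annulus μ₀ ⊆ dom R) :
    IntersectionProperty R μ₀ := by
  rintro c - ⟨m, hm, hhom⟩
  have hup : annulus μ₀ ⊆ upperCyl μs := fun z hz => by
    obtain ⟨w, hw⟩ := hμ₀ hz
    exact (hR z w hw).1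
  have hcont := (continuousOn_chart href hψ t).mono hup
  have hf : Continuous fun s => chart D.n x₀ y₀ T₀ u v t (c s) :=
    hcont.comp_continuous (by fun_prop) fun s => (c s).2
  have hcF := continuous_toComplex.comp_continuousOn hcont
  have hcG := (continuous_toComplex.comp G.continuous).comp_continuousOn hcont
  -- the charts avoid the origin, and so does `G` on the annulus, where it represents `R`
  have hG0 : ∀ z ∈ annulus μ₀, toComplex (G (chart D.n x₀ y₀ T₀ u v t z)) ≠ 0 := by
    intro z hz
    obtain ⟨w, hw⟩ := hμ₀ hz
    rw [Ne, toComplex_eq_zero, ← (hR z w hw).2.2]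
    exact chart_ne_zero href hψ t (hR z w hw).2.1
  have h1 : ¬ HasLog fun s => toComplex (chart D.n x₀ y₀ T₀ u v t (c s)) := fun h =>
    not_hasLog_chart_circle href hψ t (m := m) (hup (show ((m, 0) : Cyl) ∈ annulus μ₀ from hm))
      ((hasLog_iff_of_homotopic hhom hcF fun z hz => by
        rw [Function.comp_apply, Ne, toComplex_eq_zero]
        exact chart_ne_zero href hψ t (hup hz)).1 h)
  obtain ⟨M, hM, hMlog⟩ := exists_not_hasLog_homeomorph_chart href hψ t G μ₀
  have h2 : ¬ HasLog fun s => toComplex (G (chart D.n x₀ y₀ T₀ u v t (c s))) := fun h =>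
    hMlog ((hasLog_iff_of_circles hm hM hcG hG0).1 ((hasLog_iff_of_homotopic hhom hcG hG0).1 h))
  obtain ⟨_, ⟨s, rfl⟩, s', hs'⟩ := range_inter_range_nonempty hf G (p := 0)
    (fun K hK => (hG.measurableSet_and_volume_image hK.measurableSet G.injective.injOn).2)
    (by simpa using h1) (by simpa using h2)
  obtain ⟨w, hw⟩ := hμ₀ (c s).2
  have hws : w = c s' := injOn_chart href hψ t (hR _ w hw).2.1 (hup (c s').2)
    ((hR _ w hw).2.2.trans hs'.symm)
  exact ⟨w, ⟨_, ⟨s, rfl⟩, hw⟩, s', hws.symm⟩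

end intersection

end Duffing

end

theorem lemma5p2 (D : Duffing.ImpulsiveDuffing) (x₀ y₀ : ℝ → ℝ) (T₀ : ℝ)
    (href : Duffing.IsReferenceSolution D.n x₀ y₀ T₀)
    (u v : ℝ → ℝ → ℝ → ℝ) (h₁ : ℝ → ℝ → ℝ) (h₂ : ℝ → ℝ → ℝ → ℝ) (μs ε₁ : ℝ)
    (hψ : Duffing.IsNormalForm D x₀ y₀ T₀ u v h₁ h₂ μs ε₁)
    (hjump : D.JumpCondition) :
    -- the flow maps between the impulses are area-preserving
    (∀ j ≤ D.k, Duffing.IsAreaPreservingOn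
      (Duffing.flowRel (Duffing.normalHam D.n T₀ h₁ h₂) μs (D.tStart j) (D.tEnd j))
      (Duffing.dom
        (Duffing.flowRel (Duffing.normalHam D.n T₀ h₁ h₂) μs (D.tStart j) (D.tEnd j)))) ∧
    -- the jump maps and the time 1 map are locally area-preserving
    (∀ j, 1 ≤ j → j ≤ D.k →
      Duffing.IsLocallyAreaPreserving (Duffing.jumpRel D x₀ y₀ T₀ u v μs j)) ∧
    Duffing.IsLocallyAreaPreserving (Duffing.timeOneRel D x₀ y₀ T₀ u v h₁ h₂ μs) ∧
    -- if the plane jump maps tend to infinity at infinity, then both are area-preserving, and the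
    -- time 1 map is defined for large action and has the intersection property
    ((∀ j, 1 ≤ j → j ≤ D.k →
        Tendsto (D.jump j) (cocompact (ℝ × ℝ)) (cocompact (ℝ × ℝ))) →
      (∀ j, 1 ≤ j → j ≤ D.k → Duffing.IsAreaPreservingOn
        (Duffing.jumpRel D x₀ y₀ T₀ u v μs j)
        (Duffing.dom (Duffing.jumpRel D x₀ y₀ T₀ u v μs j))) ∧
      Duffing.IsAreaPreservingOn (Duffing.timeOneRel D x₀ y₀ T₀ u v h₁ h₂ μs)
        (Duffing.dom (Duffing.timeOneRel D x₀ y₀ T₀ u v h₁ h₂ μs)) ∧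
      (∃ μ' : ℝ, ∀ μ₀ ≥ μ',
        Duffing.annulus μ₀ ⊆ Duffing.dom (Duffing.timeOneRel D x₀ y₀ T₀ u v h₁ h₂ μs)) ∧
      ∀ μ₀ : ℝ,
        Duffing.annulus μ₀ ⊆ Duffing.dom (Duffing.timeOneRel D x₀ y₀ T₀ u v h₁ h₂ μs) →
        Duffing.IntersectionProperty (Duffing.timeOneRel D x₀ y₀ T₀ u v h₁ h₂ μs) μ₀) := by
  have hflow : ∀ j, ∃ Φ : (ℝ × ℝ) ≃ₜ (ℝ × ℝ), j ≤ D.k → Duffing.IsLocallyUnimodular Φ ∧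
      Duffing.IsChartOf D x₀ y₀ T₀ u v μs (D.tStart j) (D.tEnd j)
        (Duffing.flowRel (Duffing.normalHam D.n T₀ h₁ h₂) μs (D.tStart j) (D.tEnd j)) Φ := by
    intro j
    by_cases hj : j ≤ D.k
    · obtain ⟨Φ, hΦ⟩ := Duffing.exists_isChartOf_flowRel href hψ (D.tStart_le_tEnd hj)
      exact ⟨Φ, fun _ => hΦ⟩
    · exact ⟨Homeomorph.refl _, fun h => absurd h hj⟩
  choose Φ hΦ using hflow
  have hone := Duffing.isChartOf_timeOneRel (Φ := fun j => Φ j) href hψ fun j hj => (hΦ j hj).2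
  have hG := Duffing.isLocallyUnimodular_composedMap (Φ := fun j => Φ j) hjump
    (fun j hj => (hΦ j hj).1) le_rfl
  refine ⟨fun j hj => Duffing.isAreaPreservingOn_of_isChartOf href hψ (hΦ j hj).2 (hΦ j hj).1
      Subset.rfl (Φ j).injective.injOn,
    fun j h1 hj => Duffing.isLocallyAreaPreserving_of_isChartOf href hψ
      (Duffing.isChartOf_jumpRel href hψ j) (Duffing.isLocallyUnimodular_jump hjump h1 hj),
    Duffing.isLocallyAreaPreserving_of_isChartOf href hψ hone hG, fun hp => ?_⟩
  have hJ := fun j h1 hj => Duffing.exists_homeomorph_jump hjump h1 hj (hp j h1 hj)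
  obtain ⟨G, hGeq⟩ := Duffing.exists_homeomorph_composedMap (Φ := Φ) hJ (le_refl D.k)
  rw [← hGeq] at hone hG
  refine ⟨fun j h1 hj => ?_, Duffing.isAreaPreservingOn_of_isChartOf href hψ hone hG Subset.rfl
    G.injective.injOn, ?_, fun μ₀ hμ₀ =>
      Duffing.intersectionProperty_of_isChartOf href hψ hone hG hμ₀⟩
  · obtain ⟨J, hJeq⟩ := hJ j h1 hj
    exact Duffing.isAreaPreservingOn_of_isChartOf href hψ (Duffing.isChartOf_jumpRel href hψ j)
      (Duffing.isLocallyUnimodular_jump hjump h1 hj) Subset.rfl (hJeq ▸ J.injective.injOn)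
  · obtain ⟨N, hN⟩ := Duffing.exists_orbit href hψ hp le_rfl 0
    refine ⟨N, fun μ₀ hμ₀ z hz => ?_⟩
    obtain ⟨a, b, ha, hflow, hjmp, -⟩ := hN z (le_trans hμ₀ hz)
    exact ⟨b D.k, a, b, ha, rfl, hflow, hjmp⟩
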